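/- **Setting.** Let $\Omega\subset\mathbb R^2$ be a bounded open convex polygon and let $\Gamma\subset\Omega$ be a smooth (compact, internal) interface dividing $\Omega$ into two open sets $\Omega_1,\Omega_2$. Let $\mathbf n$ be a unit normal field of $\Gamma$, pointing into $\Omega_1$ everywhere or into $\Omega_2$ everywhere (either convention is allowed). Let $\alpha=\alpha_i>0$ be constant on $\Omega_i$, $a>0$, $y_d,u_a,u_b\in L^2(\Omega)$, $g\in H^{1/2}(\Gamma)$, and $U_{ad}=\{u\in L^2(\Omega): u_a\le u\le u_b \text{ a.e.}\}$. Write $(\cdot,\cdot)$ and $\|\cdot\|_0$ for the inner product and norm of $L^2(\Omega)$, and $[v]=v|_{\Omega_1}-v|_{\Omega_2}$ on $\Gamma$. *Continuous problem.* $(y,p,u)\in H^1_0(\Omega)\times H^1_0(\Omega)\times U_{ad}$ satisfies $(\alpha\nabla y,\nabla v)=(u,v)+(g,v)_\Gamma$ and $(\alpha\nabla v,\nabla p)=(y-y_d,v)$ for all $v\in H^1_0(\Omega)$, and $(p+au,v-u)\ge 0$ for all $v\in U_{ad}$. *Mesh.* Let $\mathcal T_h$ be a conforming triangulation of $\overline\Omega$,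 $h_T$ the diameter of $T$, $h=\max_T h_T$, and $\rho_T$ the diameter of the largest ball in $T$. Interface elements ($T\in\mathcal T_h^\Gamma$) are the triangles whose interior meets $\Gamma$; put $\Gamma_T=\Gamma\cap T$. Assume, with constants $\sigma,\kappa$: $h_T\le\sigma\rho_T$ for all $T$; $h\le\kappa h_T$ for all interface elements; $\Gamma$ meets the boundary of each interface element in exactly two distinct points, lying on different edges; $\Gamma_T$ is the graph of a function over the segment joining these two points; and an element that is not an interface element is touched by $\Gamma$ at most at its vertices. *Scheme.* Let $V_h^P$ be the continuous piecewise linear functions on $\mathcal T_h$, with nodal basis $\varphi_i$ at the mesh points $P_i$. For each $i$ with $\operatorname{supp}\varphi_i\cap\Gamma\ne\emptyset$ and $P_i$ on the $\Omega_m$ side of $\Gamma$, let $\widetilde\varphi_i$ be $0$ on that side and $\varphi_i$ elsewhere. Let $V_h$ be the functions in $V_h^P+\operatorname{span}\{\widetilde\varphi_i\}$ that vanish on $\partial\Omega$. On $T\in\mathcal T_h^\Gamma$ put $k_m=|T\cap\Omega_m|/|T|$ and $\{\phi\}=k_1\phi_1+k_2\phi_2$, where $\phi_m$ is the trace of $\phi|_{\Omega_m}$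 on $\Gamma$. With $\lambda=\widetilde C h^{-1}\max\{\alpha_1,\alpha_2\}$ let $$a_h(v,w)=(\alpha\nabla v,\nabla w)_{\Omega_1\cup\Omega_2}-(\{\alpha\nabla_{\mathbf n}v\},[w])_\Gamma-(\{\alpha\nabla_{\mathbf n}w\},[v])_\Gamma+\lambda([v],[w])_\Gamma,$$ $$l_u(v)=(u,v)+(k_2g,v|_{\Omega_1})_\Gamma+(k_1g,v|_{\Omega_2})_\Gamma,$$ $$|||v|||^2=\|\nabla v\|^2_{0,\Omega_1\cup\Omega_2}+\sum_{T\in\mathcal T_h^\Gamma}h_T\|\{\nabla_{\mathbf n}v\}\|^2_{0,\Gamma_T}+\sum_{T\in\mathcal T_h^\Gamma}h_T^{-1}\|[v]\|^2_{0,\Gamma_T}.$$ *Discrete problem.* $(y_h,p_h,u_h)\in V_h\times V_h\times U_{ad}$ satisfies $a_h(y_h,v_h)=l_{u_h}(v_h)$ and $a_h(v_h,p_h)=(y_h-y_d,v_h)$ for all $v_h\in V_h$, and $(p_h+au_h,v-u_h)\ge0$ for all $v\in U_{ad}$. Further, $(y^h,p^h)\in V_h\times V_h$ satisfies $a_h(y^h,v_h)=l_u(v_h)$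 and $a_h(v_h,p^h)=(y-y_d,v_h)$ for all $v_h\in V_h$. **Theorem.** There are constants $C_0>0$ and $C$, depending only on $\Omega,\Gamma,\alpha_1,\alpha_2,\sigma,\kappa$ (in particular not on $h$, the mesh, the position of $\Gamma$ relative to it, $a$, or the data), such that for every $\widetilde C\ge C_0$, every mesh, and all data and solutions as above, $$a^{1/2}\|u-u_h\|_0+\|y-y_h\|_0\le C\big(\|y-y^h\|_0+a^{-1/2}\|p-p^h\|_0\big),$$ $$\|p-p_h\|_0\le C\big(\|p-p^h\|_0+\|y-y_h\|_0\big),$$ $$|||y-y_h|||\le C\big(|||y-y^h|||+\|u-u_h\|_0\big),$$ $$|||p-p_h|||\le C\big(|||p-p^h|||+\|y-y_h\|_0\big).$$ -/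

import Mathlib

open MeasureTheory Set Filter Topology
open scoped NNReal ENNReal

noncomputable section

namespace NitscheXFEM

/-- The Euclidean plane. -/
abbrev Plane := EuclideanSpace ℝ (Fin 2)

/-! ### The domain and the interface -/

/-- A bounded open convex polygon `Ω` together with a smooth interface `Γ` that lies inside `Ω`
and divides it into two open sets. The interface is given by a smooth function `φ` which vanishes
exactly on `Γ`, with non-zero gradient there, and is negative on one side `Ω₁` and positive on the
other side `Ω₂`. -/
structure InterfaceDomain where
  /-- the domain -/
  Ω : Set Plane
  /-- a function that is negative in `Ω₁`, positive in `Ω₂` and zero on the interface -/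
  φ : Plane → ℝ
  polygon : ∃ V : Finset Plane, Ω = interior (convexHull ℝ (V : Set Plane))
  nonempty : Ω.Nonempty
  smooth : ContDiff ℝ (⊤ : ℕ∞) φ
  internal : ∀ x ∈ frontier Ω, φ x ≠ 0
  regular : ∀ x ∈ Ω, φ x = 0 → gradient φ x ≠ 0

namespace InterfaceDomain

variable (D : InterfaceDomain)

/-- The interface. -/
def Γ : Set Plane := {x ∈ D.Ω | D.φ x = 0}

/-- The first subdomain. -/
def Ω₁ : Set Plane := {x ∈ D.Ω | D.φ x < 0}

/-- The second subdomain. -/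
def Ω₂ : Set Plane := {x ∈ D.Ω | 0 < D.φ x}

/-- Lebesgue measure on `Ω`. -/
def vol : Measure Plane := volume.restrict D.Ω

/-- The unit normal field of the interface; it points into `Ω₂` for `s = 1` and into `Ω₁` for
`s = -1`. -/
def normal (s : ℝ) (x : Plane) : Plane := s • (‖gradient D.φ x‖⁻¹ • gradient D.φ x)

/-- The piecewise constant coefficient, equal to `α₁` on `Ω₁` and to `α₂` on `Ω₂`. -/
def coeff (α₁ α₂ : ℝ) (x : Plane) : ℝ := if D.φ x < 0 then α₁ else α₂

/-- `g ∈ H^{1/2}(Γ)`: square integrable with respect to arc length, with finite Gagliardo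
seminorm. -/
def MemHHalf (g : Plane → ℝ) : Prop :=
  MemLp g 2 (μH[1].restrict D.Γ) ∧
    ∫⁻ x in D.Γ, ∫⁻ z in D.Γ, ENNReal.ofReal ((g x - g z) ^ 2 / dist x z ^ 2) ∂μH[1] ∂μH[1] < ∞

/-- `y ∈ H¹₀(Ω)` with weak gradient `G`: the pair `(y, G)` is a limit in `L²(Ω)` of pairs
`(ψ, ∇ψ)` with `ψ` smooth and compactly supported in `Ω`. -/
def MemH10 (y : Plane → ℝ) (G : Plane → Plane) : Prop :=
  MemLp y 2 D.vol ∧ MemLp G 2 D.vol ∧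
    ∀ ε : ℝ≥0∞, 0 < ε → ∃ ψ : Plane → ℝ, ContDiff ℝ (⊤ : ℕ∞) ψ ∧ HasCompactSupport ψ ∧
      tsupport ψ ⊆ D.Ω ∧ eLpNorm (fun x => y x - ψ x) 2 D.vol ≤ ε ∧
      eLpNorm (fun x => G x - gradient ψ x) 2 D.vol ≤ ε

/-- The `L²(Ω)` inner product. -/
def l2inner (v w : Plane → ℝ) : ℝ := ∫ x in D.Ω, v x * w x

/-- The `L²(Ω)` norm. -/
def l2norm (v : Plane → ℝ) : ℝ≥0∞ := eLpNorm v 2 D.vol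

/-- The set of admissible controls. -/
def Uad (ua ub : Plane → ℝ) : Set (Plane → ℝ) :=
  {u | MemLp u 2 D.vol ∧ ∀ᵐ x ∂D.vol, ua x ≤ u x ∧ u x ≤ ub x}

/-! ### Traces on the interface

The trace at a point `x` of the interface of a function on `U` is the limit of its mean values over
`B(x, r) ∩ U` as `r → 0`. For functions continuous up to the interface it is the one-sided limit;
for Sobolev functions the limit exists at almost every point of `Γ` and is the usual trace. -/

/-- The trace at `x` of a function given on `U`. -/
def traceFrom (U : Set Plane) (v : Plane → ℝ) (x : Plane) : ℝ :=
  limUnder (𝓝[>] (0 : ℝ)) fun r => ⨍ z in Metric.ball x r ∩ U, v z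

/-- The jump across the interface: trace from `Ω₁` minus trace from `Ω₂`. -/
def jump (v : Plane → ℝ) (x : Plane) : ℝ :=
  limUnder (𝓝[>] (0 : ℝ)) fun r =>
    (⨍ z in Metric.ball x r ∩ D.Ω₁, v z) - ⨍ z in Metric.ball x r ∩ D.Ω₂, v z

/-- The weighted mean `k₁ (n · G₁) + k₂ (n · G₂)` of the normal traces from both sides of a vector
field `G`. -/
def normalMean (s k₁ k₂ : ℝ) (G : Plane → Plane) (x : Plane) : ℝ :=
  limUnder (𝓝[>] (0 : ℝ)) fun r =>
    inner ℝ (D.normal s x)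
      (k₁ • (⨍ z in Metric.ball x r ∩ D.Ω₁, G z) + k₂ • ⨍ z in Metric.ball x r ∩ D.Ω₂, G z)

/-! ### The continuous problem -/

/-- The weak form `(α∇y, ∇v)`, in terms of the gradients. -/
def bilin (α₁ α₂ : ℝ) (G H : Plane → Plane) : ℝ :=
  ∫ x in D.Ω, D.coeff α₁ α₂ x * inner ℝ (G x) (H x)

/-- The optimality system of the continuous control problem for the state `y` and the co-state `p`
(with weak gradients `Gy`, `Gp`) and the control `u`. -/
structure IsOptimal (α₁ α₂ a : ℝ) (yd ua ub g : Plane → ℝ)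
    (y : Plane → ℝ) (Gy : Plane → Plane) (p : Plane → ℝ) (Gp : Plane → Plane)
    (u : Plane → ℝ) : Prop where
  mem_y : D.MemH10 y Gy
  mem_p : D.MemH10 p Gp
  mem_u : u ∈ D.Uad ua ub
  state : ∀ v Gv, D.MemH10 v Gv →
    D.bilin α₁ α₂ Gy Gv = D.l2inner u v + ∫ x in D.Γ, g x * traceFrom D.Ω v x ∂μH[1]
  costate : ∀ v Gv, D.MemH10 v Gv →
    D.bilin α₁ α₂ Gv Gp = D.l2inner (fun x => y x - yd x) v
  variational : ∀ v ∈ D.Uad ua ub,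
    0 ≤ D.l2inner (fun x => p x + a * u x) (fun x => v x - u x)

end InterfaceDomain

/-! ### Triangulations -/

/-- A conforming triangulation of the closure of `Ω`: a finite simplicial complex that fills it
and all of whose simplices are faces of triangles. -/
structure Triangulation (Ω : Set Plane) extends Geometry.SimplicialComplex ℝ Plane where
  finite_faces : faces.Finite
  pure_faces : ∀ e ∈ faces, ∃ T ∈ faces, T.card = 3 ∧ e ⊆ T
  space_eq : (⋃ e ∈ faces, convexHull ℝ (e : Set Plane)) = closure Ω

/-- The closed triangle with vertex set `T`. -/
def tri (T : Finset Plane) : Set Plane := convexHull ℝ (T : Set Plane)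

/-- The diameter `h_T` of a triangle. -/
def size (T : Finset Plane) : ℝ := Metric.diam (tri T)

/-- The diameter `ρ_T` of the largest ball contained in a triangle. -/
def inSize (T : Finset Plane) : ℝ :=
  sSup {d : ℝ | 0 ≤ d ∧ ∃ c, Metric.closedBall c (d / 2) ⊆ tri T}

namespace Triangulation

variable {Ω : Set Plane} (𝒯 : Triangulation Ω)

/-- The triangles of the triangulation. -/
def elements : Finset (Finset Plane) := 𝒯.finite_faces.toFinset.filter fun T => T.card = 3

/-- The mesh points. -/
def nodes : Set Plane := {P | {P} ∈ 𝒯.faces}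

/-- The mesh size `h`, the largest diameter of a triangle. -/
def meshSize : ℝ := sSup (size '' {T | T ∈ 𝒯.elements})

/-- Non-degeneracy with constant `σ`. -/
def Nondegenerate (σ : ℝ) : Prop := ∀ T ∈ 𝒯.elements, size T ≤ σ * inSize T

/-- The standard space of continuous piecewise linear functions on the closure of `Ω` (extended by
zero to the plane). -/
def linearSpace : Submodule ℝ (Plane → ℝ) where
  carrier := {v | (∀ x ∉ closure Ω, v x = 0) ∧ ContinuousOn v (closure Ω) ∧
    ∀ T ∈ 𝒯.elements, ∃ A : Plane →ᵃ[ℝ] ℝ, ∀ x ∈ tri T, v x = A x}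
  zero_mem' := ⟨fun _ _ => rfl, continuousOn_const, fun _ _ => ⟨0, fun _ _ => rfl⟩⟩
  add_mem' := by
    rintro v w ⟨hv, hv', hv''⟩ ⟨hw, hw', hw''⟩
    refine ⟨fun x hx => by simp [hv x hx, hw x hx], hv'.add hw', fun T hT => ?_⟩
    obtain ⟨A, hA⟩ := hv'' T hT
    obtain ⟨B, hB⟩ := hw'' T hT
    exact ⟨A + B, fun x hx => by simp [hA x hx, hB x hx]⟩
  smul_mem' := by
    rintro c v ⟨hv, hv', hv''⟩
    refine ⟨fun x hx => by simp [hv x hx], hv'.const_smul c, fun T hT => ?_⟩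
    obtain ⟨A, hA⟩ := hv'' T hT
    exact ⟨c • A, fun x hx => by simp [hA x hx]⟩

/-- `b` is the nodal basis function of the mesh point `P`. -/
def IsNodalBasis (P : Plane) (b : Plane → ℝ) : Prop :=
  P ∈ 𝒯.nodes ∧ b ∈ 𝒯.linearSpace ∧ b P = 1 ∧ ∀ Q ∈ 𝒯.nodes, Q ≠ P → b Q = 0

end Triangulation

/-! ### The extended finite element space and the Nitsche scheme -/

section Scheme

variable (D : InterfaceDomain) (𝒯 : Triangulation D.Ω)

/-- The part of the interface in a triangle. -/
def interfacePart (T : Finset Plane) : Set Plane := D.Γ ∩ tri T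

open Classical in
/-- The interface elements: the triangles whose interior meets the interface. -/
def interfaceElements : Finset (Finset Plane) :=
  𝒯.elements.filter fun T => (D.Γ ∩ interior (tri T)).Nonempty

/-- The interface meets the boundary of the triangle `T` in exactly two points `a ≠ b`, which lie
on different edges of `T`, and in the local coordinates with origin `a` whose first axis points to
`b`, the part of the interface in `T` is the graph of a function over the segment from `a` to
`b`. -/
def CutsProperly (T : Finset Plane) : Prop :=
  ∃ a b : Plane, a ≠ b ∧ D.Γ ∩ frontier (tri T) = {a, b} ∧
    (∃ e ⊆ T, ∃ e' ⊆ T, e.card = 2 ∧ e'.card = 2 ∧ e ≠ e' ∧ a ∈ tri e ∧ b ∈ tri e') ∧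
    ∃ τ ν : Plane, τ = (dist a b)⁻¹ • (b - a) ∧ ν = !₂[-(τ 1), τ 0] ∧
      ∃ ψ : ℝ → ℝ, interfacePart D T =
        (fun ξ : ℝ => a + ξ • τ + ψ ξ • ν) '' Icc 0 (dist a b)

/-- The assumptions on the position of the interface relative to the mesh: interface elements are
cut properly, and the other elements are touched by the interface at most at their vertices. -/
def Resolves : Prop :=
  (∀ T ∈ interfaceElements D 𝒯, CutsProperly D T) ∧
    ∀ T ∈ 𝒯.elements, T ∉ interfaceElements D 𝒯 → interfacePart D T ⊆ T

/-- The cut basis functions: for a mesh point `P` whose nodal basis function `b` has a support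
meeting the interface, `b` cut off to zero on the side of the interface on which `P` lies. -/
def cutFunctions : Set (Plane → ℝ) :=
  {w | ∃ P b, 𝒯.IsNodalBasis P b ∧ (tsupport b ∩ D.Γ).Nonempty ∧
    ((D.φ P < 0 ∧ w = indicator {x | 0 ≤ D.φ x} b) ∨
      (0 < D.φ P ∧ w = indicator {x | D.φ x ≤ 0} b))}

/-- The functions that vanish on the boundary of `Ω`. -/
def zeroBoundary (Ω : Set Plane) : Submodule ℝ (Plane → ℝ) where
  carrier := {v | ∀ x ∈ frontier Ω, v x = 0}
  zero_mem' := fun _ _ => rfl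
  add_mem' := fun hv hw x hx => by simp [hv x hx, hw x hx]
  smul_mem' := fun c v hv x hx => by simp [hv x hx]

/-- The extended finite element space `V_h`. -/
def Vh : Submodule ℝ (Plane → ℝ) :=
  (𝒯.linearSpace ⊔ Submodule.span ℝ (cutFunctions D 𝒯)) ⊓ zeroBoundary D.Ω

/-- The area fraction `|T ∩ U| / |T|`. -/
def areaFraction (T : Finset Plane) (U : Set Plane) : ℝ :=
  volume.real (tri T ∩ U) / volume.real (tri T)

/-- The weighted mean `{n · G}` on an interface element `T`, with weights `k_m = |T ∩ Ω_m| / |T|`.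
-/
def nitscheMean (s : ℝ) (T : Finset Plane) (G : Plane → Plane) (x : Plane) : ℝ :=
  D.normalMean s (areaFraction T D.Ω₁) (areaFraction T D.Ω₂) G x

/-- The flux `α ∇v` of a piecewise linear function, `∇v` being its piecewise gradient. -/
def flux (α₁ α₂ : ℝ) (v : Plane → ℝ) (x : Plane) : Plane := D.coeff α₁ α₂ x • gradient v x

/-- The Nitsche bilinear form `a_h` with stabilisation parameter `Ct * h⁻¹ * max α₁ α₂`. Integrals
over the interface are sums over its parts in the interface elements. -/
def ah (s α₁ α₂ Ct : ℝ) (v w : Plane → ℝ) : ℝ :=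
  (∫ x in D.Ω₁ ∪ D.Ω₂, inner ℝ (flux D α₁ α₂ v x) (gradient w x))
    - (∑ T ∈ interfaceElements D 𝒯, ∫ x in interfacePart D T,
        nitscheMean D s T (flux D α₁ α₂ v) x * D.jump w x ∂μH[1])
    - (∑ T ∈ interfaceElements D 𝒯, ∫ x in interfacePart D T,
        nitscheMean D s T (flux D α₁ α₂ w) x * D.jump v x ∂μH[1])
    + Ct * 𝒯.meshSize⁻¹ * max α₁ α₂ *
      ∑ T ∈ interfaceElements D 𝒯, ∫ x in interfacePart D T, D.jump v x * D.jump w x ∂μH[1]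

/-- The right-hand side `(u, v) + (k₂ g, v₁)_Γ + (k₁ g, v₂)_Γ` of the discrete state equation. -/
def load (u g v : Plane → ℝ) : ℝ :=
  D.l2inner u v + ∑ T ∈ interfaceElements D 𝒯,
    ((∫ x in interfacePart D T,
        areaFraction T D.Ω₂ * g x * InterfaceDomain.traceFrom D.Ω₁ v x ∂μH[1])
      + ∫ x in interfacePart D T,
        areaFraction T D.Ω₁ * g x * InterfaceDomain.traceFrom D.Ω₂ v x ∂μH[1])

/-- The mesh dependent norm of a function `v` with piecewise (weak) gradient `G` on `Ω₁ ∪ Ω₂`. -/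
def meshNorm (s : ℝ) (v : Plane → ℝ) (G : Plane → Plane) : ℝ≥0∞ :=
  ((∫⁻ x in D.Ω₁ ∪ D.Ω₂, ‖G x‖ₑ ^ 2)
    + (∑ T ∈ interfaceElements D 𝒯, ENNReal.ofReal (size T) *
        ∫⁻ x in interfacePart D T, ‖nitscheMean D s T G x‖ₑ ^ 2 ∂μH[1])
    + ∑ T ∈ interfaceElements D 𝒯, ENNReal.ofReal (size T)⁻¹ *
        ∫⁻ x in interfacePart D T, ‖D.jump v x‖ₑ ^ 2 ∂μH[1]) ^ (1 / 2 : ℝ)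

/-- `v` solves the Nitsche scheme for the state equation with source `u`. -/
def IsNitscheState (s α₁ α₂ Ct : ℝ) (g u v : Plane → ℝ) : Prop :=
  v ∈ Vh D 𝒯 ∧ ∀ w ∈ Vh D 𝒯, ah D 𝒯 s α₁ α₂ Ct v w = load D 𝒯 u g w

/-- `q` solves the Nitsche scheme for the co-state equation with source `f`. -/
def IsNitscheCostate (s α₁ α₂ Ct : ℝ) (f q : Plane → ℝ) : Prop :=
  q ∈ Vh D 𝒯 ∧ ∀ w ∈ Vh D 𝒯, ah D 𝒯 s α₁ α₂ Ct w q = D.l2inner f w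

/-- The optimality system of the discrete control problem. -/
structure IsDiscreteOptimal (s α₁ α₂ Ct a : ℝ) (yd ua ub g yh ph uh : Plane → ℝ) : Prop where
  mem_u : uh ∈ D.Uad ua ub
  state : IsNitscheState D 𝒯 s α₁ α₂ Ct g uh yh
  costate : IsNitscheCostate D 𝒯 s α₁ α₂ Ct (fun x => yh x - yd x) ph
  variational : ∀ v ∈ D.Uad ua ub,
    0 ≤ D.l2inner (fun x => ph x + a * uh x) (fun x => v x - uh x)

end Scheme

end NitscheXFEM

end

/-! The pairs (y^h, p^h) and (y_h, p_h) solve the same linear schemes with different sources. Their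
differences therefore lie in V_h and satisfy a_h(y^h − y_h, w) = (u − u_h, w) and a_h(w, p^h − p_h)
= (y − y_h, w) for all w in V_h. Testing the first with p^h − p_h and the second with y^h − y_h
gives (u − u_h, p^h − p_h) = (y − y_h, y^h − y_h). Inserted into the sum of the two variational
inequalities, this is `control_error_le`, and Young's inequality in variables scaled by a^{1/2}
yields the first estimate. The other three follow from triangle inequalities and `exists_stability`:
if e in V_h satisfies a_h(e, e) = (f, e), then its L² norm and the root of its energy (broken
gradient plus weighted jump) are bounded by a multiple of ‖f‖.

Stability rests on two facts that are uniform in the mesh and in the way Γ cuts it. The first is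
coercivity, `exists_coercive`. The consistency terms are absorbed by Young's inequality and
`exists_inverse_inequality`: Γ is locally a Lipschitz graph, so Γ_T has length at most a multiple of
h_T, and the area weights k_m compensate for arbitrarily small pieces T ∩ Ω_m because k_m² ≤ k_m.

The second is a Poincaré inequality across the jump, `exists_poincare`. A broken function is joined
over the thin band 0 ≤ φ ≤ ε into a Lipschitz function with compact support, to which ‖v‖_{L²} ≤
‖∇v‖_{L¹} applies. The gradient in the band is of order |[v]|/ε, the width of the band is of order
ε, and as ε → 0 just the L¹ norm of the jump on Γ remains.

Functions of V_h are handled through `IsBroken`: one piecewise linear function per side of Γ, which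
turns jumps and means, defined as limits of averages, into explicit formulas. The errors y − y_h and
p − p_h are less regular; `enorm_limUnder_le_add` makes the mesh dependent norm subadditive up to
constants even where their traces do not exist. -/

namespace NitscheXFEM

/-! ### Piecewise Lipschitz functions -/

/-- A continuous function on a segment that is Lipschitz on each of finitely many closed sets
covering the segment satisfies the Lipschitz estimate between the end points. -/
theorem sub_le_of_finite_closed_cover {ι : Type*} (s : Finset ι) (I : ι → Set ℝ)
    (hI : ∀ k ∈ s, IsClosed (I k)) {a b : ℝ} (hab : a ≤ b) (hcov : Icc a b ⊆ ⋃ k ∈ s, I k)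
    {g : ℝ → ℝ} (hg : ContinuousOn g (Icc a b)) {L : ℝ}
    (hL : ∀ k ∈ s, ∀ x ∈ I k, ∀ z ∈ I k, x ∈ Icc a b → z ∈ Icc a b → |g x - g z| ≤ L * |x - z|) :
    g b - g a ≤ L * (b - a) := by
  -- Fencing argument: it is enough that for each x and each r > L there are points z arbitrarily
  -- close to the right of x with slope below r.
  have key : ∀ ⦃x⦄, x ∈ Icc a b → g x ≤ g a + L * (x - a) := by
    refine image_le_of_liminf_slope_right_le_deriv_boundary hg (B' := fun _ => L) (by simp)
      (by fun_prop) ?_ ?_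
    · intro x _
      have := (((hasDerivAt_id x).sub_const a).const_mul L).const_add (g a)
      simpa using this.hasDerivWithinAt
    · intro x hx r hr
      have hfreq : ∃ᶠ z in 𝓝[>] x, ∃ k ∈ s, z ∈ I k := by
        refine Eventually.frequently ?_
        filter_upwards [Ioc_mem_nhdsGT hx.2] with z hz
        have := hcov (show z ∈ Icc a b from ⟨hx.1.trans hz.1.le, hz.2⟩)
        simpa using this
      -- Pigeonhole: one of the finitely many sets is met arbitrarily close to the right of x. Being
      -- closed it contains x too, so its Lipschitz bound applies to the pair.
      obtain ⟨k, hk, hfk⟩ : ∃ k ∈ s, ∃ᶠ z in 𝓝[>] x, z ∈ I k := by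
        by_contra! h
        refine hfreq ?_
        have : ∀ᶠ z in 𝓝[>] x, ∀ k ∈ s, z ∉ I k := by
          rw [Filter.eventually_all_finset]
          intro k hk
          simpa using h k hk
        filter_upwards [this] with z hz
        push Not
        exact hz
      have hxk : x ∈ I k := by
        have : ∃ᶠ z in 𝓝 x, z ∈ I k := hfk.filter_mono nhdsWithin_le_nhds
        exact (hI k hk).closure_eq ▸ mem_closure_iff_frequently.2 this
      refine (hfk.and_eventually (Ioc_mem_nhdsGT hx.2)).mono ?_
      rintro z ⟨hz, hz'⟩
      refine lt_of_le_of_lt ?_ hr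
      have h1 := hL k hk z hz x hxk ⟨hx.1.trans hz'.1.le, hz'.2⟩ ⟨hx.1, hx.2.le⟩
      have hpos : 0 < z - x := sub_pos.2 hz'.1
      rw [slope_def_field, div_le_iff₀ hpos]
      rw [abs_of_pos hpos] at h1
      exact (le_abs_self _).trans h1
  have := key (right_mem_Icc.2 hab)
  linarith

/-- A continuous function that is Lipschitz on each of finitely many closed sets covering the space
is Lipschitz. -/
theorem lipschitzWith_of_finite_closed_cover {E : Type*} [NormedAddCommGroup E] [NormedSpace ℝ E]
    {ι : Type*} (s : Finset ι) (S : ι → Set E) (hS : ∀ k ∈ s, IsClosed (S k))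
    (hcov : ∀ x, ∃ k ∈ s, x ∈ S k) {v : E → ℝ} (hv : Continuous v) {K : ℝ≥0}
    (hK : ∀ k ∈ s, LipschitzOnWith K v (S k)) : LipschitzWith K v := by
  have main : ∀ x z, v z - v x ≤ K * dist x z := by
    intro x z
    set l : ℝ → E := fun t => AffineMap.lineMap x z t with hl
    have hlc : Continuous l := AffineMap.lineMap_continuous
    have := sub_le_of_finite_closed_cover s (fun k => l ⁻¹' S k)
      (fun k hk => (hS k hk).preimage hlc) (zero_le_one (α := ℝ))
      (fun t _ => by simpa using hcov (l t)) (g := v ∘ l) (hv.comp hlc).continuousOn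
      (L := K * dist x z) (by
        intro k hk t ht t' ht' _ _
        have h := (hK k hk).dist_le_mul _ ht _ ht'
        rw [Real.dist_eq] at h
        refine h.trans_eq ?_
        rw [hl]
        simp only [dist_lineMap_lineMap, Real.dist_eq]
        ring)
    simpa [hl] using this
  refine LipschitzWith.of_dist_le_mul fun x z => ?_
  rw [Real.dist_eq, abs_le]
  constructor
  · have := main x z; linarith
  · have := main z x; rw [dist_comm] at this; linarith

/-! ### Slicing the plane by coordinate lines -/

/-- The point with `i`-th coordinate `t` and other coordinate `s`. -/
def pt (i : Fin 2) (s t : ℝ) : Plane := WithLp.toLp 2 fun k => if k = i then t else s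

theorem measurePreserving_pt (i : Fin 2) :
    MeasurePreserving (fun q : ℝ × ℝ => pt i q.1 q.2) (volume.prod volume) volume := by
  have h1 : MeasurePreserving
      (fun q : ℝ × ℝ => WithLp.toLp 2 ((MeasurableEquiv.finTwoArrow (α := ℝ)).symm q))
      (volume.prod volume) (volume : Measure Plane) :=
    (PiLp.volume_preserving_toLp (Fin 2)).comp (volume_preserving_finTwoArrow ℝ).symm
  fin_cases i
  · have h2 := h1.comp (Measure.measurePreserving_swap (μ := (volume : Measure ℝ))
      (ν := (volume : Measure ℝ)))
    convert h2 using 1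
    ext q k
    fin_cases k <;> simp [pt, MeasurableEquiv.finTwoArrow]
  · convert h1 using 1
    ext q k
    fin_cases k <;> simp [pt, MeasurableEquiv.finTwoArrow]

theorem lintegral_plane (i : Fin 2) {f : Plane → ℝ≥0∞} (hf : Measurable f) :
    ∫⁻ x, f x = ∫⁻ s, ∫⁻ t, f (pt i s t) := by
  rw [← (measurePreserving_pt i).lintegral_comp hf, lintegral_prod]
  exact (hf.comp (measurePreserving_pt i).measurable).aemeasurable

theorem ae_ae_of_ae_plane (i : Fin 2) {P : Plane → Prop} (h : ∀ᵐ x, P x) :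
    ∀ᵐ s : ℝ, ∀ᵐ t : ℝ, P (pt i s t) :=
  Measure.ae_ae_of_ae_prod ((measurePreserving_pt i).quasiMeasurePreserving.ae h)

theorem pt_eq_add (i : Fin 2) (s t : ℝ) :
    pt i s t = pt i s 0 + t • EuclideanSpace.single i (1 : ℝ) := by
  ext k
  by_cases hk : k = i <;> simp [pt, hk]

theorem dist_pt (i : Fin 2) (s t t' : ℝ) : dist (pt i s t) (pt i s t') = |t - t'| := by
  rw [pt_eq_add, pt_eq_add i s t', dist_add_left, dist_eq_norm, ← sub_smul, norm_smul]
  simp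

theorem pt_zero_eq_pt_one (s t : ℝ) : pt 0 t s = pt 1 s t := by
  ext k
  fin_cases k <;> simp [pt]

theorem continuous_pt (i : Fin 2) (s : ℝ) : Continuous (pt i s) := by
  have : pt i s = fun t => pt i s 0 + t • EuclideanSpace.single i (1 : ℝ) := by
    ext t; rw [pt_eq_add]
  rw [this]; fun_prop

/-! ### The Gagliardo-Nirenberg-Sobolev inequality for Lipschitz functions in the plane -/

/-- Fundamental theorem of calculus, starting from a point left of the support; Lipschitz functions
are absolutely continuous, so the derivative almost everywhere suffices. -/
theorem enorm_le_lintegral_enorm_deriv {g : ℝ → ℝ} {K : ℝ≥0} (hg : LipschitzWith K g)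
    (hc : HasCompactSupport g) (t : ℝ) : ‖g t‖ₑ ≤ ∫⁻ x, ‖deriv g x‖ₑ := by
  obtain ⟨R, hR⟩ := hc.isCompact.isBounded.subset_closedBall (0 : ℝ)
  set a : ℝ := min t (-(|R| + 1)) with ha
  have hga : g a = 0 := by
    by_contra h
    have := hR (subset_tsupport g h)
    rw [Real.closedBall_eq_Icc] at this
    have h1 : a ≤ -(|R| + 1) := min_le_right _ _
    have := this.1
    have := le_abs_self R
    linarith
  have hat : a ≤ t := min_le_left _ _
  have hac : AbsolutelyContinuousOnInterval g a t :=
    (hg.lipschitzOnWith (s := uIcc a t)).absolutelyContinuousOnInterval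
  have h := hac.integral_deriv_eq_sub
  rw [hga, sub_zero] at h
  rw [← h, intervalIntegral.integral_of_le hat]
  exact (enorm_integral_le_lintegral_enorm _).trans (setLIntegral_le_lintegral _ _)

/-- Rademacher and Fubini: on almost every line in direction `i` the function is differentiable at
almost every point, where the chain rule bounds the derivative along the line by the full one. -/
theorem ae_enorm_le_lintegral_enorm_fderiv {v : Plane → ℝ} {K : ℝ≥0} (hv : LipschitzWith K v)
    (hc : HasCompactSupport v) (i : Fin 2) :
    ∀ᵐ s : ℝ, ∀ t, ‖v (pt i s t)‖ₑ ≤ ∫⁻ t', ‖fderiv ℝ v (pt i s t')‖ₑ := by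
  filter_upwards [ae_ae_of_ae_plane i hv.ae_differentiableAt] with s hs t
  have hiso : Isometry (pt i s) := Isometry.of_dist_eq fun a b => by rw [dist_pt, Real.dist_eq]
  have h1 : LipschitzWith K (fun t => v (pt i s t)) := by
    simpa [Function.comp_def] using hv.comp hiso.lipschitz
  have h2 : HasCompactSupport (fun t => v (pt i s t)) :=
    hc.comp_isClosedEmbedding hiso.isClosedEmbedding
  refine (enorm_le_lintegral_enorm_deriv h1 h2 t).trans (lintegral_mono_ae ?_)
  filter_upwards [hs] with t' ht'
  have hd : HasDerivAt (pt i s) (EuclideanSpace.single i (1 : ℝ)) t' := by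
    have : pt i s = fun t => pt i s 0 + t • EuclideanSpace.single i (1 : ℝ) := by
      ext t; rw [pt_eq_add]
    rw [this]
    simpa using ((hasDerivAt_id t').smul_const (EuclideanSpace.single i (1 : ℝ))).const_add
      (pt i s 0)
  have := ht'.hasFDerivAt.comp_hasDerivAt t' hd
  have h3 : deriv (fun t => v (pt i s t)) t'
      = fderiv ℝ v (pt i s t') (EuclideanSpace.single i (1 : ℝ)) := this.deriv
  rw [h3, enorm_le_iff_norm_le]
  simpa using (fderiv ℝ v (pt i s t')).le_opNorm (EuclideanSpace.single i (1 : ℝ))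

/-- Gagliardo's product trick: |v(s, t)| is at most k(s) and at most l(t), the line integrals in the
two directions, and k(s) l(t) integrates to a product. The L¹ norm on the right is essential later:
a gradient of size 1/ε on a band of area of order ε stays bounded in L¹ but not in L². -/
theorem lintegral_sq_le_sq_lintegral_fderiv {v : Plane → ℝ} {K : ℝ≥0} (hv : LipschitzWith K v)
    (hc : HasCompactSupport v) :
    ∫⁻ x, ‖v x‖ₑ ^ 2 ≤ (∫⁻ x, ‖fderiv ℝ v x‖ₑ) ^ 2 := by
  have hm : Measurable fun x => ‖fderiv ℝ v x‖ₑ := (measurable_fderiv ℝ v).enorm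
  have hm' : Measurable fun q : ℝ × ℝ => ‖fderiv ℝ v (pt 1 q.1 q.2)‖ₑ :=
    hm.comp (measurePreserving_pt 1).measurable
  set k : ℝ → ℝ≥0∞ := fun s => ∫⁻ t', ‖fderiv ℝ v (pt 1 s t')‖ₑ with hk
  set l : ℝ → ℝ≥0∞ := fun t => ∫⁻ s', ‖fderiv ℝ v (pt 1 s' t)‖ₑ with hl
  have hl' : ∀ t, l t = ∫⁻ s', ‖fderiv ℝ v (pt 0 t s')‖ₑ := by
    intro t; simp only [hl, pt_zero_eq_pt_one]
  have hk_int : ∫⁻ s, k s = ∫⁻ x, ‖fderiv ℝ v x‖ₑ := (lintegral_plane 1 hm).symm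
  have hl_int : ∫⁻ t, l t = ∫⁻ x, ‖fderiv ℝ v x‖ₑ := by
    rw [lintegral_plane 0 hm]; simp only [hl']
  have hlm : Measurable l := hm'.lintegral_prod_left'
  have hvm : Measurable fun x => ‖v x‖ₑ ^ 2 := (hv.continuous.measurable.enorm).pow_const 2
  rw [lintegral_plane 1 hvm]
  have h1 := ae_enorm_le_lintegral_enorm_fderiv hv hc 1
  have h0 := ae_enorm_le_lintegral_enorm_fderiv hv hc 0
  calc ∫⁻ s, ∫⁻ t, ‖v (pt 1 s t)‖ₑ ^ 2 ≤ ∫⁻ s, ∫⁻ t, k s * l t := by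
        refine lintegral_mono_ae ?_
        filter_upwards [h1] with s hs
        refine lintegral_mono_ae ?_
        filter_upwards [h0] with t ht
        rw [sq]
        have ht' := ht s
        rw [pt_zero_eq_pt_one, ← hl'] at ht'
        exact mul_le_mul' (hs t) ht'
    _ = ∫⁻ s, k s * ∫⁻ t, l t := by
        refine lintegral_congr fun s => ?_
        rw [lintegral_const_mul _ hlm]
    _ = (∫⁻ x, ‖fderiv ℝ v x‖ₑ) ^ 2 := by
        rw [lintegral_mul_const _ (hm'.lintegral_prod_right'), hk_int, hl_int, sq]


/-! ### Basic facts on the domain and the interface -/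

namespace InterfaceDomain

variable (D : InterfaceDomain)

theorem isOpen_Ω : IsOpen D.Ω := by
  obtain ⟨V, hV⟩ := D.polygon
  rw [hV]; exact isOpen_interior

theorem convex_Ω : Convex ℝ D.Ω := by
  obtain ⟨V, hV⟩ := D.polygon
  rw [hV]; exact (convex_convexHull ℝ _).interior

theorem isBounded_Ω : Bornology.IsBounded D.Ω := by
  obtain ⟨V, hV⟩ := D.polygon
  rw [hV]
  exact (((V.finite_toSet).isCompact_convexHull (𝕜 := ℝ)).isBounded).subset interior_subset

theorem isCompact_closure_Ω : IsCompact (closure D.Ω) := D.isBounded_Ω.isCompact_closure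

theorem continuous_φ : Continuous D.φ := D.smooth.continuous

theorem differentiable_φ : Differentiable ℝ D.φ := D.smooth.differentiable (by simp)

theorem continuous_gradient_φ : Continuous (gradient D.φ) := by
  have h : Continuous (fderiv ℝ D.φ) := D.smooth.continuous_fderiv (by simp)
  exact (InnerProductSpace.toDual ℝ Plane).symm.continuous.comp h

theorem mem_Ω_of_mem_closure {x : Plane} (hx : x ∈ closure D.Ω) (h : D.φ x = 0) : x ∈ D.Ω := by
  by_contra h'
  refine D.internal x ⟨hx, ?_⟩ h
  rwa [D.isOpen_Ω.interior_eq]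

theorem Γ_eq : D.Γ = closure D.Ω ∩ D.φ ⁻¹' {0} := by
  ext x
  exact ⟨fun h => ⟨subset_closure h.1, h.2⟩, fun h => ⟨D.mem_Ω_of_mem_closure h.1 h.2, h.2⟩⟩

theorem isCompact_Γ : IsCompact D.Γ := by
  rw [D.Γ_eq]
  exact D.isCompact_closure_Ω.inter_right (isClosed_singleton.preimage D.continuous_φ)

theorem measurableSet_Γ : MeasurableSet D.Γ := D.isCompact_Γ.isClosed.measurableSet

theorem isOpen_Ω₁ : IsOpen D.Ω₁ := D.isOpen_Ω.inter (isOpen_lt D.continuous_φ continuous_const)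

theorem isOpen_Ω₂ : IsOpen D.Ω₂ := D.isOpen_Ω.inter (isOpen_lt continuous_const D.continuous_φ)

theorem volume_Ω_lt_top : volume D.Ω < ∞ := D.isBounded_Ω.measure_lt_top

instance : IsFiniteMeasure D.vol := ⟨by
  rw [vol, Measure.restrict_apply_univ]; exact D.volume_Ω_lt_top⟩

/-! ### The interface as a graph -/

/-- The coordinate transversal to direction `i`. -/
def transversal (i : Fin 2) (x : Plane) : ℝ := x (i + 1)

theorem pt_transversal (i : Fin 2) (x : Plane) : pt i (transversal i x) (x i) = x := by
  ext k
  fin_cases i <;> fin_cases k <;> simp [pt, transversal]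

theorem transversal_pt (i : Fin 2) (s t : ℝ) : transversal i (pt i s t) = s := by
  fin_cases i <;> simp [pt, transversal]

theorem pt_self (i : Fin 2) (s t : ℝ) : pt i s t i = t := by simp [pt]

theorem lipschitzWith_transversal (i : Fin 2) : LipschitzWith 1 (transversal i) := by
  refine LipschitzWith.of_dist_le_mul fun x z => ?_
  rw [dist_eq_norm, dist_eq_norm]
  simpa [transversal] using PiLp.norm_apply_le (x - z) (i + 1)

theorem norm_le_abs_add_abs (i : Fin 2) (x : Plane) : ‖x‖ ≤ |x i| + |transversal i x| := by
  have : x = x i • EuclideanSpace.single i (1 : ℝ)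
      + transversal i x • EuclideanSpace.single (i + 1) (1 : ℝ) := by
    ext k
    fin_cases i <;> fin_cases k <;> simp [transversal]
  calc ‖x‖ = ‖x i • EuclideanSpace.single i (1 : ℝ)
      + transversal i x • EuclideanSpace.single (i + 1) (1 : ℝ)‖ := by rw [← this]
    _ ≤ _ := by
      refine (norm_add_le _ _).trans ?_
      simp [norm_smul]

/-- Near a point of the interface, `φ` is close to its linearisation, which is not degenerate in
some coordinate direction `i`. -/
theorem exists_chart {x₀ : Plane} (hx₀ : x₀ ∈ D.Γ) :
    ∃ (i : Fin 2) (d : ℝ) (M : ℝ≥0) (ρ : ℝ), d ≠ 0 ∧ 0 < ρ ∧ Metric.closedBall x₀ ρ ⊆ D.Ω ∧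
      (∀ s t t', pt i s t ∈ Metric.closedBall x₀ ρ → pt i s t' ∈ Metric.closedBall x₀ ρ →
        |D.φ (pt i s t) - D.φ (pt i s t') - (t - t') * d| ≤ |d| / 2 * |t - t'|) ∧
      (∀ x ∈ D.Γ ∩ Metric.closedBall x₀ ρ, ∀ z ∈ D.Γ ∩ Metric.closedBall x₀ ρ,
        dist x z ≤ M * |transversal i x - transversal i z|) := by
  set L := fderiv ℝ D.φ x₀ with hL
  have hL0 : L ≠ 0 := by
    intro h
    refine D.regular x₀ hx₀.1 hx₀.2 ?_
    rw [gradient, ← hL, h, map_zero]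
  obtain ⟨i, hi⟩ : ∃ i, L (EuclideanSpace.single i (1 : ℝ)) ≠ 0 := by
    by_contra! h
    refine hL0 (ContinuousLinearMap.ext fun x => ?_)
    have : x = x 0 • EuclideanSpace.single (0 : Fin 2) (1 : ℝ)
        + x 1 • EuclideanSpace.single (1 : Fin 2) (1 : ℝ) := by
      ext k; fin_cases k <;> simp
    rw [this, map_add, map_smul, map_smul, h, h]; simp
  set d := L (EuclideanSpace.single i (1 : ℝ)) with hd
  set d' := L (EuclideanSpace.single (i + 1) (1 : ℝ)) with hd'
  have hdpos : 0 < |d| := abs_pos.2 hi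
  have hstrict : HasStrictFDerivAt D.φ L x₀ := D.smooth.contDiffAt.hasStrictFDerivAt (by simp)
  -- The tolerance |d|/2 is half of the slope of φ in direction `i`: φ stays strictly monotone along
  -- that direction, and the error can be absorbed below.
  obtain ⟨N, hN, happ⟩ := hstrict.approximates_deriv_on_nhds
    (c := Real.toNNReal (|d| / 2)) (Or.inr (by simpa using hi))
  obtain ⟨ρ, hρ, hball⟩ := Metric.nhds_basis_closedBall.mem_iff.1
    (Filter.inter_mem hN (D.isOpen_Ω.mem_nhds hx₀.1))
  have hcoe : ((Real.toNNReal (|d| / 2) : ℝ≥0) : ℝ) = |d| / 2 := Real.coe_toNNReal _ (by positivity)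
  have hM : (0 : ℝ) ≤ 2 * |d'| / |d| + 2 := by positivity
  refine ⟨i, d, Real.toNNReal (2 * |d'| / |d| + 2), ρ, hi, hρ, fun x hx => (hball hx).2, ?_, ?_⟩
  · intro s t t' ht ht'
    have h := happ _ (hball ht).1 _ (hball ht').1
    have e1 : pt i s t - pt i s t' = (t - t') • EuclideanSpace.single i (1 : ℝ) := by
      rw [pt_eq_add, pt_eq_add i s t', add_sub_add_left_eq_sub, sub_smul]
    rw [e1, map_smul, ← hd, hcoe, norm_smul, Real.norm_eq_abs, Real.norm_eq_abs] at h
    simpa using h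
  · intro x hx z hz
    have h := happ _ (hball hx.2).1 _ (hball hz.2).1
    rw [hx.1.2, hz.1.2, hcoe, sub_self, zero_sub, norm_neg, Real.norm_eq_abs] at h
    set w := x - z with hw
    have hLw : L w = w i * d + transversal i w * d' := by
      have : w = w i • EuclideanSpace.single i (1 : ℝ)
          + transversal i w • EuclideanSpace.single (i + 1) (1 : ℝ) := by
        ext k
        fin_cases i <;> fin_cases k <;> simp [transversal]
      conv_lhs => rw [this]
      rw [map_add, map_smul, map_smul, smul_eq_mul, smul_eq_mul]
    have hn := norm_le_abs_add_abs i w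
    have htr : transversal i x - transversal i z = transversal i w := rfl
    rw [htr, dist_eq_norm, Real.coe_toNNReal _ hM]
    -- Since φ vanishes at both points, |L w| ≤ |d|/2 · ‖w‖; the share |d|/2 · |w i| is then
    -- absorbed on the left, which produces `M`.
    have h1 : |w i| * |d| ≤ |transversal i w| * |d'| + |d| / 2 * (|w i| + |transversal i w|) := by
      have h2 : |w i * d| ≤ |L w| + |transversal i w * d'| := by
        have : w i * d = L w - transversal i w * d' := by rw [hLw]; ring
        rw [this]; exact abs_sub _ _
      rw [abs_mul, abs_mul] at h2
      have h3 : |d| / 2 * ‖w‖ ≤ |d| / 2 * (|w i| + |transversal i w|) := by gcongr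
      linarith
    have h4 : |w i| ≤ (2 * |d'| / |d| + 1) * |transversal i w| := by
      rw [← mul_le_mul_iff_left₀ hdpos]
      have : (2 * |d'| / |d| + 1) * |transversal i w| * |d|
          = 2 * |d'| * |transversal i w| + |d| * |transversal i w| := by field_simp
      rw [this]; linarith
    linarith

/-- The length of the part of the interface in a bounded set is at most a multiple of the diameter
of the set. -/
theorem exists_hausdorffMeasure_le :
    ∃ C : ℝ≥0, ∀ S : Set Plane, Bornology.IsBounded S →
      μH[1] (D.Γ ∩ S) ≤ C * ENNReal.ofReal (Metric.diam S) := by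
  -- The inner `D.Γ` is the set that the compactness induction replaces by local pieces; the outer
  -- one stays.
  have key : ∃ C : ℝ≥0, ∀ S : Set Plane, Bornology.IsBounded S →
      μH[1] (D.Γ ∩ (D.Γ ∩ S)) ≤ C * ENNReal.ofReal (Metric.diam S) := by
    refine D.isCompact_Γ.induction_on (p := fun A => ∃ C : ℝ≥0, ∀ S : Set Plane,
      Bornology.IsBounded S → μH[1] (D.Γ ∩ (A ∩ S)) ≤ C * ENNReal.ofReal (Metric.diam S))
      ?_ ?_ ?_ ?_
    · exact ⟨0, by simp⟩
    · rintro A B hAB ⟨C, hC⟩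
      exact ⟨C, fun S hS => (measure_mono (by gcongr)).trans (hC S hS)⟩
    · rintro A B ⟨C, hC⟩ ⟨C', hC'⟩
      refine ⟨C + C', fun S hS => ?_⟩
      rw [union_inter_distrib_right, inter_union_distrib_left]
      refine (measure_union_le _ _).trans ?_
      rw [ENNReal.coe_add, add_mul]
      exact add_le_add (hC S hS) (hC' S hS)
    · intro x₀ hx₀
      obtain ⟨i, d, M, ρ, hd, hρ, hball, -, hM⟩ := D.exists_chart hx₀
      refine ⟨Metric.closedBall x₀ ρ,
        mem_nhdsWithin_of_mem_nhds (Metric.closedBall_mem_nhds _ hρ), M * 2, fun S hS => ?_⟩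
      rcases (D.Γ ∩ (Metric.closedBall x₀ ρ ∩ S)).eq_empty_or_nonempty with he | ⟨p, hp⟩
      · rw [he]; simp
      set K := D.Γ ∩ (Metric.closedBall x₀ ρ ∩ S) with hK
      -- `f` parametrises the piece as an M-Lipschitz graph, so its length is at most M times that
      -- of its projection, which lies in an interval of length 2 · diam S.
      set f := Function.invFunOn (transversal i) K with hf
      have hinj : InjOn (transversal i) K := by
        intro x hx z hz h
        have := hM x ⟨hx.1, hx.2.1⟩ z ⟨hz.1, hz.2.1⟩
        rw [h] at this
        simpa using this
      have hleft : ∀ x ∈ K, f (transversal i x) = x := fun x hx => hinj.leftInvOn_invFunOn hx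
      have hlip : LipschitzOnWith M f (transversal i '' K) := by
        refine LipschitzOnWith.of_dist_le_mul ?_
        rintro _ ⟨x, hx, rfl⟩ _ ⟨z, hz, rfl⟩
        rw [hleft x hx, hleft z hz, Real.dist_eq]
        exact hM x ⟨hx.1, hx.2.1⟩ z ⟨hz.1, hz.2.1⟩
      have himg : K = f '' (transversal i '' K) := by
        rw [image_image]
        ext x
        constructor
        · intro hx; exact ⟨x, hx, hleft x hx⟩
        · rintro ⟨z, hz, rfl⟩; simpa only [hleft z hz] using hz
      have h1 := hlip.hausdorffMeasure_image_le (d := 1) zero_le_one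
      rw [← himg, ENNReal.rpow_one, hausdorffMeasure_real] at h1
      refine h1.trans ?_
      have h2 : transversal i '' K ⊆
          Metric.closedBall (transversal i p) (Metric.diam S) := by
        rintro _ ⟨x, hx, rfl⟩
        rw [Metric.mem_closedBall]
        refine ((lipschitzWith_transversal i).dist_le_mul x p).trans ?_
        rw [NNReal.coe_one, one_mul]
        exact Metric.dist_le_diam_of_mem hS hx.2.2 hp.2.2
      calc (M : ℝ≥0∞) * volume (transversal i '' K)
          ≤ M * volume (Metric.closedBall (transversal i p) (Metric.diam S)) := by gcongr
        _ = ((M * 2 : ℝ≥0) : ℝ≥0∞) * ENNReal.ofReal (Metric.diam S) := by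
          rw [Real.volume_closedBall, ENNReal.ofReal_mul (by norm_num)]
          push_cast
          rw [mul_assoc]; simp
  obtain ⟨C, hC⟩ := key
  refine ⟨C, fun S hS => ?_⟩
  have := hC S hS
  rwa [← inter_assoc, inter_self] at this

theorem hausdorffMeasure_Γ_lt_top : μH[1] D.Γ < ∞ := by
  obtain ⟨C, hC⟩ := D.exists_hausdorffMeasure_le
  have := hC D.Γ D.isCompact_Γ.isBounded
  rw [inter_self] at this
  exact this.trans_lt (ENNReal.mul_lt_top (by simp) (by simp))

/-- The length element of a curve dominates the length element of its projection to a coordinate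
axis. -/
theorem setLIntegral_projection_le {i : Fin 2} {K : Set Plane} (hK : IsCompact K)
    (hinj : InjOn (transversal i) K) (f : Plane → ℝ≥0∞) :
    ∫⁻ s in transversal i '' K, f (Function.invFunOn (transversal i) K s)
      ≤ ∫⁻ x in K, f x ∂μH[1] := by
  have hc : Continuous (transversal i) := (lipschitzWith_transversal i).continuous
  have hmeas : MeasurableSet (transversal i '' K) := (hK.image hc).isClosed.measurableSet
  -- The projection is 1-Lipschitz and so does not increase one-dimensional Hausdorff measure, which
  -- on the line is Lebesgue measure.
  have hle : (volume : Measure ℝ).restrict (transversal i '' K)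
      ≤ Measure.map (transversal i) (μH[1].restrict K) := by
    refine Measure.le_iff.2 fun E hE => ?_
    rw [Measure.restrict_apply hE, Measure.map_apply hc.measurable hE,
      Measure.restrict_apply (hc.measurable hE), ← hausdorffMeasure_real]
    have hsub : E ∩ transversal i '' K ⊆ transversal i '' (transversal i ⁻¹' E ∩ K) := by
      rintro _ ⟨hE', x, hx, rfl⟩
      exact ⟨x, ⟨hE', hx⟩, rfl⟩
    refine (measure_mono hsub).trans ?_
    simpa using ((lipschitzWith_transversal i).lipschitzOnWith
      (s := transversal i ⁻¹' E ∩ K)).hausdorffMeasure_image_le (d := 1) zero_le_one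
  calc _ ≤ ∫⁻ s, f (Function.invFunOn (transversal i) K s)
        ∂(Measure.map (transversal i) (μH[1].restrict K)) := lintegral_mono' hle le_rfl
    _ ≤ ∫⁻ x in K, f (Function.invFunOn (transversal i) K (transversal i x)) ∂μH[1] :=
        lintegral_map_le _ _
    _ = ∫⁻ x in K, f x ∂μH[1] := by
        refine setLIntegral_congr_fun hK.isClosed.measurableSet fun x hx => ?_
        rw [hinj.leftInvOn_invFunOn hx]

end InterfaceDomain


namespace InterfaceDomain

variable (D : InterfaceDomain)

/-! ### Integrals over thin bands along the interface -/

/-- The band `0 ≤ φ ≤ ε`. -/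
def band (ε : ℝ) : Set Plane := {x ∈ D.Ω | 0 ≤ D.φ x ∧ D.φ x ≤ ε}

theorem measurableSet_band (ε : ℝ) : MeasurableSet (D.band ε) :=
  D.isOpen_Ω.measurableSet.inter
    ((isClosed_le continuous_const D.continuous_φ).inter
      (isClosed_le D.continuous_φ continuous_const)).measurableSet

/-- On lines in the chart direction φ has slope at least |d|/2 in modulus, so the band meets such a
line only within distance 2ε/|d| of its point on Γ. There F is close to its value on Γ, and
integration over the transversal coordinate is dominated by arc length. The additive δ pays for F
being merely continuous. -/
theorem exists_setLIntegral_band_le_local {x₀ : Plane} (hx₀ : x₀ ∈ D.Γ) :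
    ∃ U : Set Plane, IsOpen U ∧ x₀ ∈ U ∧ ∃ C : ℝ≥0, ∀ F : Plane → ℝ, Measurable F →
      ContinuousOn F (closure D.Ω) → ∀ δ : ℝ≥0, 0 < δ → ∀ᶠ ε in 𝓝[>] (0 : ℝ),
        ∫⁻ x in U ∩ D.band ε, ‖F x‖ₑ ≤ ENNReal.ofReal ε * (C * ∫⁻ x in D.Γ, ‖F x‖ₑ ∂μH[1] + δ) := by
  obtain ⟨i, d, M, ρ, hd, hρ, hball, hφ, hM⟩ := D.exists_chart hx₀
  have hdpos : 0 < |d| := abs_pos.2 hd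
  set s₀ := transversal i x₀ with hs₀
  set t₀ := x₀ i with ht₀
  have hx₀' : pt i s₀ t₀ = x₀ := pt_transversal i x₀
  have hmem : ∀ s t, |s - s₀| ≤ ρ / 2 → |t - t₀| ≤ ρ / 2 →
      pt i s t ∈ Metric.closedBall x₀ ρ := by
    intro s t hs ht
    rw [Metric.mem_closedBall, dist_eq_norm]
    refine (norm_le_abs_add_abs i _).trans ?_
    have e1 : (pt i s t - x₀) i = t - t₀ := by simp [pt, ht₀]
    have e2 : transversal i (pt i s t - x₀) = s - s₀ := by
      have : transversal i (pt i s t - x₀) = transversal i (pt i s t) - transversal i x₀ := rfl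
      rw [this, transversal_pt]
    rw [e1, e2]; linarith
  set K := D.Γ ∩ Metric.closedBall x₀ ρ with hKdef
  have hK : IsCompact K := D.isCompact_Γ.inter_right Metric.isClosed_closedBall
  have hinj : InjOn (transversal i) K := by
    intro x hx z hz h
    have := hM x hx z hz
    rw [h] at this
    simpa using this
  set f := Function.invFunOn (transversal i) K with hf
  have hleft : ∀ x ∈ K, f (transversal i x) = x := fun x hx => hinj.leftInvOn_invFunOn hx
  have hcont : Continuous (transversal i) := (lipschitzWith_transversal i).continuous
  set U : Set Plane := {x | |transversal i x - s₀| < ρ / 2} ∩ {x | |x i - t₀| < ρ / 4} with hU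
  have hUo : IsOpen U :=
    (isOpen_lt (by fun_prop) continuous_const).inter (isOpen_lt (by fun_prop) continuous_const)
  refine ⟨U, hUo, ⟨by simpa [hs₀] using hρ, by simpa [ht₀] using hρ⟩,
    Real.toNNReal (4 / |d|), fun F hFm hFc δ hδ => ?_⟩
  -- uniform continuity
  set δ' : ℝ := δ * (|d| / (8 * ρ)) with hδ'
  have hδ'pos : 0 < δ' := by positivity
  obtain ⟨η, hη, hunif⟩ := Metric.uniformContinuousOn_iff.1
    (D.isCompact_closure_Ω.uniformContinuousOn_of_continuous hFc) δ' hδ'pos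
  have hsmall : ∀ᶠ ε in 𝓝[>] (0 : ℝ), ε < |d| * ρ / 8 ∧ ε < |d| * η / 2 := by
    refine nhdsWithin_le_nhds ?_
    exact (eventually_lt_nhds (by positivity)).and (eventually_lt_nhds (by positivity))
  filter_upwards [hsmall, self_mem_nhdsWithin] with ε hε hε0
  have hε0 : 0 < ε := hε0
  -- Stepping back from a band point by 2ε/d lowers φ by at least ε, so Γ is crossed on the way. `U`
  -- has the smaller half-width ρ/4 in direction `i` to leave room for this step.
  have hzero : ∀ s t, pt i s t ∈ U ∩ D.band ε → s ∈ transversal i '' K ∧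
      |t - (f s) i| ≤ 2 * ε / |d| ∧ |F (pt i s t) - F (f s)| ≤ δ' := by
    rintro s t ⟨⟨hs, ht⟩, hΩ, h0, h1⟩
    rw [mem_ofPred_eq, transversal_pt] at hs
    rw [mem_ofPred_eq, pt_self] at ht
    have hstep : |2 * ε / d| < ρ / 4 := by
      rw [abs_div, abs_of_pos (by positivity : 0 < 2 * ε), div_lt_iff₀ hdpos]
      linarith [hε.1]
    set b := t - 2 * ε / d with hb
    have hseg : ∀ r ∈ uIcc b t, |r - t| ≤ |2 * ε / d| ∧ |r - t₀| ≤ ρ / 2 := by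
      intro r hr
      have h2 : |r - t| ≤ |2 * ε / d| := by
        have h3 := abs_sub_right_of_mem_uIcc hr
        rw [hb] at h3
        rw [abs_sub_comm]
        simpa using h3
      refine ⟨h2, ?_⟩
      have : r - t₀ = (r - t) + (t - t₀) := by ring
      rw [this]
      exact (abs_add_le _ _).trans (by linarith)
    have hbmem := hmem s b hs.le (hseg b left_mem_uIcc).2
    have htmem := hmem s t hs.le (hseg t right_mem_uIcc).2
    have hb0 : D.φ (pt i s b) ≤ 0 := by
      have h2 := hφ s t b htmem hbmem
      have e1 : (t - b) * d = 2 * ε := by rw [hb]; field_simp; ring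
      have e2 : |d| / 2 * |t - b| = ε := by
        rw [hb, sub_sub_cancel, abs_div, abs_of_pos (by positivity : 0 < 2 * ε)]; field_simp
      rw [e1, e2] at h2
      have := (abs_le.1 h2).1
      linarith
    have hcφ : ContinuousOn (fun r => D.φ (pt i s r)) (uIcc b t) :=
      (D.continuous_φ.comp (continuous_pt i s)).continuousOn
    obtain ⟨r, hr, hr0⟩ := intermediate_value_uIcc hcφ
      (show (0 : ℝ) ∈ uIcc (D.φ (pt i s b)) (D.φ (pt i s t)) from mem_uIcc.2 (Or.inl ⟨hb0, h0⟩))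
    have hrmem := hmem s r hs.le (hseg r hr).2
    have hrK : pt i s r ∈ K := ⟨⟨hball hrmem, hr0⟩, hrmem⟩
    have hfs : f s = pt i s r := by
      have := hleft _ hrK
      rwa [transversal_pt] at this
    have habs : |2 * ε / d| = 2 * ε / |d| := by
      rw [abs_div, abs_of_pos (by positivity : 0 < 2 * ε)]
    have hrt : |t - r| ≤ 2 * ε / |d| := by
      rw [← habs, abs_sub_comm]; exact (hseg r hr).1
    refine ⟨⟨_, hrK, transversal_pt i s r⟩, ?_, ?_⟩
    · rw [hfs, pt_self]; exact hrt
    · rw [hfs, ← Real.dist_eq]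
      refine (hunif _ (subset_closure hΩ) _ (subset_closure (hball hrmem)) ?_).le
      rw [dist_pt]
      refine hrt.trans_lt ?_
      rw [div_lt_iff₀ hdpos]; linarith [hε.2]
  have hmeasU : MeasurableSet (U ∩ D.band ε) := hUo.measurableSet.inter (D.measurableSet_band ε)
  have hmS : MeasurableSet (transversal i '' K) := (hK.image hcont).isClosed.measurableSet
  have hFe : Measurable fun x => ‖F x‖ₑ := hFm.enorm
  have hvolS : volume (transversal i '' K) ≤ ENNReal.ofReal (2 * ρ) := by
    rw [← Real.volume_closedBall s₀ ρ]
    refine measure_mono ?_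
    rintro _ ⟨x, hx, rfl⟩
    have := (lipschitzWith_transversal i).dist_le_mul x x₀
    rw [NNReal.coe_one, one_mul] at this
    exact Metric.mem_closedBall.2 (this.trans hx.2)
  rw [← lintegral_indicator hmeasU, lintegral_plane i (hFe.indicator hmeasU)]
  calc ∫⁻ s, ∫⁻ t, (U ∩ D.band ε).indicator (fun x => ‖F x‖ₑ) (pt i s t)
      ≤ ∫⁻ s, (transversal i '' K).indicator
          (fun s => ENNReal.ofReal (4 * ε / |d|) * (ENNReal.ofReal δ' + ‖F (f s)‖ₑ)) s := by
        refine lintegral_mono fun s => ?_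
        by_cases hs : s ∈ transversal i '' K
        · rw [indicator_of_mem hs]
          calc ∫⁻ t, (U ∩ D.band ε).indicator (fun x => ‖F x‖ₑ) (pt i s t)
              ≤ ∫⁻ t, (Metric.closedBall ((f s) i) (2 * ε / |d|)).indicator
                  (fun _ => ENNReal.ofReal δ' + ‖F (f s)‖ₑ) t := by
                refine lintegral_mono fun t => ?_
                by_cases ht : pt i s t ∈ U ∩ D.band ε
                · obtain ⟨-, h1, h2⟩ := hzero s t ht
                  rw [indicator_of_mem ht, indicator_of_mem]
                  · have : F (pt i s t) = (F (pt i s t) - F (f s)) + F (f s) := by ring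
                    rw [this]
                    refine (enorm_add_le _ _).trans ?_
                    gcongr
                    rw [Real.enorm_eq_ofReal_abs]
                    exact ENNReal.ofReal_le_ofReal h2
                  · rw [Metric.mem_closedBall, Real.dist_eq]; exact h1
                · rw [indicator_of_notMem ht]; exact zero_le
            _ = _ := by
                rw [lintegral_indicator Metric.isClosed_closedBall.measurableSet,
                  setLIntegral_const,
                  Real.volume_closedBall, mul_comm]
                congr 2
                ring
        · rw [indicator_of_notMem hs]
          refine le_of_eq ?_
          have : ∀ t, (U ∩ D.band ε).indicator (fun x => ‖F x‖ₑ) (pt i s t) = 0 := by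
            intro t
            refine indicator_of_notMem (fun ht => hs (hzero s t ht).1) _
          simp [this]
    _ = ENNReal.ofReal (4 * ε / |d|) *
          (ENNReal.ofReal δ' * volume (transversal i '' K)
            + ∫⁻ s in transversal i '' K, ‖F (f s)‖ₑ) := by
        rw [lintegral_indicator hmS, lintegral_const_mul' _ _ ENNReal.ofReal_ne_top,
          lintegral_add_left measurable_const, setLIntegral_const]
    _ ≤ ENNReal.ofReal (4 * ε / |d|) *
          (ENNReal.ofReal δ' * ENNReal.ofReal (2 * ρ) + ∫⁻ x in D.Γ, ‖F x‖ₑ ∂μH[1]) := by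
        gcongr
        refine (setLIntegral_projection_le hK hinj (fun x => ‖F x‖ₑ)).trans ?_
        exact lintegral_mono_set inter_subset_left
    _ = ENNReal.ofReal ε * (Real.toNNReal (4 / |d|) * ∫⁻ x in D.Γ, ‖F x‖ₑ ∂μH[1] + δ) := by
        have e1 : ENNReal.ofReal (4 * ε / |d|) = ENNReal.ofReal ε * ENNReal.ofReal (4 / |d|) := by
          rw [← ENNReal.ofReal_mul hε0.le]; congr 1; ring
        have e2 : ENNReal.ofReal (4 / |d|) * (ENNReal.ofReal δ' * ENNReal.ofReal (2 * ρ)) = δ := by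
          rw [← ENNReal.ofReal_mul hδ'pos.le, ← ENNReal.ofReal_mul (by positivity), hδ']
          rw [← ENNReal.ofReal_coe_nnreal]
          congr 1
          field_simp
          norm_num
        rw [e1, mul_assoc, mul_add, e2, add_comm]
        rfl

/-- Compactness of Γ: constants add up and δ is split between the pieces. The induction carries an
open neighbourhood U of Γ, because |φ| has a positive minimum on the rest of the closure of Ω and so
a thin band lies in U. -/
theorem exists_setLIntegral_band_le :
    ∃ C : ℝ≥0, ∀ F : Plane → ℝ, Measurable F →
      ContinuousOn F (closure D.Ω) → ∀ δ : ℝ≥0, 0 < δ → ∀ᶠ ε in 𝓝[>] (0 : ℝ),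
        ∫⁻ x in D.band ε, ‖F x‖ₑ ≤ ENNReal.ofReal ε * (C * ∫⁻ x in D.Γ, ‖F x‖ₑ ∂μH[1] + δ) := by
  obtain ⟨U, hUo, hΓU, C, hC⟩ : ∃ U : Set Plane, IsOpen U ∧ D.Γ ⊆ U ∧ ∃ C : ℝ≥0,
      ∀ F : Plane → ℝ, Measurable F →
      ContinuousOn F (closure D.Ω) → ∀ δ : ℝ≥0, 0 < δ → ∀ᶠ ε in 𝓝[>] (0 : ℝ),
        ∫⁻ x in U ∩ D.band ε, ‖F x‖ₑ
          ≤ ENNReal.ofReal ε * (C * ∫⁻ x in D.Γ, ‖F x‖ₑ ∂μH[1] + δ) := by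
    refine D.isCompact_Γ.induction_on (p := fun A => ∃ U : Set Plane, IsOpen U ∧ A ⊆ U ∧ ∃ C : ℝ≥0,
      ∀ F : Plane → ℝ, Measurable F →
      ContinuousOn F (closure D.Ω) → ∀ δ : ℝ≥0, 0 < δ → ∀ᶠ ε in 𝓝[>] (0 : ℝ),
        ∫⁻ x in U ∩ D.band ε, ‖F x‖ₑ
          ≤ ENNReal.ofReal ε * (C * ∫⁻ x in D.Γ, ‖F x‖ₑ ∂μH[1] + δ)) ?_ ?_ ?_ ?_
    · exact ⟨∅, isOpen_empty, subset_rfl, 0, by simp⟩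
    · rintro A B hAB ⟨U, hU, hBU, h⟩
      exact ⟨U, hU, hAB.trans hBU, h⟩
    · rintro A B ⟨U, hU, hAU, C, hC⟩ ⟨U', hU', hBU', C', hC'⟩
      refine ⟨U ∪ U', hU.union hU', union_subset_union hAU hBU', C + C', fun F hF hF' δ hδ => ?_⟩
      filter_upwards [hC F hF hF' (δ / 2) (by positivity), hC' F hF hF' (δ / 2) (by positivity)]
        with ε h1 h2
      rw [union_inter_distrib_right]
      refine (lintegral_union_le _ _ _).trans ((add_le_add h1 h2).trans_eq ?_)
      rw [← mul_add]
      congr 1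
      have : (δ : ℝ≥0∞) = (δ / 2 : ℝ≥0) + (δ / 2 : ℝ≥0) := by
        rw [← ENNReal.coe_add, add_halves]
      rw [this]
      push_cast
      ring
    · intro x₀ hx₀
      obtain ⟨U, hU, hx, h⟩ := D.exists_setLIntegral_band_le_local hx₀
      exact ⟨U, mem_nhdsWithin_of_mem_nhds (hU.mem_nhds hx), U, hU, subset_rfl, h⟩
  refine ⟨C, fun F hF hF' δ hδ => ?_⟩
  have hband : ∀ᶠ ε in 𝓝[>] (0 : ℝ), D.band ε ⊆ U := by
    have hcomp : IsCompact (closure D.Ω \ U) := D.isCompact_closure_Ω.diff hUo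
    rcases (closure D.Ω \ U).eq_empty_or_nonempty with he | hne
    · refine Eventually.of_forall fun ε x hx => ?_
      by_contra h
      have : x ∈ closure D.Ω \ U := ⟨subset_closure hx.1, h⟩
      rw [he] at this; exact this
    · obtain ⟨x₁, hx₁, hmin⟩ := hcomp.exists_isMinOn hne (D.continuous_φ.abs.continuousOn)
      have hpos : 0 < |D.φ x₁| := by
        refine abs_pos.2 fun h => hx₁.2 (hΓU ?_)
        rw [D.Γ_eq]; exact ⟨hx₁.1, h⟩
      filter_upwards [nhdsWithin_le_nhds (eventually_lt_nhds hpos)] with ε hε x hx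
      by_contra h
      have h1 := isMinOn_iff.1 hmin x ⟨subset_closure hx.1, h⟩
      rw [abs_of_nonneg hx.2.1] at h1
      linarith [hx.2.2]
  filter_upwards [hC F hF hF' δ hδ, hband] with ε h1 h2
  rwa [inter_eq_self_of_subset_right h2] at h1

/-- The band estimate with F = 1, since Γ has finite length. -/
theorem tendsto_volume_band : Tendsto (fun ε => volume (D.band ε)) (𝓝[>] 0) (𝓝 0) := by
  obtain ⟨C, hC⟩ := D.exists_setLIntegral_band_le
  have h := hC (fun _ => 1) measurable_const continuousOn_const 1 one_pos
  simp only [enorm_one, lintegral_one, Measure.restrict_apply_univ] at h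
  have hfin : (C * μH[1] D.Γ + ((1 : ℝ≥0) : ℝ≥0∞)) ≠ ∞ :=
    ENNReal.add_ne_top.2 ⟨ENNReal.mul_ne_top (by simp) D.hausdorffMeasure_Γ_lt_top.ne, by simp⟩
  refine tendsto_of_tendsto_of_tendsto_of_le_of_le' tendsto_const_nhds (?_ : Tendsto (fun ε =>
    ENNReal.ofReal ε * (C * μH[1] D.Γ + ((1 : ℝ≥0) : ℝ≥0∞))) _ _) (by simp) h
  have h0 : Tendsto (fun ε : ℝ => ENNReal.ofReal ε) (𝓝[>] 0) (𝓝 0) := by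
    have : Tendsto (fun ε : ℝ => ENNReal.ofReal ε) (𝓝 0) (𝓝 (ENNReal.ofReal 0)) :=
      (ENNReal.continuous_ofReal).tendsto 0
    rw [ENNReal.ofReal_zero] at this
    exact this.mono_left nhdsWithin_le_nhds
  have := ENNReal.Tendsto.mul_const h0 (Or.inr hfin)
  rwa [zero_mul] at this

end InterfaceDomain


/-! ### Triangulations -/

theorem isCompact_tri (T : Finset Plane) : IsCompact (tri T) :=
  T.finite_toSet.isCompact_convexHull (𝕜 := ℝ)

theorem convex_tri (T : Finset Plane) : Convex ℝ (tri T) := convex_convexHull ℝ _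

theorem isClosed_tri (T : Finset Plane) : IsClosed (tri T) := (isCompact_tri T).isClosed

theorem measurableSet_tri (T : Finset Plane) : MeasurableSet (tri T) :=
  (isClosed_tri T).measurableSet

theorem volume_tri_lt_top (T : Finset Plane) : volume (tri T) < ∞ :=
  (isCompact_tri T).measure_lt_top

theorem size_nonneg (T : Finset Plane) : 0 ≤ size T := Metric.diam_nonneg

theorem volume_convexHull_eq_zero {s : Finset Plane} (hs : s.card ≤ 2) :
    volume (convexHull ℝ (s : Set Plane)) = 0 := by
  refine measure_mono_null (convexHull_subset_affineSpan (𝕜 := ℝ) _)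
    (Measure.addHaar_affineSubspace _ _ fun h => ?_)
  rcases s.eq_empty_or_nonempty with rfl | hne
  · simp at h
  · have h2 : Module.finrank ℝ (vectorSpan ℝ (s : Set Plane)) ≤ 1 := by
      have := finrank_vectorSpan_range_le ℝ ((↑) : s → Plane) (n := s.card - 1)
        (by have := hne.card_pos; rw [Fintype.card_coe]; omega)
      have aux : ∀ S : Set Plane, S = range ((↑) : s → Plane) →
          Module.finrank ℝ (vectorSpan ℝ S) ≤ s.card - 1 := by rintro _ rfl; exact this
      exact (aux _ Subtype.range_coe.symm).trans (by omega)
    rw [← direction_affineSpan, h, AffineSubspace.direction_top] at h2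
    simp at h2

namespace Triangulation

variable {Ω : Set Plane} (𝒯 : Triangulation Ω)

theorem mem_elements {T : Finset Plane} : T ∈ 𝒯.elements ↔ T ∈ 𝒯.faces ∧ T.card = 3 := by
  simp [elements]

theorem biUnion_tri : (⋃ T ∈ 𝒯.elements, tri T) = closure Ω := by
  rw [← 𝒯.space_eq]
  apply subset_antisymm
  · refine iUnion₂_subset fun T hT => ?_
    exact subset_biUnion_of_mem (u := fun e : Finset Plane => convexHull ℝ (e : Set Plane))
      (𝒯.mem_elements.1 hT).1
  · refine iUnion₂_subset fun e he => ?_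
    obtain ⟨T, hT, hc, heT⟩ := 𝒯.pure_faces e he
    exact (convexHull_mono (by exact_mod_cast heT)).trans
      (subset_biUnion_of_mem (u := fun T : Finset Plane => tri T) (𝒯.mem_elements.2 ⟨hT, hc⟩))

theorem tri_subset {T : Finset Plane} (hT : T ∈ 𝒯.elements) : tri T ⊆ closure Ω := by
  rw [← 𝒯.biUnion_tri]
  exact subset_biUnion_of_mem (u := fun T : Finset Plane => tri T) hT

theorem exists_mem_tri {x : Plane} (hx : x ∈ closure Ω) : ∃ T ∈ 𝒯.elements, x ∈ tri T := by
  rw [← 𝒯.biUnion_tri] at hx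
  simpa using hx

/-- Distinct triangles share at most two vertices, and by conformity they meet only in the hull of
these, a null set. An open null set is empty. -/
theorem disjoint_interior {T T' : Finset Plane} (hT : T ∈ 𝒯.elements) (hT' : T' ∈ 𝒯.elements)
    (hne : T ≠ T') : Disjoint (interior (tri T)) (interior (tri T')) := by
  classical
  rw [Set.disjoint_iff_inter_eq_empty]
  have hT1 := 𝒯.mem_elements.1 hT
  have hT2 := 𝒯.mem_elements.1 hT'
  have hcard : (T ∩ T').card ≤ 2 := by
    by_contra! h
    have h1 : T ∩ T' = T := Finset.eq_of_subset_of_card_le Finset.inter_subset_left (by omega)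
    have h2 : T ∩ T' = T' := Finset.eq_of_subset_of_card_le Finset.inter_subset_right (by omega)
    exact hne (h1.symm.trans h2)
  have hnull : volume (interior (tri T) ∩ interior (tri T')) = 0 := by
    refine measure_mono_null ?_ (volume_convexHull_eq_zero hcard)
    rw [Finset.coe_inter]
    exact (inter_subset_inter interior_subset interior_subset).trans
      (𝒯.inter_subset_convexHull hT1.1 hT2.1)
  exact (isOpen_interior.inter isOpen_interior).eq_empty_of_measure_zero hnull

theorem ae_mem_interior_tri :
    ∀ᵐ x : Plane, x ∈ closure Ω → ∃ T ∈ 𝒯.elements, x ∈ interior (tri T) := by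
  have h : ∀ᵐ x : Plane, ∀ T ∈ 𝒯.elements, x ∉ frontier (tri T) := by
    rw [Filter.eventually_all_finset]
    intro T _
    exact measure_eq_zero_iff_ae_notMem.1 ((convex_tri T).addHaar_frontier volume)
  filter_upwards [h] with x hx hxΩ
  obtain ⟨T, hT, hxT⟩ := 𝒯.exists_mem_tri hxΩ
  refine ⟨T, hT, ?_⟩
  by_contra hi
  exact hx T hT ⟨subset_closure hxT, hi⟩

theorem size_pos {T : Finset Plane} (hT : T ∈ 𝒯.elements) : 0 < size T := by
  obtain ⟨a, ha, b, hb, hab⟩ := Finset.one_lt_card.1 (by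
    rw [(𝒯.mem_elements.1 hT).2]; norm_num : 1 < T.card)
  have h := Metric.dist_le_diam_of_mem (isCompact_tri T).isBounded
    (subset_convexHull ℝ _ ha) (subset_convexHull ℝ _ hb)
  exact (dist_pos.2 hab).trans_le h

theorem size_le_meshSize {T : Finset Plane} (hT : T ∈ 𝒯.elements) : size T ≤ 𝒯.meshSize := by
  refine le_csSup ?_ ⟨T, hT, rfl⟩
  exact ((𝒯.elements.finite_toSet).image size).bddAbove

variable {𝒯}

/-- `inSize` is a supremum, so an actual ball is obtained at the price of a factor 2. Non-degeneracy
itself forces σ > 0 and excludes the default value 0 of an empty supremum. -/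
theorem Nondegenerate.exists_closedBall {σ : ℝ} (h : 𝒯.Nondegenerate σ) {T : Finset Plane}
    (hT : T ∈ 𝒯.elements) :
    ∃ d, 0 < d ∧ size T ≤ 2 * |σ| * d ∧ ∃ c, Metric.closedBall c (d / 2) ⊆ tri T := by
  have hs := 𝒯.size_pos hT
  have h1 := h T hT
  set A := {d : ℝ | 0 ≤ d ∧ ∃ c, Metric.closedBall c (d / 2) ⊆ tri T} with hA
  have hin : 0 ≤ inSize T := Real.sSup_nonneg fun d hd => hd.1
  have hσ : 0 < σ := by
    by_contra! hσ
    nlinarith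
  have hlt : size T / (2 * σ) < inSize T := by
    rw [div_lt_iff₀ (by positivity)]; linarith
  have hne : A.Nonempty := by
    by_contra hA0
    rw [not_nonempty_iff_eq_empty] at hA0
    have : inSize T = 0 := by rw [inSize, ← hA, hA0, Real.sSup_empty]
    rw [this] at hlt
    have : 0 < size T / (2 * σ) := by positivity
    linarith
  obtain ⟨d, hd, hlt'⟩ := exists_lt_of_lt_csSup hne hlt
  refine ⟨d, lt_trans (by positivity) hlt', ?_, hd.2⟩
  rw [abs_of_pos hσ]
  rw [div_lt_iff₀ (by positivity)] at hlt'
  linarith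

theorem Nondegenerate.size_sq_le {σ : ℝ} (h : 𝒯.Nondegenerate σ) {T : Finset Plane}
    (hT : T ∈ 𝒯.elements) : size T ^ 2 ≤ 16 * σ ^ 2 * volume.real (tri T) := by
  obtain ⟨d, hd, hsd, c, hc⟩ := h.exists_closedBall hT
  have hv : Real.pi * (d / 2) ^ 2 ≤ volume.real (tri T) := by
    have h1 := measureReal_mono hc (volume_tri_lt_top T).ne
    rw [measureReal_def, EuclideanSpace.volume_closedBall_fin_two, ENNReal.toReal_mul,
      ENNReal.toReal_pow, ENNReal.toReal_ofReal (by positivity),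
      ENNReal.toReal_ofReal Real.pi_pos.le, mul_comm] at h1
    exact h1
  have hpi : (1 : ℝ) ≤ Real.pi := by linarith [Real.pi_gt_three]
  have h2 : (d / 2) ^ 2 ≤ volume.real (tri T) := by
    refine le_trans ?_ hv
    nlinarith [sq_nonneg (d / 2)]
  calc size T ^ 2 ≤ (2 * |σ| * d) ^ 2 := by
        have := size_nonneg T
        gcongr
    _ = 16 * σ ^ 2 * (d / 2) ^ 2 := by rw [mul_pow, mul_pow, sq_abs]; ring
    _ ≤ _ := by gcongr

theorem Nondegenerate.volume_tri_pos {σ : ℝ} (h : 𝒯.Nondegenerate σ) {T : Finset Plane}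
    (hT : T ∈ 𝒯.elements) : 0 < volume.real (tri T) := by
  have h1 := h.size_sq_le hT
  have h2 := 𝒯.size_pos hT
  by_contra! h3
  nlinarith [sq_nonneg σ, pow_pos h2 2, mul_nonneg (sq_nonneg σ) (neg_nonneg.2 h3)]

end Triangulation

/-! ### Piecewise linear functions -/

section Linear

variable {Ω : Set Plane} {𝒯 : Triangulation Ω}

open Classical in
/-- The gradient of a piecewise linear function on the triangle `T`. -/
noncomputable def elemGrad (w : Plane → ℝ) (T : Finset Plane) : Plane :=
  if h : (interior (tri T)).Nonempty then gradient w h.some else 0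

theorem hasGradientAt_affine (A : Plane →ᵃ[ℝ] ℝ) (x : Plane) :
    HasGradientAt A ((InnerProductSpace.toDual ℝ Plane).symm A.linear.toContinuousLinearMap) x := by
  rw [hasGradientAt_iff_hasFDerivAt, LinearIsometryEquiv.apply_symm_apply]
  have h : (A : Plane → ℝ) = fun x => A.linear.toContinuousLinearMap x + A 0 := by
    ext z; rw [AffineMap.decomp A]; simp
  rw [h]
  exact (A.linear.toContinuousLinearMap.hasFDerivAt).add_const _

theorem hasGradientAt_elemGrad {w : Plane → ℝ} (hw : w ∈ 𝒯.linearSpace) {T : Finset Plane}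
    (hT : T ∈ 𝒯.elements) {x : Plane} (hx : x ∈ interior (tri T)) :
    HasGradientAt w (elemGrad w T) x := by
  obtain ⟨A, hA⟩ := hw.2.2 T hT
  set g := (InnerProductSpace.toDual ℝ Plane).symm A.linear.toContinuousLinearMap with hg
  have key : ∀ z ∈ interior (tri T), HasGradientAt w g z := by
    intro z hz
    refine (hasGradientAt_affine A z).congr_of_eventuallyEq ?_
    filter_upwards [isOpen_interior.mem_nhds hz] with y hy
    exact hA y (interior_subset hy)
  have hne : (interior (tri T)).Nonempty := ⟨x, hx⟩
  have : elemGrad w T = g := by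
    rw [elemGrad, dif_pos hne]
    exact (key _ hne.some_mem).gradient
  rw [this]
  exact key x hx

theorem elemGrad_add {w w' : Plane → ℝ} (hw : w ∈ 𝒯.linearSpace) (hw' : w' ∈ 𝒯.linearSpace)
    {T : Finset Plane} (hT : T ∈ 𝒯.elements) :
    elemGrad (w + w') T = elemGrad w T + elemGrad w' T := by
  by_cases hne : (interior (tri T)).Nonempty
  · have h1 := hasGradientAt_elemGrad hw hT hne.some_mem
    have h2 := hasGradientAt_elemGrad hw' hT hne.some_mem
    have h3 := hasGradientAt_elemGrad (𝒯.linearSpace.add_mem hw hw') hT hne.some_mem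
    have h4 : HasGradientAt (w + w') (elemGrad w T + elemGrad w' T) hne.some := by
      rw [hasGradientAt_iff_hasFDerivAt] at *
      rw [map_add]
      exact h1.add h2
    exact h3.unique h4
  · simp [elemGrad, hne]

open Classical in
theorem measurable_of_mem_linearSpace {w : Plane → ℝ} (hw : w ∈ 𝒯.linearSpace) : Measurable w := by
  have hcl : MeasurableSet (closure Ω) := isClosed_closure.measurableSet
  have : w = (closure Ω).indicator w := by
    ext x
    by_cases hx : x ∈ closure Ω
    · rw [indicator_of_mem hx]
    · rw [indicator_of_notMem hx, hw.1 x hx]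
  rw [this, ← piecewise_eq_indicator]
  exact hw.2.1.measurable_piecewise continuousOn_const hcl

theorem exists_bound_of_mem_linearSpace (hΩ : IsCompact (closure Ω)) {w : Plane → ℝ}
    (hw : w ∈ 𝒯.linearSpace) : ∃ M : ℝ, 0 ≤ M ∧ ∀ x, |w x| ≤ M := by
  obtain ⟨M, hM⟩ := hΩ.exists_bound_of_continuousOn hw.2.1
  refine ⟨max M 0, le_max_right _ _, fun x => ?_⟩
  by_cases hx : x ∈ closure Ω
  · exact (hM x hx).trans (le_max_left _ _)
  · rw [hw.1 x hx, abs_zero]; exact le_max_right _ _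

end Linear


/-! ### The structure of the extended finite element space -/

/-- `v` agrees with the piecewise linear function `w₁` where `φ < 0` and with `w₂` where `φ > 0`. -/
structure IsBroken (D : InterfaceDomain) (𝒯 : Triangulation D.Ω) (v w₁ w₂ : Plane → ℝ) : Prop where
  measurable : Measurable v
  bounded : ∃ M : ℝ, ∀ x, |v x| ≤ M
  mem₁ : w₁ ∈ 𝒯.linearSpace
  mem₂ : w₂ ∈ 𝒯.linearSpace
  eq₁ : ∀ x, D.φ x < 0 → v x = w₁ x
  eq₂ : ∀ x, 0 < D.φ x → v x = w₂ x

section Broken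

variable {D : InterfaceDomain} {𝒯 : Triangulation D.Ω}

theorem isBroken_self {w : Plane → ℝ} (hw : w ∈ 𝒯.linearSpace) : IsBroken D 𝒯 w w w where
  measurable := measurable_of_mem_linearSpace hw
  bounded := by
    obtain ⟨M, -, hM⟩ := exists_bound_of_mem_linearSpace D.isCompact_closure_Ω hw
    exact ⟨M, hM⟩
  mem₁ := hw
  mem₂ := hw
  eq₁ := fun _ _ => rfl
  eq₂ := fun _ _ => rfl

theorem IsBroken.add {v w₁ w₂ v' w₁' w₂' : Plane → ℝ} (h : IsBroken D 𝒯 v w₁ w₂)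
    (h' : IsBroken D 𝒯 v' w₁' w₂') : IsBroken D 𝒯 (v + v') (w₁ + w₁') (w₂ + w₂') where
  measurable := h.measurable.add h'.measurable
  bounded := by
    obtain ⟨M, hM⟩ := h.bounded
    obtain ⟨M', hM'⟩ := h'.bounded
    exact ⟨M + M', fun x => (abs_add_le _ _).trans (add_le_add (hM x) (hM' x))⟩
  mem₁ := 𝒯.linearSpace.add_mem h.mem₁ h'.mem₁
  mem₂ := 𝒯.linearSpace.add_mem h.mem₂ h'.mem₂
  eq₁ := fun x hx => by simp [h.eq₁ x hx, h'.eq₁ x hx]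
  eq₂ := fun x hx => by simp [h.eq₂ x hx, h'.eq₂ x hx]

theorem IsBroken.smul {v w₁ w₂ : Plane → ℝ} (h : IsBroken D 𝒯 v w₁ w₂) (c : ℝ) :
    IsBroken D 𝒯 (c • v) (c • w₁) (c • w₂) where
  measurable := h.measurable.const_smul c
  bounded := by
    obtain ⟨M, hM⟩ := h.bounded
    refine ⟨|c| * M, fun x => ?_⟩
    rw [Pi.smul_apply, smul_eq_mul, abs_mul]
    gcongr
    exact hM x
  mem₁ := 𝒯.linearSpace.smul_mem c h.mem₁
  mem₂ := 𝒯.linearSpace.smul_mem c h.mem₂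
  eq₁ := fun x hx => by simp [h.eq₁ x hx]
  eq₂ := fun x hx => by simp [h.eq₂ x hx]

/-- A cut function is zero on the side of its node and the full nodal function on the other. Its
values on Γ are not determined by the two sides, hence the separate measurability and bound in
`IsBroken`. -/
theorem exists_isBroken_of_mem_cutFunctions {v : Plane → ℝ} (hv : v ∈ cutFunctions D 𝒯) :
    ∃ w₁ w₂, IsBroken D 𝒯 v w₁ w₂ := by
  obtain ⟨P, b, hb, -, h⟩ := hv
  have hm := measurable_of_mem_linearSpace hb.2.1
  obtain ⟨M, hM0, hM⟩ := exists_bound_of_mem_linearSpace D.isCompact_closure_Ω hb.2.1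
  have hbd : ∀ s : Set Plane, ∀ x, |s.indicator b x| ≤ M := by
    intro s x
    by_cases hx : x ∈ s
    · rw [indicator_of_mem hx]; exact hM x
    · rw [indicator_of_notMem hx, abs_zero]; exact hM0
  rcases h with ⟨-, rfl⟩ | ⟨-, rfl⟩
  · refine ⟨0, b, hm.indicator (isClosed_le continuous_const D.continuous_φ).measurableSet,
      ⟨M, hbd _⟩, 𝒯.linearSpace.zero_mem, hb.2.1, fun x hx => ?_, fun x hx => ?_⟩
    · rw [indicator_of_notMem (by simpa using hx)]; rfl
    · rw [indicator_of_mem (by simpa using hx.le)]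
  · refine ⟨b, 0, hm.indicator (isClosed_le D.continuous_φ continuous_const).measurableSet,
      ⟨M, hbd _⟩, hb.2.1, 𝒯.linearSpace.zero_mem, fun x hx => ?_, fun x hx => ?_⟩
    · rw [indicator_of_mem (by simpa using hx.le)]
    · rw [indicator_of_notMem (by simpa using hx)]; rfl

theorem exists_isBroken {v : Plane → ℝ} (hv : v ∈ Vh D 𝒯) : ∃ w₁ w₂, IsBroken D 𝒯 v w₁ w₂ := by
  obtain ⟨a, ha, b, hb, rfl⟩ := Submodule.mem_sup.1 hv.1
  clear hv
  obtain ⟨b₁, b₂, hb'⟩ : ∃ w₁ w₂, IsBroken D 𝒯 b w₁ w₂ := by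
    induction hb using Submodule.span_induction with
    | mem x hx => exact exists_isBroken_of_mem_cutFunctions hx
    | zero => exact ⟨0, 0, isBroken_self 𝒯.linearSpace.zero_mem⟩
    | add x z _ _ hx hz =>
      obtain ⟨x₁, x₂, hx⟩ := hx
      obtain ⟨z₁, z₂, hz⟩ := hz
      exact ⟨_, _, hx.add hz⟩
    | smul c x _ hx =>
      obtain ⟨x₁, x₂, hx⟩ := hx
      exact ⟨_, _, hx.smul c⟩
  exact ⟨_, _, (isBroken_self ha).add hb'⟩

variable {v w₁ w₂ : Plane → ℝ}

theorem IsBroken.memLp (h : IsBroken D 𝒯 v w₁ w₂) : MemLp v 2 D.vol := by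
  obtain ⟨M, hM⟩ := h.bounded
  exact MemLp.of_bound h.measurable.aestronglyMeasurable M (Eventually.of_forall hM)

theorem IsBroken.hasGradientAt₁ (h : IsBroken D 𝒯 v w₁ w₂) {T : Finset Plane}
    (hT : T ∈ 𝒯.elements) {x : Plane} (hx : x ∈ interior (tri T)) (hφ : D.φ x < 0) :
    HasGradientAt v (elemGrad w₁ T) x := by
  refine (hasGradientAt_elemGrad h.mem₁ hT hx).congr_of_eventuallyEq ?_
  filter_upwards [(isOpen_lt D.continuous_φ continuous_const).mem_nhds hφ] with z hz
  exact h.eq₁ z hz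

theorem IsBroken.hasGradientAt₂ (h : IsBroken D 𝒯 v w₁ w₂) {T : Finset Plane}
    (hT : T ∈ 𝒯.elements) {x : Plane} (hx : x ∈ interior (tri T)) (hφ : 0 < D.φ x) :
    HasGradientAt v (elemGrad w₂ T) x := by
  refine (hasGradientAt_elemGrad h.mem₂ hT hx).congr_of_eventuallyEq ?_
  filter_upwards [(isOpen_lt continuous_const D.continuous_φ).mem_nhds hφ] with z hz
  exact h.eq₂ z hz

theorem measurable_gradient (v : Plane → ℝ) : Measurable (gradient v) :=
  (InnerProductSpace.toDual ℝ Plane).symm.continuous.measurable.comp (measurable_fderiv ℝ v)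

/-! ### Traces -/

/-- Otherwise x would be a local minimum of φ, which the non-zero gradient forbids. It makes the
averages defining the trace genuine ones. -/
theorem InterfaceDomain.volume_ball_inter_Ω₁_pos (D : InterfaceDomain) {x : Plane} (hx : x ∈ D.Γ)
    {r : ℝ} (hr : 0 < r) : 0 < volume (Metric.ball x r ∩ D.Ω₁) := by
  refine (Metric.isOpen_ball.inter D.isOpen_Ω₁).measure_pos _ ?_
  by_contra hne
  rw [not_nonempty_iff_eq_empty] at hne
  have hmin : IsLocalMin D.φ x := by
    filter_upwards [Metric.ball_mem_nhds x hr, D.isOpen_Ω.mem_nhds hx.1] with z hz hz'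
    rw [hx.2]
    by_contra! h
    have : z ∈ Metric.ball x r ∩ D.Ω₁ := ⟨hz, hz', h⟩
    rw [hne] at this; exact this
  refine D.regular x hx.1 hx.2 ?_
  rw [gradient, hmin.fderiv_eq_zero, map_zero]

theorem InterfaceDomain.volume_ball_inter_Ω₂_pos (D : InterfaceDomain) {x : Plane} (hx : x ∈ D.Γ)
    {r : ℝ} (hr : 0 < r) : 0 < volume (Metric.ball x r ∩ D.Ω₂) := by
  refine (Metric.isOpen_ball.inter D.isOpen_Ω₂).measure_pos _ ?_
  by_contra hne
  rw [not_nonempty_iff_eq_empty] at hne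
  have hmax : IsLocalMax D.φ x := by
    filter_upwards [Metric.ball_mem_nhds x hr, D.isOpen_Ω.mem_nhds hx.1] with z hz hz'
    rw [hx.2]
    by_contra! h
    have : z ∈ Metric.ball x r ∩ D.Ω₂ := ⟨hz, hz', h⟩
    rw [hne] at this; exact this
  refine D.regular x hx.1 hx.2 ?_
  rw [gradient, hmax.fderiv_eq_zero, map_zero]

/-- Mean values over small balls intersected with `U` converge to the limit from within `U`. -/
theorem tendsto_setAverage_ball {E : Type*} [NormedAddCommGroup E] [NormedSpace ℝ E]
    [CompleteSpace E] {U : Set Plane} (hU : MeasurableSet U) {x : Plane}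
    (hpos : ∀ r : ℝ, 0 < r → 0 < volume (Metric.ball x r ∩ U)) {f : Plane → E} {l : E}
    (hint : ∀ᶠ r in 𝓝[>] (0 : ℝ), IntegrableOn f (Metric.ball x r ∩ U))
    (hlim : Tendsto f (𝓝[U] x) (𝓝 l)) :
    Tendsto (fun r => ⨍ z in Metric.ball x r ∩ U, f z) (𝓝[>] 0) (𝓝 l) := by
  rw [Metric.nhds_basis_closedBall.tendsto_right_iff]
  intro ε hε
  have h1 := hlim (Metric.closedBall_mem_nhds l hε)
  obtain ⟨ρ, hρ, hρU⟩ := Metric.mem_nhdsWithin_iff.1 h1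
  filter_upwards [hint, self_mem_nhdsWithin, nhdsWithin_le_nhds (eventually_lt_nhds hρ)]
    with r hr hr0 hrρ
  -- Averages of values in a closed convex set stay in it.
  refine (convex_closedBall l ε).set_average_mem Metric.isClosed_closedBall (hpos r hr0).ne'
    (measure_mono inter_subset_left |>.trans_lt measure_ball_lt_top).ne ?_ hr
  filter_upwards [ae_restrict_mem (measurableSet_ball.inter hU)] with z hz
  exact hρU ⟨Metric.ball_subset_ball hrρ.le hz.1, hz.2⟩

theorem IsBroken.tendsto_trace₁ (h : IsBroken D 𝒯 v w₁ w₂) {x : Plane} (hx : x ∈ D.Γ) :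
    Tendsto (fun r => ⨍ z in Metric.ball x r ∩ D.Ω₁, v z) (𝓝[>] 0) (𝓝 (w₁ x)) := by
  have hint : IntegrableOn v D.Ω :=
    (h.memLp.integrable (by norm_num))
  refine tendsto_setAverage_ball D.isOpen_Ω₁.measurableSet
    (fun r hr => D.volume_ball_inter_Ω₁_pos hx hr)
    (Eventually.of_forall fun r => hint.mono_set fun z hz => hz.2.1) ?_
  have h1 : Tendsto w₁ (𝓝[D.Ω₁] x) (𝓝 (w₁ x)) :=
    (h.mem₁.2.1 x (subset_closure hx.1)).mono fun z hz => subset_closure hz.1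
  refine h1.congr' ?_
  filter_upwards [self_mem_nhdsWithin] with z hz
  exact (h.eq₁ z hz.2).symm

theorem IsBroken.tendsto_trace₂ (h : IsBroken D 𝒯 v w₁ w₂) {x : Plane} (hx : x ∈ D.Γ) :
    Tendsto (fun r => ⨍ z in Metric.ball x r ∩ D.Ω₂, v z) (𝓝[>] 0) (𝓝 (w₂ x)) := by
  have hint : IntegrableOn v D.Ω :=
    (h.memLp.integrable (by norm_num))
  refine tendsto_setAverage_ball D.isOpen_Ω₂.measurableSet
    (fun r hr => D.volume_ball_inter_Ω₂_pos hx hr)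
    (Eventually.of_forall fun r => hint.mono_set fun z hz => hz.2.1) ?_
  have h1 : Tendsto w₂ (𝓝[D.Ω₂] x) (𝓝 (w₂ x)) :=
    (h.mem₂.2.1 x (subset_closure hx.1)).mono fun z hz => subset_closure hz.1
  refine h1.congr' ?_
  filter_upwards [self_mem_nhdsWithin] with z hz
  exact (h.eq₂ z hz.2).symm

theorem IsBroken.tendsto_jump (h : IsBroken D 𝒯 v w₁ w₂) {x : Plane} (hx : x ∈ D.Γ) :
    Tendsto (fun r => (⨍ z in Metric.ball x r ∩ D.Ω₁, v z) - ⨍ z in Metric.ball x r ∩ D.Ω₂, v z)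
      (𝓝[>] 0) (𝓝 (w₁ x - w₂ x)) :=
  (h.tendsto_trace₁ hx).sub (h.tendsto_trace₂ hx)

theorem IsBroken.jump_eq (h : IsBroken D 𝒯 v w₁ w₂) {x : Plane} (hx : x ∈ D.Γ) :
    D.jump v x = w₁ x - w₂ x := (h.tendsto_jump hx).limUnder_eq

/-- The weighted mean of the normal fluxes of a broken piecewise linear function. -/
noncomputable def meanFlux (α₁ α₂ : ℝ) (D : InterfaceDomain) (w₁ w₂ : Plane → ℝ)
    (T : Finset Plane) : Plane :=
  areaFraction T D.Ω₁ • α₁ • elemGrad w₁ T + areaFraction T D.Ω₂ • α₂ • elemGrad w₂ T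

theorem tendsto_setAverage_of_eqOn {U : Set Plane} (hU : MeasurableSet U) {x : Plane}
    (hpos : ∀ r : ℝ, 0 < r → 0 < volume (Metric.ball x r ∩ U)) {f : Plane → Plane} {l : Plane}
    {V : Set Plane} (hV : V ∈ 𝓝 x) (hf : ∀ z ∈ V ∩ U, f z = l) :
    Tendsto (fun r => ⨍ z in Metric.ball x r ∩ U, f z) (𝓝[>] 0) (𝓝 l) := by
  refine tendsto_setAverage_ball hU hpos ?_ ?_
  · obtain ⟨ρ, hρ, hρV⟩ := Metric.mem_nhds_iff.1 hV
    filter_upwards [nhdsWithin_le_nhds (eventually_lt_nhds hρ)] with r hr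
    have : IntegrableOn (fun _ : Plane => l) (Metric.ball x r ∩ U) :=
      integrableOn_const ((measure_mono inter_subset_left).trans_lt measure_ball_lt_top).ne
    refine this.congr_fun ?_ (measurableSet_ball.inter hU)
    intro z hz
    exact (hf z ⟨hρV (Metric.ball_subset_ball hr.le hz.1), hz.2⟩).symm
  · refine tendsto_const_nhds.congr' ?_
    filter_upwards [self_mem_nhdsWithin, nhdsWithin_le_nhds hV] with z hz hz'
    exact (hf z ⟨hz', hz⟩).symm

/-- Inside T the flux is constant on each side of Γ. Convergence is recorded, not just the value of
the limit, because perturbing limits in the mesh dependent norm needs it. -/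
theorem IsBroken.tendsto_normalMean (h : IsBroken D 𝒯 v w₁ w₂) (s α₁ α₂ : ℝ) {T : Finset Plane}
    (hT : T ∈ 𝒯.elements) {x : Plane} (hx : x ∈ D.Γ) (hxT : x ∈ interior (tri T)) :
    Tendsto (fun r => inner ℝ (D.normal s x)
      (areaFraction T D.Ω₁ • (⨍ z in Metric.ball x r ∩ D.Ω₁, flux D α₁ α₂ v z)
        + areaFraction T D.Ω₂ • ⨍ z in Metric.ball x r ∩ D.Ω₂, flux D α₁ α₂ v z)) (𝓝[>] 0)
      (𝓝 (inner ℝ (D.normal s x) (meanFlux α₁ α₂ D w₁ w₂ T))) := by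
  have hV := isOpen_interior.mem_nhds hxT
  have h1 := tendsto_setAverage_of_eqOn (f := flux D α₁ α₂ v) (l := α₁ • elemGrad w₁ T)
    D.isOpen_Ω₁.measurableSet (fun r hr => D.volume_ball_inter_Ω₁_pos hx hr) hV (by
      rintro z ⟨hz, hz'⟩
      rw [flux, (h.hasGradientAt₁ hT hz hz'.2).gradient, InterfaceDomain.coeff, if_pos hz'.2])
  have h2 := tendsto_setAverage_of_eqOn (f := flux D α₁ α₂ v) (l := α₂ • elemGrad w₂ T)
    D.isOpen_Ω₂.measurableSet (fun r hr => D.volume_ball_inter_Ω₂_pos hx hr) hV (by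
      rintro z ⟨hz, hz'⟩
      rw [flux, (h.hasGradientAt₂ hT hz hz'.2).gradient, InterfaceDomain.coeff,
        if_neg (not_lt.2 hz'.2.le)])
  exact tendsto_const_nhds.inner ((h1.const_smul _).add (h2.const_smul _))

theorem IsBroken.nitscheMean_eq (h : IsBroken D 𝒯 v w₁ w₂) (s α₁ α₂ : ℝ) {T : Finset Plane}
    (hT : T ∈ 𝒯.elements) {x : Plane} (hx : x ∈ D.Γ) (hxT : x ∈ interior (tri T)) :
    nitscheMean D s T (flux D α₁ α₂ v) x
      = inner ℝ (D.normal s x) (meanFlux α₁ α₂ D w₁ w₂ T) :=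
  (h.tendsto_normalMean s α₁ α₂ hT hx hxT).limUnder_eq

/-- With unit coefficients the mean flux becomes the mean gradient of the mesh dependent norm, so
the same formulas serve both. -/
theorem flux_one_one (D : InterfaceDomain) (v : Plane → ℝ) : flux D 1 1 v = gradient v := by
  ext1 x
  simp [flux, InterfaceDomain.coeff]

theorem meanFlux_add (α₁ α₂ : ℝ) {w₁ w₂ w₁' w₂' : Plane → ℝ} (h₁ : w₁ ∈ 𝒯.linearSpace)
    (h₂ : w₂ ∈ 𝒯.linearSpace) (h₁' : w₁' ∈ 𝒯.linearSpace) (h₂' : w₂' ∈ 𝒯.linearSpace)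
    {T : Finset Plane} (hT : T ∈ 𝒯.elements) :
    meanFlux α₁ α₂ D (w₁ + w₁') (w₂ + w₂') T
      = meanFlux α₁ α₂ D w₁ w₂ T + meanFlux α₁ α₂ D w₁' w₂' T := by
  rw [meanFlux, elemGrad_add h₁ h₁' hT, elemGrad_add h₂ h₂' hT, meanFlux, meanFlux]
  module

/-- Almost every point of the interface part of a properly cut triangle is interior to it. -/
theorem CutsProperly.ae_mem_interior {T : Finset Plane} (hT : CutsProperly D T) :
    ∀ᵐ x ∂(μH[1].restrict (interfacePart D T)), x ∈ D.Γ ∧ x ∈ interior (tri T) := by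
  obtain ⟨a, b, -, hab, -⟩ := hT
  have hm : MeasurableSet (interfacePart D T) := D.measurableSet_Γ.inter (measurableSet_tri T)
  have hnull : μH[1] ({a, b} : Set Plane) = 0 := by
    have := Measure.nullSingletonClass_hausdorff Plane (d := 1) one_pos
    exact (Set.toFinite _).measure_zero _
  have h1 : ∀ᵐ x ∂(μH[1].restrict (interfacePart D T)), x ∉ ({a, b} : Set Plane) :=
    ae_restrict_of_ae (measure_eq_zero_iff_ae_notMem.1 hnull)
  filter_upwards [h1, ae_restrict_mem hm] with x hx hx'
  refine ⟨hx'.1, ?_⟩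
  by_contra hi
  refine hx ?_
  rw [← hab]
  exact ⟨hx'.1, subset_closure hx'.2, hi⟩

end Broken


/-! ### The Poincaré inequality for broken piecewise linear functions -/

/-- The transition from `w₁` to `w₂` across the band `0 ≤ φ ≤ ε`. -/
noncomputable def blend (φ w₁ w₂ : Plane → ℝ) (ε : ℝ) (x : Plane) : ℝ :=
  w₁ x + Real.smoothTransition (φ x / ε) * (w₂ x - w₁ x)

theorem blend_of_neg {φ w₁ w₂ : Plane → ℝ} {ε : ℝ} (hε : 0 < ε) {x : Plane} (hx : φ x ≤ 0) :
    blend φ w₁ w₂ ε x = w₁ x := by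
  rw [blend, Real.smoothTransition.zero_of_nonpos (div_nonpos_of_nonpos_of_nonneg hx hε.le)]
  ring

theorem blend_of_le {φ w₁ w₂ : Plane → ℝ} {ε : ℝ} (hε : 0 < ε) {x : Plane} (hx : ε ≤ φ x) :
    blend φ w₁ w₂ ε x = w₂ x := by
  rw [blend, Real.smoothTransition.one_of_one_le ((one_le_div hε).2 hx)]
  ring

/-- Product and chain rule; the cut-off has values in [0, 1] and a derivative bounded on [0, 1], and
∇φ is bounded on the closure of Ω. `M` depends on the domain alone, which makes the Poincaré
constant independent of the mesh. -/
theorem exists_norm_fderiv_blend_le (D : InterfaceDomain) :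
    ∃ M : ℝ≥0, ∀ ε : ℝ, 0 < ε → ∀ x ∈ D.band ε, ∀ w₁ w₂ : Plane → ℝ, ∀ g₁ g₂ : Plane,
      HasGradientAt w₁ g₁ x → HasGradientAt w₂ g₂ x →
      ‖fderiv ℝ (blend D.φ w₁ w₂ ε) x‖ ≤ 2 * ‖g₁‖ + ‖g₂‖ + M / ε * |w₁ x - w₂ x| := by
  have hη1 : ContDiff ℝ 1 Real.smoothTransition := Real.smoothTransition.contDiff (n := 1)
  have hcd : Continuous (deriv Real.smoothTransition) := hη1.continuous_deriv le_rfl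
  obtain ⟨M₁, hM₁⟩ := (isCompact_Icc (a := (0 : ℝ)) (b := 1)).exists_bound_of_continuousOn
    hcd.continuousOn
  have hcf : Continuous (fderiv ℝ D.φ) := D.smooth.continuous_fderiv (by simp)
  obtain ⟨M₂, hM₂⟩ := D.isCompact_closure_Ω.exists_bound_of_continuousOn hcf.continuousOn
  refine ⟨Real.toNNReal (M₁ * M₂), fun ε hε x hx w₁ w₂ g₁ g₂ h₁ h₂ => ?_⟩
  have hM₁0 : 0 ≤ M₁ := (norm_nonneg _).trans (hM₁ 0 (by simp))
  have hM₂0 : 0 ≤ M₂ := (norm_nonneg _).trans (hM₂ x (subset_closure hx.1))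
  rw [hasGradientAt_iff_hasFDerivAt] at h₁ h₂
  have hη :
      HasDerivAt Real.smoothTransition (deriv Real.smoothTransition (D.φ x / ε)) (D.φ x / ε) :=
    ((hη1.differentiable (by simp)) _).hasDerivAt
  have hφ : HasFDerivAt (fun z => D.φ z / ε) (ε⁻¹ • fderiv ℝ D.φ x) x := by
    have e : (fun z => D.φ z / ε) = ε⁻¹ • D.φ := by ext z; simp [div_eq_inv_mul]
    rw [e]
    exact ((D.differentiable_φ x).hasFDerivAt).const_smul ε⁻¹
  have hχ := hη.comp_hasFDerivAt x hφ
  have hmul := hχ.mul (h₂.sub h₁)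
  have htot := h₁.add hmul
  have hfd : fderiv ℝ (blend D.φ w₁ w₂ ε) x = _ := htot.fderiv
  rw [hfd]
  set c := Real.smoothTransition (D.φ x / ε) with hc
  have hc0 : 0 ≤ c := Real.smoothTransition.nonneg _
  have hc1 : c ≤ 1 := Real.smoothTransition.le_one _
  have hb := hM₁ (D.φ x / ε) ⟨div_nonneg hx.2.1 hε.le, (div_le_one hε).2 hx.2.2⟩
  have hb2 := hM₂ x (subset_closure hx.1)
  refine (norm_add_le _ _).trans ?_
  have e1 : ‖(InnerProductSpace.toDual ℝ Plane) g₁‖ = ‖g₁‖ := LinearIsometryEquiv.norm_map _ _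
  have e2 : ‖(InnerProductSpace.toDual ℝ Plane) g₂‖ = ‖g₂‖ := LinearIsometryEquiv.norm_map _ _
  rw [e1]
  have h3 := norm_add_le ((Real.smoothTransition ∘ fun z => D.φ z / ε) x •
      ((InnerProductSpace.toDual ℝ Plane) g₂ - (InnerProductSpace.toDual ℝ Plane) g₁))
    ((w₂ - w₁) x • (deriv Real.smoothTransition (D.φ x / ε) • ε⁻¹ • fderiv ℝ D.φ x))
  have h4 : ‖(Real.smoothTransition ∘ fun z => D.φ z / ε) x •
      ((InnerProductSpace.toDual ℝ Plane) g₂ - (InnerProductSpace.toDual ℝ Plane) g₁)‖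
      ≤ ‖g₁‖ + ‖g₂‖ := by
    rw [norm_smul, Function.comp_apply, ← hc, Real.norm_of_nonneg hc0]
    have h5 := norm_sub_le ((InnerProductSpace.toDual ℝ Plane) g₂)
      ((InnerProductSpace.toDual ℝ Plane) g₁)
    rw [e1, e2] at h5
    calc c * _ ≤ 1 * (‖g₂‖ + ‖g₁‖) := by gcongr
      _ = _ := by ring
  have h5 : ‖(w₂ - w₁) x • (deriv Real.smoothTransition (D.φ x / ε) • ε⁻¹ • fderiv ℝ D.φ x)‖
      ≤ (Real.toNNReal (M₁ * M₂) : ℝ) / ε * |w₁ x - w₂ x| := by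
    rw [norm_smul, norm_smul, norm_smul, Real.coe_toNNReal _ (by positivity), Pi.sub_apply,
      norm_inv, Real.norm_of_nonneg hε.le, Real.norm_eq_abs, abs_sub_comm]
    calc |w₁ x - w₂ x| * (‖deriv Real.smoothTransition (D.φ x / ε)‖ * (ε⁻¹ * ‖fderiv ℝ D.φ x‖))
        ≤ |w₁ x - w₂ x| * (M₁ * (ε⁻¹ * M₂)) := by gcongr
      _ = _ := by rw [div_eq_mul_inv]; ring
  linarith

section Broken

variable {D : InterfaceDomain} {𝒯 : Triangulation D.Ω} {v w₁ w₂ : Plane → ℝ}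

/-- On T the blend agrees with a C¹ function built from affine ones, which is Lipschitz on a compact
set. The size of the constant plays no role. -/
theorem exists_blend_lipschitzOnWith_tri (D : InterfaceDomain) (𝒯 : Triangulation D.Ω)
    (h₁ : w₁ ∈ 𝒯.linearSpace) (h₂ : w₂ ∈ 𝒯.linearSpace) (ε : ℝ) {T : Finset Plane}
    (hT : T ∈ 𝒯.elements) : ∃ K : ℝ≥0, LipschitzOnWith K (blend D.φ w₁ w₂ ε) (tri T) := by
  obtain ⟨A₁, hA₁⟩ := h₁.2.2 T hT
  obtain ⟨A₂, hA₂⟩ := h₂.2.2 T hT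
  have haff : ∀ A : Plane →ᵃ[ℝ] ℝ, ContDiff ℝ 1 A := by
    intro A
    have h : (A : Plane → ℝ) = fun x => A.linear.toContinuousLinearMap x + A 0 := by
      ext z; rw [AffineMap.decomp A]; simp
    rw [h]
    exact (ContinuousLinearMap.contDiff _).add contDiff_const
  have hφ : ContDiff ℝ 1 D.φ := D.smooth.of_le (by exact_mod_cast le_top)
  have hη1 : ContDiff ℝ 1 Real.smoothTransition := Real.smoothTransition.contDiff (n := 1)
  have hsm : ContDiff ℝ 1 (blend D.φ A₁ A₂ ε) :=
    (haff A₁).add ((hη1.comp (hφ.div_const ε)).mul ((haff A₂).sub (haff A₁)))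
  obtain ⟨K, hK⟩ := (hsm.locallyLipschitz.locallyLipschitzOn
    (s := tri T)).exists_lipschitzOnWith_of_compact (isCompact_tri T)
  have e : ∀ x ∈ tri T, blend D.φ w₁ w₂ ε x = blend D.φ A₁ A₂ ε x := fun x hx => by
    simp only [blend, hA₁ x hx, hA₂ x hx]
  refine ⟨K, fun x hx z hz => ?_⟩
  rw [e x hx, e z hz]
  exact hK hx hz

/-- The condition on ε keeps the transition off the boundary, so that the blend has the boundary
values of v. -/
theorem IsBroken.blend_eq_zero (h : IsBroken D 𝒯 v w₁ w₂) (hbd : ∀ x ∈ frontier D.Ω, v x = 0)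
    {ε : ℝ} (hε : 0 < ε) (hfr : ∀ x ∈ frontier D.Ω, ε ≤ |D.φ x|) {x : Plane} (hx : x ∉ D.Ω) :
    blend D.φ w₁ w₂ ε x = 0 := by
  by_cases hcl : x ∈ closure D.Ω
  · have hxf : x ∈ frontier D.Ω := ⟨hcl, by rwa [D.isOpen_Ω.interior_eq]⟩
    have h1 := hfr x hxf
    rcases lt_or_gt_of_ne (D.internal x hxf) with hneg | hpos
    · rw [blend_of_neg hε hneg.le, ← h.eq₁ x hneg, hbd x hxf]
    · rw [abs_of_pos hpos] at h1
      rw [blend_of_le hε h1, ← h.eq₂ x hpos, hbd x hxf]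
  · simp [blend, h.mem₁.1 x hcl, h.mem₂.1 x hcl]

/-- The triangles together with the complement of Ω (the index `none`) form a finite closed cover,
and the blend is continuous and Lipschitz on each member. -/
theorem IsBroken.exists_lipschitzWith_blend (h : IsBroken D 𝒯 v w₁ w₂)
    (hbd : ∀ x ∈ frontier D.Ω, v x = 0)
    {ε : ℝ} (hε : 0 < ε) (hfr : ∀ x ∈ frontier D.Ω, ε ≤ |D.φ x|) :
    ∃ K : ℝ≥0, LipschitzWith K (blend D.φ w₁ w₂ ε) := by
  have hz : ∀ x ∈ D.Ωᶜ, blend D.φ w₁ w₂ ε x = 0 := fun x hx => h.blend_eq_zero hbd hε hfr hx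
  have hcont : Continuous (blend D.φ w₁ w₂ ε) := by
    have hc1 : ContinuousOn (blend D.φ w₁ w₂ ε) (closure D.Ω) :=
      h.mem₁.2.1.add (((Real.smoothTransition.continuous.comp
        (D.continuous_φ.div_const ε)).continuousOn).mul (h.mem₂.2.1.sub h.mem₁.2.1))
    have hc2 : ContinuousOn (blend D.φ w₁ w₂ ε) D.Ωᶜ := continuousOn_const.congr hz
    have := hc1.union_of_isClosed hc2 isClosed_closure D.isOpen_Ω.isClosed_compl
    rw [← continuousOn_univ]
    refine this.mono fun x _ => ?_
    by_cases hx : x ∈ D.Ω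
    · exact Or.inl (subset_closure hx)
    · exact Or.inr hx
  choose! K hK using fun T (hT : T ∈ 𝒯.elements) =>
    exists_blend_lipschitzOnWith_tri D 𝒯 h.mem₁ h.mem₂ ε hT
  refine ⟨𝒯.elements.sup K, lipschitzWith_of_finite_closed_cover (Finset.insertNone 𝒯.elements)
    (fun o => o.elim D.Ωᶜ tri) ?_ ?_ hcont ?_⟩
  · rintro (_ | T) _
    · exact D.isOpen_Ω.isClosed_compl
    · exact isClosed_tri T
  · intro x
    by_cases hx : x ∈ D.Ω
    · obtain ⟨T, hT, hxT⟩ := 𝒯.exists_mem_tri (subset_closure hx)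
      exact ⟨some T, by simpa using hT, hxT⟩
    · exact ⟨none, by simp, hx⟩
  · rintro (_ | T) hT
    · refine LipschitzOnWith.of_dist_le_mul fun x hx z hz' => ?_
      rw [hz x hx, hz z hz', dist_self]; positivity
    · have hT' : T ∈ 𝒯.elements := by simpa using hT
      exact (hK T hT').weaken (Finset.le_sup hT')

theorem enorm_gradient (v : Plane → ℝ) (x : Plane) : ‖gradient v x‖ₑ = ‖fderiv ℝ v x‖ₑ := by
  rw [gradient, enorm_eq_iff_norm_eq]
  exact LinearIsometryEquiv.norm_map _ _

theorem measurableSet_Ω₁_union_Ω₂ (D : InterfaceDomain) : MeasurableSet (D.Ω₁ ∪ D.Ω₂) :=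
  (D.isOpen_Ω₁.union D.isOpen_Ω₂).measurableSet

/-- A pointwise bound for the gradient of the transition between `w₁` and `w₂`. -/
theorem exists_enorm_fderiv_blend_le (D : InterfaceDomain) : ∃ M : ℝ≥0, ∀ (𝒯 : Triangulation D.Ω)
    (v w₁ w₂ : Plane → ℝ), IsBroken D 𝒯 v w₁ w₂ → (∀ x ∈ frontier D.Ω, v x = 0) →
    ∃ G : ℝ≥0, ∀ ε : ℝ, 0 < ε → (∀ x ∈ frontier D.Ω, ε ≤ |D.φ x|) →
      ∀ᵐ x, ‖fderiv ℝ (blend D.φ w₁ w₂ ε) x‖ₑ ≤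
        (D.Ω₁ ∪ D.Ω₂).indicator (fun x => ‖gradient v x‖ₑ) x
          + (D.band ε).indicator
            (fun x => G + ENNReal.ofReal (M / ε) * ‖w₁ x - w₂ x‖ₑ) x := by
  obtain ⟨M, hM⟩ := exists_norm_fderiv_blend_le D
  -- This `G` may depend on the mesh and the functions: it is integrated only over the band, whose
  -- area tends to zero.
  refine ⟨M, fun 𝒯 v w₁ w₂ h hbd => ⟨Real.toNNReal
    (∑ T ∈ 𝒯.elements, (2 * ‖elemGrad w₁ T‖ + ‖elemGrad w₂ T‖)), fun ε hε hfr => ?_⟩⟩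
  have hfr0 : ∀ᵐ x : Plane, x ∉ frontier D.Ω :=
    measure_eq_zero_iff_ae_notMem.1 (D.convex_Ω.addHaar_frontier volume)
  filter_upwards [𝒯.ae_mem_interior_tri, hfr0] with x hx hxf
  by_cases hcl : x ∈ closure D.Ω
  · have hxΩ : x ∈ D.Ω := by
      by_contra hne
      exact hxf ⟨hcl, by rwa [D.isOpen_Ω.interior_eq]⟩
    obtain ⟨T, hT, hxT⟩ := hx hcl
    rcases lt_or_ge (D.φ x) 0 with hneg | hnn
    · have heq : blend D.φ w₁ w₂ ε =ᶠ[𝓝 x] v := by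
        filter_upwards [(isOpen_lt D.continuous_φ continuous_const).mem_nhds hneg] with z hz
        rw [blend_of_neg hε (le_of_lt hz), h.eq₁ z hz]
      have hmem : x ∈ D.Ω₁ ∪ D.Ω₂ := Or.inl ⟨hxΩ, hneg⟩
      rw [heq.fderiv_eq, indicator_of_mem hmem, enorm_gradient]
      exact le_self_add
    rcases lt_or_ge ε (D.φ x) with hgt | hle
    · have heq : blend D.φ w₁ w₂ ε =ᶠ[𝓝 x] v := by
        filter_upwards [(isOpen_lt continuous_const D.continuous_φ).mem_nhds hgt] with z hz
        have hz : ε < D.φ z := hz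
        rw [blend_of_le hε hz.le, h.eq₂ z (hε.trans hz)]
      have hmem : x ∈ D.Ω₁ ∪ D.Ω₂ := Or.inr ⟨hxΩ, hε.trans hgt⟩
      rw [heq.fderiv_eq, indicator_of_mem hmem, enorm_gradient]
      exact le_self_add
    · have hband : x ∈ D.band ε := ⟨hxΩ, hnn, hle⟩
      rw [indicator_of_mem hband]
      refine le_add_left ?_
      have h1 := hM ε hε x hband w₁ w₂ _ _ (hasGradientAt_elemGrad h.mem₁ hT hxT)
        (hasGradientAt_elemGrad h.mem₂ hT hxT)
      have h2 : 2 * ‖elemGrad w₁ T‖ + ‖elemGrad w₂ T‖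
          ≤ ∑ T ∈ 𝒯.elements, (2 * ‖elemGrad w₁ T‖ + ‖elemGrad w₂ T‖) :=
        Finset.single_le_sum (f := fun T => 2 * ‖elemGrad w₁ T‖ + ‖elemGrad w₂ T‖)
          (fun T _ => by positivity) hT
      rw [← ofReal_norm, ← ofReal_norm]
      rw [← ENNReal.ofReal_mul (by positivity), Real.norm_eq_abs, ENNReal.ofNNReal_toNNReal,
        ← ENNReal.ofReal_add (by positivity) (by positivity)]
      exact ENNReal.ofReal_le_ofReal (by linarith)
  · have heq : blend D.φ w₁ w₂ ε =ᶠ[𝓝 x] fun _ => 0 := by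
      filter_upwards [isClosed_closure.isOpen_compl.mem_nhds hcl] with z hz
      exact h.blend_eq_zero hbd hε hfr fun hz' => hz (subset_closure hz')
    have h0 : fderiv ℝ (fun _ : Plane => (0 : ℝ)) x = 0 := fderiv_const_apply 0
    rw [heq.fderiv_eq, h0, ← ofReal_norm, norm_zero, ENNReal.ofReal_zero]
    exact zero_le

/-! ### The Poincaré inequality as a limit of thin bands -/

theorem lintegral_sq_le (μ : Measure Plane) {f : Plane → ℝ≥0∞} (hf : AEMeasurable f μ) :
    (∫⁻ x, f x ∂μ) ^ 2 ≤ μ univ * ∫⁻ x, f x ^ 2 ∂μ := by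
  have h := ENNReal.lintegral_mul_le_Lp_mul_Lq μ Real.HolderConjugate.two_two hf
    (aemeasurable_const (b := (1 : ℝ≥0∞)))
  simp only [Pi.mul_apply, mul_one, ENNReal.rpow_two, one_pow, lintegral_one] at h
  calc (∫⁻ x, f x ∂μ) ^ 2 ≤ ((∫⁻ x, f x ^ 2 ∂μ) ^ (1 / 2 : ℝ) * μ univ ^ (1 / 2 : ℝ)) ^ 2 := by
        gcongr
    _ = _ := by
        rw [mul_pow, ← ENNReal.rpow_two, ← ENNReal.rpow_mul, ← ENNReal.rpow_two, ← ENNReal.rpow_mul]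
        norm_num
        rw [mul_comm]

/-- The inequality ‖·‖_{L²} ≤ ‖∇·‖_{L¹} is applied to the blend. Off the band the blend is v; in the
band the term |w₁ − w₂|/ε is integrated by the band estimate and leaves the jump on Γ. -/
theorem exists_poincare_one (D : InterfaceDomain) : ∃ C : ℝ≥0, ∀ (𝒯 : Triangulation D.Ω)
    (v w₁ w₂ : Plane → ℝ), IsBroken D 𝒯 v w₁ w₂ → (∀ x ∈ frontier D.Ω, v x = 0) →
    ∫⁻ x in D.Ω, ‖v x‖ₑ ^ 2 ≤
      ((∫⁻ x in D.Ω₁ ∪ D.Ω₂, ‖gradient v x‖ₑ) + C * ∫⁻ x in D.Γ, ‖w₁ x - w₂ x‖ₑ ∂μH[1]) ^ 2 := by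
  obtain ⟨M, hM⟩ := exists_enorm_fderiv_blend_le D
  obtain ⟨C, hC⟩ := D.exists_setLIntegral_band_le
  refine ⟨M * C, fun 𝒯 v w₁ w₂ h hbd => ?_⟩
  obtain ⟨G, hG⟩ := hM 𝒯 v w₁ w₂ h hbd
  obtain ⟨B, hB⟩ := h.bounded
  set A := ∫⁻ x in D.Ω₁ ∪ D.Ω₂, ‖gradient v x‖ₑ with hA
  set J := ∫⁻ x in D.Γ, ‖w₁ x - w₂ x‖ₑ ∂μH[1] with hJ
  have hw₁ := measurable_of_mem_linearSpace h.mem₁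
  have hw₂ := measurable_of_mem_linearSpace h.mem₂
  have hmg : Measurable fun x => ‖gradient v x‖ₑ := (measurable_gradient v).enorm
  -- smallness of `ε` on the boundary
  have hfr : ∀ᶠ ε in 𝓝[>] (0 : ℝ), ∀ x ∈ frontier D.Ω, ε ≤ |D.φ x| := by
    have hcomp : IsCompact (frontier D.Ω) :=
      D.isCompact_closure_Ω.of_isClosed_subset isClosed_frontier frontier_subset_closure
    rcases (frontier D.Ω).eq_empty_or_nonempty with he | hne
    · simp [he]
    · obtain ⟨x₁, hx₁, hmin⟩ := hcomp.exists_isMinOn hne D.continuous_φ.abs.continuousOn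
      filter_upwards [nhdsWithin_le_nhds (eventually_lt_nhds (abs_pos.2 (D.internal x₁ hx₁)))]
        with ε hε x hx
      exact hε.le.trans (isMinOn_iff.1 hmin x hx)
  -- Two limits in succession: ε → 0 for fixed δ removes the terms with the area of the band, then δ
  -- → 0.
  have step : ∀ δ : ℝ≥0, 0 < δ → ∫⁻ x in D.Ω, ‖v x‖ₑ ^ 2 ≤ (A + M * (C * J + δ)) ^ 2 := by
    intro δ hδ
    have hband := D.tendsto_volume_band
    have hlim : Tendsto (fun ε => (A + (G * volume (D.band ε) + M * (C * J + δ))) ^ 2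
        + ENNReal.ofReal B ^ 2 * volume (D.band ε)) (𝓝[>] 0) (𝓝 ((A + M * (C * J + δ)) ^ 2)) := by
      have h1 := ENNReal.Tendsto.const_mul (a := (G : ℝ≥0∞)) hband (Or.inr (by simp))
      have h2 := ENNReal.Tendsto.const_mul (a := ENNReal.ofReal B ^ 2) hband
        (Or.inr (ENNReal.pow_ne_top ENNReal.ofReal_ne_top))
      have h3 := (ENNReal.Tendsto.pow (n := 2)
        ((h1.add_const (M * (C * J + (δ : ℝ≥0∞)))).const_add A)).add h2
      simpa using h3
    refine ge_of_tendsto hlim ?_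
    filter_upwards [hfr, self_mem_nhdsWithin, hC (fun x => w₁ x - w₂ x) (hw₁.sub hw₂)
      (h.mem₁.2.1.sub h.mem₂.2.1) δ hδ] with ε hε hε0 hεC
    have hε0 : 0 < ε := hε0
    obtain ⟨K, hK⟩ := h.exists_lipschitzWith_blend hbd hε0 hε
    have hcs : HasCompactSupport (blend D.φ w₁ w₂ ε) :=
      HasCompactSupport.intro D.isCompact_closure_Ω fun x hx =>
        h.blend_eq_zero hbd hε0 hε fun hx' => hx (subset_closure hx')
    have hgns := lintegral_sq_le_sq_lintegral_fderiv hK hcs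
    have hgrad : ∫⁻ x, ‖fderiv ℝ (blend D.φ w₁ w₂ ε) x‖ₑ
        ≤ A + (G * volume (D.band ε) + M * (C * J + δ)) := by
      refine (lintegral_mono_ae (hG ε hε0 hε)).trans ?_
      rw [lintegral_add_left (hmg.indicator (measurableSet_Ω₁_union_Ω₂ D)),
        lintegral_indicator (measurableSet_Ω₁_union_Ω₂ D),
        lintegral_indicator (D.measurableSet_band ε), lintegral_add_left measurable_const,
        setLIntegral_const, lintegral_const_mul' _ _ ENNReal.ofReal_ne_top]
      -- The factor 1/ε of the gradient cancels against the width ε of the band.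
      refine add_le_add le_rfl (add_le_add le_rfl ?_)
      calc ENNReal.ofReal (M / ε) * ∫⁻ x in D.band ε, ‖w₁ x - w₂ x‖ₑ
          ≤ ENNReal.ofReal (M / ε) * (ENNReal.ofReal ε * (C * J + δ)) := by gcongr
        _ = M * (C * J + δ) := by
          rw [← mul_assoc, ← ENNReal.ofReal_mul (by positivity), div_mul_cancel₀ _ hε0.ne',
            ENNReal.ofReal_coe_nnreal]
    have hpt : ∀ x ∈ D.Ω, ‖v x‖ₑ ^ 2 ≤ ‖blend D.φ w₁ w₂ ε x‖ₑ ^ 2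
        + (D.band ε).indicator (fun _ => ENNReal.ofReal B ^ 2) x := by
      intro x hx
      rcases lt_or_ge (D.φ x) 0 with hneg | hnn
      · rw [blend_of_neg hε0 hneg.le, h.eq₁ x hneg]; exact le_self_add
      rcases lt_or_ge ε (D.φ x) with hgt | hle
      · rw [blend_of_le hε0 hgt.le, h.eq₂ x (hε0.trans hgt)]; exact le_self_add
      · have hmem : x ∈ D.band ε := ⟨hx, hnn, hle⟩
        rw [indicator_of_mem hmem]
        refine le_add_left ?_
        gcongr
        rw [Real.enorm_eq_ofReal_abs]
        exact ENNReal.ofReal_le_ofReal (hB x)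
    calc ∫⁻ x in D.Ω, ‖v x‖ₑ ^ 2
        ≤ ∫⁻ x in D.Ω, (‖blend D.φ w₁ w₂ ε x‖ₑ ^ 2
          + (D.band ε).indicator (fun _ => ENNReal.ofReal B ^ 2) x) :=
          setLIntegral_mono' D.isOpen_Ω.measurableSet hpt
      _ ≤ ∫⁻ x, (‖blend D.φ w₁ w₂ ε x‖ₑ ^ 2
          + (D.band ε).indicator (fun _ => ENNReal.ofReal B ^ 2) x) := setLIntegral_le_lintegral _ _
      _ = (∫⁻ x, ‖blend D.φ w₁ w₂ ε x‖ₑ ^ 2) + ENNReal.ofReal B ^ 2 * volume (D.band ε) := by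
          rw [lintegral_add_left (hK.continuous.measurable.enorm.pow_const 2),
            lintegral_indicator (D.measurableSet_band ε), setLIntegral_const]
      _ ≤ _ := by
          gcongr
          exact hgns.trans (by gcongr)
  have hlim : Tendsto (fun δ : ℝ≥0 => (A + M * (C * J + (δ : ℝ≥0∞))) ^ 2) (𝓝[>] 0)
      (𝓝 ((A + M * (C * J)) ^ 2)) := by
    have h0 : Tendsto (fun δ : ℝ≥0 => (δ : ℝ≥0∞)) (𝓝[>] 0) (𝓝 0) := by
      have := (ENNReal.continuous_coe).tendsto (0 : ℝ≥0)
      rw [ENNReal.coe_zero] at this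
      exact this.mono_left nhdsWithin_le_nhds
    have h1 := ENNReal.Tendsto.const_mul (a := (M : ℝ≥0∞)) (h0.const_add (C * J))
      (Or.inr (by simp))
    have h2 := ENNReal.Tendsto.pow (n := 2) (h1.const_add A)
    simpa using h2
  have := ge_of_tendsto hlim (Filter.mem_of_superset self_mem_nhdsWithin fun δ hδ => step δ hδ)
  rwa [ENNReal.coe_mul, mul_assoc]

/-- The `L²` norm of a broken piecewise linear function that vanishes on the boundary is controlled
by its gradient and its jump across the interface. -/
theorem exists_poincare (D : InterfaceDomain) : ∃ C : ℝ≥0, ∀ (𝒯 : Triangulation D.Ω)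
    (v w₁ w₂ : Plane → ℝ), IsBroken D 𝒯 v w₁ w₂ → (∀ x ∈ frontier D.Ω, v x = 0) →
    ∫⁻ x in D.Ω, ‖v x‖ₑ ^ 2 ≤
      C * ((∫⁻ x in D.Ω₁ ∪ D.Ω₂, ‖gradient v x‖ₑ ^ 2)
        + ∫⁻ x in D.Γ, ‖w₁ x - w₂ x‖ₑ ^ 2 ∂μH[1]) := by
  obtain ⟨C, hC⟩ := exists_poincare_one D
  have hfin1 : volume (D.Ω₁ ∪ D.Ω₂) ≠ ∞ :=
    ((measure_mono (union_subset (fun x hx => hx.1) fun x hx => hx.1)).trans_lt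
      D.volume_Ω_lt_top).ne
  have hfin2 : μH[1] D.Γ ≠ ∞ := D.hausdorffMeasure_Γ_lt_top.ne
  set a := (volume (D.Ω₁ ∪ D.Ω₂)).toNNReal
  set b := (μH[1] D.Γ).toNNReal
  have ha : (a : ℝ≥0∞) = volume (D.Ω₁ ∪ D.Ω₂) := ENNReal.coe_toNNReal hfin1
  have hb : (b : ℝ≥0∞) = μH[1] D.Γ := ENNReal.coe_toNNReal hfin2
  -- From (A + CJ)² ≤ 2A² + 2(CJ)² and Cauchy–Schwarz against 1 for each term, with the area `a` and
  -- the length `b`.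
  refine ⟨2 * a + 2 * (C ^ 2 * b), fun 𝒯 v w₁ w₂ h hbd => (hC 𝒯 v w₁ w₂ h hbd).trans ?_⟩
  have hw₁ := measurable_of_mem_linearSpace h.mem₁
  have hw₂ := measurable_of_mem_linearSpace h.mem₂
  have h1 := lintegral_sq_le (volume.restrict (D.Ω₁ ∪ D.Ω₂))
    (measurable_gradient v).enorm.aemeasurable
  have h2 := lintegral_sq_le (μH[1].restrict D.Γ) (hw₁.sub hw₂).enorm.aemeasurable
  simp only [Measure.restrict_apply_univ, ← ha, ← hb, Pi.sub_apply] at h1 h2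
  set P := ∫⁻ x in D.Ω₁ ∪ D.Ω₂, ‖gradient v x‖ₑ ^ 2
  set Q := ∫⁻ x in D.Γ, ‖w₁ x - w₂ x‖ₑ ^ 2 ∂μH[1]
  set A := ∫⁻ x in D.Ω₁ ∪ D.Ω₂, ‖gradient v x‖ₑ
  set J := ∫⁻ x in D.Γ, ‖w₁ x - w₂ x‖ₑ ∂μH[1]
  have h3 : (A + C * J) ^ 2 ≤ 2 * A ^ 2 + 2 * (C * J) ^ 2 := by
    have := ENNReal.rpow_add_le_mul_rpow_add_rpow A (C * J) (p := 2) (by norm_num)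
    rw [show (2 : ℝ) - 1 = 1 by norm_num, ENNReal.rpow_one, ENNReal.rpow_two, ENNReal.rpow_two,
      ENNReal.rpow_two, mul_add] at this
    exact this
  calc (A + C * J) ^ 2 ≤ 2 * A ^ 2 + 2 * (C * J) ^ 2 := h3
    _ ≤ 2 * (a * P) + 2 * (C ^ 2 * (b * Q)) := by rw [mul_pow]; gcongr
    _ ≤ ((2 * a + 2 * (C ^ 2 * b) : ℝ≥0) : ℝ≥0∞) * (P + Q) := by
        push_cast
        have : (2 * (a : ℝ≥0∞) + 2 * ((C : ℝ≥0∞) ^ 2 * b)) * (P + Q)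
            = (2 * (a * P) + 2 * (C ^ 2 * (b * Q))) + (2 * (C ^ 2 * b) * P + 2 * a * Q) := by ring
        rw [this]
        exact le_self_add

end Broken


/-! ### Bilinearity of the Nitsche form -/

theorem InterfaceDomain.measurable_normal (D : InterfaceDomain) (s : ℝ) :
    Measurable (D.normal s) := by
  have h := D.continuous_gradient_φ.measurable
  exact (h.norm.inv.smul h).const_smul s

theorem InterfaceDomain.norm_normal_le (D : InterfaceDomain) {s : ℝ} (hs : s = 1 ∨ s = -1)
    (x : Plane) : ‖D.normal s x‖ ≤ 1 := by
  have h1 : ‖s‖ = 1 := by rcases hs with rfl | rfl <;> simp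
  rw [InterfaceDomain.normal, norm_smul, norm_smul, h1, one_mul, norm_inv, norm_norm]
  exact inv_mul_le_one

theorem InterfaceDomain.measurable_coeff (D : InterfaceDomain) (α₁ α₂ : ℝ) :
    Measurable (D.coeff α₁ α₂) :=
  Measurable.ite (isOpen_lt D.continuous_φ continuous_const).measurableSet
    measurable_const measurable_const

theorem InterfaceDomain.abs_coeff_le (D : InterfaceDomain) (α₁ α₂ : ℝ) (x : Plane) :
    |D.coeff α₁ α₂ x| ≤ |α₁| + |α₂| := by
  unfold InterfaceDomain.coeff
  split_ifs
  · linarith [abs_nonneg α₂]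
  · linarith [abs_nonneg α₁]

theorem mem_interfaceElements {D : InterfaceDomain} {𝒯 : Triangulation D.Ω} {T : Finset Plane} :
    T ∈ interfaceElements D 𝒯 ↔ T ∈ 𝒯.elements ∧ (D.Γ ∩ interior (tri T)).Nonempty := by
  classical
  simp [interfaceElements]

theorem measurableSet_interfacePart (D : InterfaceDomain) (T : Finset Plane) :
    MeasurableSet (interfacePart D T) := D.measurableSet_Γ.inter (measurableSet_tri T)

theorem hausdorffMeasure_interfacePart_lt_top (D : InterfaceDomain) (T : Finset Plane) :
    μH[1] (interfacePart D T) < ∞ :=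
  (measure_mono inter_subset_left).trans_lt D.hausdorffMeasure_Γ_lt_top

instance (D : InterfaceDomain) (T : Finset Plane) :
    IsFiniteMeasure (μH[1].restrict (interfacePart D T)) :=
  ⟨by rw [Measure.restrict_apply_univ]; exact hausdorffMeasure_interfacePart_lt_top D T⟩

instance (D : InterfaceDomain) : IsFiniteMeasure (volume.restrict (D.Ω₁ ∪ D.Ω₂)) :=
  ⟨by
    rw [Measure.restrict_apply_univ]
    exact (measure_mono (union_subset (fun x hx => hx.1) fun x hx => hx.1)).trans_lt
      D.volume_Ω_lt_top⟩

section Broken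

variable {D : InterfaceDomain} {𝒯 : Triangulation D.Ω} {v w₁ w₂ v' w₁' w₂' : Plane → ℝ}

theorem ae_mem_interior_tri_of_mem_union (𝒯 : Triangulation D.Ω) :
    ∀ᵐ x ∂(volume.restrict (D.Ω₁ ∪ D.Ω₂)), ∃ T ∈ 𝒯.elements, x ∈ interior (tri T) ∧
      (D.φ x < 0 ∨ 0 < D.φ x) := by
  filter_upwards [ae_restrict_of_ae 𝒯.ae_mem_interior_tri,
    ae_restrict_mem (measurableSet_Ω₁_union_Ω₂ D)] with x hx hx'
  rcases hx' with hx' | hx'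
  · obtain ⟨T, hT, hxT⟩ := hx (subset_closure hx'.1)
    exact ⟨T, hT, hxT, Or.inl hx'.2⟩
  · obtain ⟨T, hT, hxT⟩ := hx (subset_closure hx'.1)
    exact ⟨T, hT, hxT, Or.inr hx'.2⟩

/-- Only almost everywhere: on mesh edges `gradient` may be the default value 0, which is not
additive. -/
theorem IsBroken.gradient_add (h : IsBroken D 𝒯 v w₁ w₂) (h' : IsBroken D 𝒯 v' w₁' w₂') :
    ∀ᵐ x ∂(volume.restrict (D.Ω₁ ∪ D.Ω₂)), gradient (v + v') x = gradient v x + gradient v' x := by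
  filter_upwards [ae_mem_interior_tri_of_mem_union 𝒯] with x hx
  obtain ⟨T, hT, hxT, hφ | hφ⟩ := hx
  · rw [((h.add h').hasGradientAt₁ hT hxT hφ).gradient, (h.hasGradientAt₁ hT hxT hφ).gradient,
      (h'.hasGradientAt₁ hT hxT hφ).gradient, elemGrad_add h.mem₁ h'.mem₁ hT]
  · rw [((h.add h').hasGradientAt₂ hT hxT hφ).gradient, (h.hasGradientAt₂ hT hxT hφ).gradient,
      (h'.hasGradientAt₂ hT hxT hφ).gradient, elemGrad_add h.mem₂ h'.mem₂ hT]

theorem IsBroken.exists_gradient_bound (h : IsBroken D 𝒯 v w₁ w₂) :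
    ∃ B : ℝ, ∀ᵐ x ∂(volume.restrict (D.Ω₁ ∪ D.Ω₂)), ‖gradient v x‖ ≤ B := by
  refine ⟨∑ T ∈ 𝒯.elements, (‖elemGrad w₁ T‖ + ‖elemGrad w₂ T‖), ?_⟩
  filter_upwards [ae_mem_interior_tri_of_mem_union 𝒯] with x hx
  obtain ⟨T, hT, hxT, hφ⟩ := hx
  refine le_trans ?_ (Finset.single_le_sum (f := fun T => ‖elemGrad w₁ T‖ + ‖elemGrad w₂ T‖)
          (fun T _ => by positivity) hT)
  rcases hφ with hφ | hφ
  · rw [(h.hasGradientAt₁ hT hxT hφ).gradient]; linarith [norm_nonneg (elemGrad w₂ T)]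
  · rw [(h.hasGradientAt₂ hT hxT hφ).gradient]; linarith [norm_nonneg (elemGrad w₁ T)]

theorem IsBroken.integrable_inner_flux (h : IsBroken D 𝒯 v w₁ w₂) (h' : IsBroken D 𝒯 v' w₁' w₂')
    (α₁ α₂ : ℝ) :
    IntegrableOn (fun x => inner ℝ (flux D α₁ α₂ v x) (gradient v' x)) (D.Ω₁ ∪ D.Ω₂) := by
  obtain ⟨B, hB⟩ := h.exists_gradient_bound
  obtain ⟨B', hB'⟩ := h'.exists_gradient_bound
  refine Integrable.of_bound (C := (|α₁| + |α₂|) * B * B') ?_ ?_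
  · exact (((D.measurable_coeff α₁ α₂).smul (measurable_gradient v)).inner
      (measurable_gradient v')).aestronglyMeasurable
  · filter_upwards [hB, hB'] with x hx hx'
    refine (norm_inner_le_norm _ _).trans ?_
    have hB0 := (norm_nonneg _).trans hx
    have : ‖flux D α₁ α₂ v x‖ ≤ (|α₁| + |α₂|) * B := by
      rw [flux, norm_smul, Real.norm_eq_abs]
      gcongr
      exact D.abs_coeff_le α₁ α₂ x
    gcongr

theorem IsBroken.setIntegral_nitscheMean_mul_jump (h : IsBroken D 𝒯 v w₁ w₂)
    (h' : IsBroken D 𝒯 v' w₁' w₂') (hres : Resolves D 𝒯) (s α₁ α₂ : ℝ) {T : Finset Plane}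
    (hT : T ∈ interfaceElements D 𝒯) :
    ∫ x in interfacePart D T, nitscheMean D s T (flux D α₁ α₂ v) x * D.jump v' x ∂μH[1]
      = ∫ x in interfacePart D T,
        inner ℝ (D.normal s x) (meanFlux α₁ α₂ D w₁ w₂ T) * (w₁' x - w₂' x) ∂μH[1] := by
  refine integral_congr_ae ?_
  filter_upwards [(hres.1 T hT).ae_mem_interior] with x hx
  rw [h.nitscheMean_eq s α₁ α₂ (mem_interfaceElements.1 hT).1 hx.1 hx.2, h'.jump_eq hx.1]

theorem IsBroken.setIntegral_jump_mul_jump (h : IsBroken D 𝒯 v w₁ w₂)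
    (h' : IsBroken D 𝒯 v' w₁' w₂') (T : Finset Plane) :
    ∫ x in interfacePart D T, D.jump v x * D.jump v' x ∂μH[1]
      = ∫ x in interfacePart D T, (w₁ x - w₂ x) * (w₁' x - w₂' x) ∂μH[1] := by
  refine setIntegral_congr_fun (measurableSet_interfacePart D T) fun x hx => ?_
  simp only [h.jump_eq hx.1, h'.jump_eq hx.1]

theorem IsBroken.exists_jump_bound (h : IsBroken D 𝒯 v w₁ w₂) :
    ∃ B : ℝ, 0 ≤ B ∧ ∀ x, |w₁ x - w₂ x| ≤ B := by
  obtain ⟨M₁, hM₁, h₁⟩ := exists_bound_of_mem_linearSpace D.isCompact_closure_Ω h.mem₁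
  obtain ⟨M₂, hM₂, h₂⟩ := exists_bound_of_mem_linearSpace D.isCompact_closure_Ω h.mem₂
  exact ⟨M₁ + M₂, by positivity, fun x => (abs_sub _ _).trans (add_le_add (h₁ x) (h₂ x))⟩

theorem IsBroken.measurable_jump (h : IsBroken D 𝒯 v w₁ w₂) :
    Measurable fun x => w₁ x - w₂ x :=
  (measurable_of_mem_linearSpace h.mem₁).sub (measurable_of_mem_linearSpace h.mem₂)

theorem IsBroken.integrable_inner_mul_jump (h : IsBroken D 𝒯 v w₁ w₂) (s : ℝ) (m : Plane)
    (T : Finset Plane) :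
    IntegrableOn (fun x => inner ℝ (D.normal s x) m * (w₁ x - w₂ x)) (interfacePart D T) μH[1] := by
  obtain ⟨B, hB0, hB⟩ := h.exists_jump_bound
  refine Integrable.of_bound (C := (|s| * ‖m‖) * B) ?_ (Eventually.of_forall fun x => ?_)
  · exact (((D.measurable_normal s).inner measurable_const).mul
      h.measurable_jump).aestronglyMeasurable
  · rw [norm_mul]
    have : ‖D.normal s x‖ ≤ |s| := by
      rw [InterfaceDomain.normal, norm_smul, norm_smul, norm_inv, norm_norm, Real.norm_eq_abs]
      exact mul_le_of_le_one_right (abs_nonneg s) inv_mul_le_one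
    have h2 := (norm_inner_le_norm (𝕜 := ℝ) (D.normal s x) m)
    have h3 : ‖D.normal s x‖ * ‖m‖ ≤ |s| * ‖m‖ := by gcongr
    exact mul_le_mul (h2.trans h3) (hB x) (norm_nonneg _) (by positivity)

theorem IsBroken.integrable_jump_mul_jump (h : IsBroken D 𝒯 v w₁ w₂)
    (h' : IsBroken D 𝒯 v' w₁' w₂') (T : Finset Plane) :
    IntegrableOn (fun x => (w₁ x - w₂ x) * (w₁' x - w₂' x)) (interfacePart D T) μH[1] := by
  obtain ⟨B, hB0, hB⟩ := h.exists_jump_bound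
  obtain ⟨B', hB0', hB'⟩ := h'.exists_jump_bound
  refine Integrable.of_bound (C := B * B') ?_ (Eventually.of_forall fun x => ?_)
  · exact (h.measurable_jump.mul h'.measurable_jump).aestronglyMeasurable
  · rw [norm_mul]
    exact mul_le_mul (hB x) (hB' x) (norm_nonneg _) hB0

theorem ah_comm (D : InterfaceDomain) (𝒯 : Triangulation D.Ω) (s α₁ α₂ Ct : ℝ) (v w : Plane → ℝ) :
    ah D 𝒯 s α₁ α₂ Ct v w = ah D 𝒯 s α₁ α₂ Ct w v := by
  have h1 : ∀ x, inner ℝ (flux D α₁ α₂ v x) (gradient w x)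
      = inner ℝ (flux D α₁ α₂ w x) (gradient v x) := by
    intro x
    rw [flux, flux, real_inner_smul_left, real_inner_smul_left, real_inner_comm]
  unfold ah
  simp only [h1, mul_comm (D.jump v _) (D.jump w _)]
  ring

/-- Additivity is not formal, since jumps and means are values of `limUnder` and Bochner integrals
need integrability. For broken functions they equal explicit bounded expressions almost everywhere,
and these are additive. -/
theorem ah_add_left (hres : Resolves D 𝒯) (s α₁ α₂ Ct : ℝ) (h : IsBroken D 𝒯 v w₁ w₂)
    (h' : IsBroken D 𝒯 v' w₁' w₂') {z z₁ z₂ : Plane → ℝ} (hz : IsBroken D 𝒯 z z₁ z₂) :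
    ah D 𝒯 s α₁ α₂ Ct (v + v') z = ah D 𝒯 s α₁ α₂ Ct v z + ah D 𝒯 s α₁ α₂ Ct v' z := by
  have e1 : ∫ x in D.Ω₁ ∪ D.Ω₂, inner ℝ (flux D α₁ α₂ (v + v') x) (gradient z x)
      = (∫ x in D.Ω₁ ∪ D.Ω₂, inner ℝ (flux D α₁ α₂ v x) (gradient z x))
        + ∫ x in D.Ω₁ ∪ D.Ω₂, inner ℝ (flux D α₁ α₂ v' x) (gradient z x) := by
    rw [← integral_add (h.integrable_inner_flux hz α₁ α₂) (h'.integrable_inner_flux hz α₁ α₂)]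
    refine integral_congr_ae ?_
    filter_upwards [h.gradient_add h'] with x hx
    rw [flux, hx, smul_add, inner_add_left, flux, flux]
  have e2 : ∑ T ∈ interfaceElements D 𝒯, ∫ x in interfacePart D T,
        nitscheMean D s T (flux D α₁ α₂ (v + v')) x * D.jump z x ∂μH[1]
      = (∑ T ∈ interfaceElements D 𝒯, ∫ x in interfacePart D T,
        nitscheMean D s T (flux D α₁ α₂ v) x * D.jump z x ∂μH[1])
        + ∑ T ∈ interfaceElements D 𝒯, ∫ x in interfacePart D T,
        nitscheMean D s T (flux D α₁ α₂ v') x * D.jump z x ∂μH[1] := by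
    rw [← Finset.sum_add_distrib]
    refine Finset.sum_congr rfl fun T hT => ?_
    rw [(h.add h').setIntegral_nitscheMean_mul_jump hz hres s α₁ α₂ hT,
      h.setIntegral_nitscheMean_mul_jump hz hres s α₁ α₂ hT,
      h'.setIntegral_nitscheMean_mul_jump hz hres s α₁ α₂ hT,
      ← integral_add (hz.integrable_inner_mul_jump s _ T) (hz.integrable_inner_mul_jump s _ T)]
    refine integral_congr_ae (Eventually.of_forall fun x => ?_)
    simp only [meanFlux_add α₁ α₂ h.mem₁ h.mem₂ h'.mem₁ h'.mem₂ (mem_interfaceElements.1 hT).1,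
      inner_add_right, add_mul]
  have e3 : ∑ T ∈ interfaceElements D 𝒯, ∫ x in interfacePart D T,
        nitscheMean D s T (flux D α₁ α₂ z) x * D.jump (v + v') x ∂μH[1]
      = (∑ T ∈ interfaceElements D 𝒯, ∫ x in interfacePart D T,
        nitscheMean D s T (flux D α₁ α₂ z) x * D.jump v x ∂μH[1])
        + ∑ T ∈ interfaceElements D 𝒯, ∫ x in interfacePart D T,
        nitscheMean D s T (flux D α₁ α₂ z) x * D.jump v' x ∂μH[1] := by
    rw [← Finset.sum_add_distrib]
    refine Finset.sum_congr rfl fun T hT => ?_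
    rw [hz.setIntegral_nitscheMean_mul_jump (h.add h') hres s α₁ α₂ hT,
      hz.setIntegral_nitscheMean_mul_jump h hres s α₁ α₂ hT,
      hz.setIntegral_nitscheMean_mul_jump h' hres s α₁ α₂ hT,
      ← integral_add (h.integrable_inner_mul_jump s _ T) (h'.integrable_inner_mul_jump s _ T)]
    refine integral_congr_ae (Eventually.of_forall fun x => ?_)
    simp only [Pi.add_apply]
    ring
  have e4 : ∑ T ∈ interfaceElements D 𝒯, ∫ x in interfacePart D T,
        D.jump (v + v') x * D.jump z x ∂μH[1]
      = (∑ T ∈ interfaceElements D 𝒯, ∫ x in interfacePart D T, D.jump v x * D.jump z x ∂μH[1])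
        + ∑ T ∈ interfaceElements D 𝒯, ∫ x in interfacePart D T,
          D.jump v' x * D.jump z x ∂μH[1] := by
    rw [← Finset.sum_add_distrib]
    refine Finset.sum_congr rfl fun T hT => ?_
    rw [(h.add h').setIntegral_jump_mul_jump hz T, h.setIntegral_jump_mul_jump hz T,
      h'.setIntegral_jump_mul_jump hz T,
      ← integral_add (h.integrable_jump_mul_jump hz T) (h'.integrable_jump_mul_jump hz T)]
    refine integral_congr_ae (Eventually.of_forall fun x => ?_)
    simp only [Pi.add_apply]
    ring
  unfold ah
  rw [e1, e2, e3, e4]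
  ring

theorem ah_sub_left (hres : Resolves D 𝒯) (s α₁ α₂ Ct : ℝ) {v v' z : Plane → ℝ}
    (hv : v ∈ Vh D 𝒯) (hv' : v' ∈ Vh D 𝒯) (hz : z ∈ Vh D 𝒯) :
    ah D 𝒯 s α₁ α₂ Ct (v - v') z = ah D 𝒯 s α₁ α₂ Ct v z - ah D 𝒯 s α₁ α₂ Ct v' z := by
  obtain ⟨_, _, h⟩ := exists_isBroken ((Vh D 𝒯).sub_mem hv hv')
  obtain ⟨_, _, h'⟩ := exists_isBroken hv'
  obtain ⟨_, _, hz⟩ := exists_isBroken hz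
  have := ah_add_left hres s α₁ α₂ Ct h h' hz
  rw [sub_add_cancel] at this
  linarith

theorem ah_sub_right (hres : Resolves D 𝒯) (s α₁ α₂ Ct : ℝ) {v v' z : Plane → ℝ}
    (hv : v ∈ Vh D 𝒯) (hv' : v' ∈ Vh D 𝒯) (hz : z ∈ Vh D 𝒯) :
    ah D 𝒯 s α₁ α₂ Ct z (v - v') = ah D 𝒯 s α₁ α₂ Ct z v - ah D 𝒯 s α₁ α₂ Ct z v' := by
  rw [ah_comm, ah_sub_left hres s α₁ α₂ Ct hv hv' hz, ah_comm, ah_comm D 𝒯 s α₁ α₂ Ct v']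

end Broken


/-! ### Coercivity of the Nitsche form -/

/-- The squared broken `H¹` seminorm. -/
noncomputable def gradEnergy (D : InterfaceDomain) (v : Plane → ℝ) : ℝ :=
  ∫ x in D.Ω₁ ∪ D.Ω₂, ‖gradient v x‖ ^ 2

/-- The weighted sum of the squared `L²` norms of the jump over the interface elements. -/
noncomputable def jumpEnergy (D : InterfaceDomain) (𝒯 : Triangulation D.Ω)
    (w₁ w₂ : Plane → ℝ) : ℝ :=
  ∑ T ∈ interfaceElements D 𝒯,
    (size T)⁻¹ * ∫ x in interfacePart D T, (w₁ x - w₂ x) * (w₁ x - w₂ x) ∂μH[1]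

/-- The energy of a broken piecewise linear function on a triangle. -/
noncomputable def elemEnergy (D : InterfaceDomain) (w₁ w₂ : Plane → ℝ) (T : Finset Plane) : ℝ :=
  volume.real (tri T ∩ D.Ω₁) * ‖elemGrad w₁ T‖ ^ 2
    + volume.real (tri T ∩ D.Ω₂) * ‖elemGrad w₂ T‖ ^ 2

theorem jumpEnergy_nonneg (D : InterfaceDomain) (𝒯 : Triangulation D.Ω) (w₁ w₂ : Plane → ℝ) :
    0 ≤ jumpEnergy D 𝒯 w₁ w₂ :=
  Finset.sum_nonneg fun T _ => mul_nonneg (inv_nonneg.2 (size_nonneg T))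
    (integral_nonneg fun _ => mul_self_nonneg _)

theorem gradEnergy_nonneg (D : InterfaceDomain) (v : Plane → ℝ) : 0 ≤ gradEnergy D v :=
  integral_nonneg fun _ => by positivity

section Broken

variable {D : InterfaceDomain} {𝒯 : Triangulation D.Ω} {v w₁ w₂ : Plane → ℝ}

theorem IsBroken.integrable_norm_gradient_sq (h : IsBroken D 𝒯 v w₁ w₂) :
    IntegrableOn (fun x => ‖gradient v x‖ ^ 2) (D.Ω₁ ∪ D.Ω₂) := by
  have := h.integrable_inner_flux h 1 1
  simpa only [flux_one_one, real_inner_self_eq_norm_sq] using this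

theorem volume_real_interior_tri_inter (T : Finset Plane) (U : Set Plane) :
    volume.real (interior (tri T) ∩ U) = volume.real (tri T ∩ U) := by
  refine measureReal_congr ?_
  have h : interior (tri T) =ᵐ[volume] tri T :=
    interior_ae_eq_of_null_frontier ((convex_tri T).addHaar_frontier volume)
  exact h.inter (ae_eq_refl _)

theorem IsBroken.setIntegral_interior_tri (h : IsBroken D 𝒯 v w₁ w₂) {T : Finset Plane}
    (hT : T ∈ 𝒯.elements) :
    ∫ x in interior (tri T) ∩ (D.Ω₁ ∪ D.Ω₂), ‖gradient v x‖ ^ 2 = elemEnergy D w₁ w₂ T := by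
  have hsub : interior (tri T) ∩ (D.Ω₁ ∪ D.Ω₂) ⊆ D.Ω₁ ∪ D.Ω₂ := inter_subset_right
  have hint := h.integrable_norm_gradient_sq.mono_set hsub
  rw [inter_union_distrib_left] at hint ⊢
  have hm₁ : MeasurableSet (interior (tri T) ∩ D.Ω₁) :=
    (isOpen_interior.inter D.isOpen_Ω₁).measurableSet
  have hm₂ : MeasurableSet (interior (tri T) ∩ D.Ω₂) :=
    (isOpen_interior.inter D.isOpen_Ω₂).measurableSet
  have hdisj : Disjoint (interior (tri T) ∩ D.Ω₁) (interior (tri T) ∩ D.Ω₂) := by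
    refine Set.disjoint_left.2 fun x hx hx' => ?_
    exact lt_asymm hx.2.2 hx'.2.2
  rw [setIntegral_union hdisj hm₂ (hint.mono_set subset_union_left)
    (hint.mono_set subset_union_right)]
  have e₁ : ∫ x in interior (tri T) ∩ D.Ω₁, ‖gradient v x‖ ^ 2
      = ∫ x in interior (tri T) ∩ D.Ω₁, ‖elemGrad w₁ T‖ ^ 2 :=
    setIntegral_congr_fun hm₁ fun x hx => by
      simp only [(h.hasGradientAt₁ hT hx.1 hx.2.2).gradient]
  have e₂ : ∫ x in interior (tri T) ∩ D.Ω₂, ‖gradient v x‖ ^ 2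
      = ∫ x in interior (tri T) ∩ D.Ω₂, ‖elemGrad w₂ T‖ ^ 2 :=
    setIntegral_congr_fun hm₂ fun x hx => by
      simp only [(h.hasGradientAt₂ hT hx.1 hx.2.2).gradient]
  rw [e₁, e₂, setIntegral_const, setIntegral_const, smul_eq_mul, smul_eq_mul,
    volume_real_interior_tri_inter, volume_real_interior_tri_inter, elemEnergy]

/-- Triangles have disjoint interiors, so the element energies sum to an integral over a part of Ω₁
∪ Ω₂. -/
theorem IsBroken.sum_elemEnergy_le (h : IsBroken D 𝒯 v w₁ w₂) :
    ∑ T ∈ interfaceElements D 𝒯, elemEnergy D w₁ w₂ T ≤ gradEnergy D v := by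
  have hel : ∀ T ∈ interfaceElements D 𝒯, T ∈ 𝒯.elements := fun T hT =>
    (mem_interfaceElements.1 hT).1
  have hsum : ∑ T ∈ interfaceElements D 𝒯, elemEnergy D w₁ w₂ T
      = ∫ x in ⋃ T ∈ interfaceElements D 𝒯, interior (tri T) ∩ (D.Ω₁ ∪ D.Ω₂),
        ‖gradient v x‖ ^ 2 := by
    rw [integral_biUnion_finset]
    · exact Finset.sum_congr rfl fun T hT => (h.setIntegral_interior_tri (hel T hT)).symm
    · exact fun T _ => isOpen_interior.measurableSet.inter (measurableSet_Ω₁_union_Ω₂ D)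
    · intro T hT T' hT' hne
      exact (𝒯.disjoint_interior (hel T hT) (hel T' hT') hne).mono inter_subset_left
        inter_subset_left
    · exact fun T _ => h.integrable_norm_gradient_sq.mono_set inter_subset_right
  rw [hsum]
  refine setIntegral_mono_set h.integrable_norm_gradient_sq
    (Eventually.of_forall fun x => by positivity) ?_
  exact (iUnion₂_subset fun T _ => inter_subset_right).eventuallyLE

/-! ### Weighted fluxes and the inverse inequality -/

theorem areaFraction_nonneg (T : Finset Plane) (U : Set Plane) : 0 ≤ areaFraction T U :=
  div_nonneg measureReal_nonneg measureReal_nonneg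

theorem areaFraction_le_one (T : Finset Plane) (U : Set Plane) : areaFraction T U ≤ 1 :=
  div_le_one_of_le₀ (measureReal_mono inter_subset_left (volume_tri_lt_top T).ne) measureReal_nonneg

/-- This is the purpose of the area weights: the left side carries k_m² |T|, the energy on T ∩ Ω_m
carries k_m |T|, and k_m² ≤ k_m. No lower bound on the size of the pieces is needed. -/
theorem norm_meanFlux_sq_mul_volume_le {α₁ α₂ α : ℝ} (h₁ : |α₁| ≤ α) (h₂ : |α₂| ≤ α)
    {T : Finset Plane} (hT : 0 < volume.real (tri T)) :
    ‖meanFlux α₁ α₂ D w₁ w₂ T‖ ^ 2 * volume.real (tri T) ≤ 2 * α ^ 2 * elemEnergy D w₁ w₂ T := by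
  have hα : 0 ≤ α := (abs_nonneg _).trans h₁
  set k₁ := areaFraction T D.Ω₁ with hk₁
  set k₂ := areaFraction T D.Ω₂ with hk₂
  set g₁ := ‖elemGrad w₁ T‖
  set g₂ := ‖elemGrad w₂ T‖
  have e₁ : volume.real (tri T ∩ D.Ω₁) = k₁ * volume.real (tri T) :=
    (div_mul_cancel₀ _ hT.ne').symm
  have e₂ : volume.real (tri T ∩ D.Ω₂) = k₂ * volume.real (tri T) :=
    (div_mul_cancel₀ _ hT.ne').symm
  have hk₁0 : 0 ≤ k₁ := areaFraction_nonneg _ _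
  have hk₂0 : 0 ≤ k₂ := areaFraction_nonneg _ _
  have hk₁1 : k₁ ≤ 1 := areaFraction_le_one _ _
  have hk₂1 : k₂ ≤ 1 := areaFraction_le_one _ _
  have hg₁ : 0 ≤ g₁ := norm_nonneg _
  have hg₂ : 0 ≤ g₂ := norm_nonneg _
  have hn : ‖meanFlux α₁ α₂ D w₁ w₂ T‖ ≤ α * (k₁ * g₁ + k₂ * g₂) := by
    refine (norm_add_le _ _).trans ?_
    rw [norm_smul, norm_smul, norm_smul, norm_smul, Real.norm_of_nonneg hk₁0,
      Real.norm_of_nonneg hk₂0, Real.norm_eq_abs, Real.norm_eq_abs]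
    calc k₁ * (|α₁| * g₁) + k₂ * (|α₂| * g₂) ≤ k₁ * (α * g₁) + k₂ * (α * g₂) := by gcongr
      _ = _ := by ring
  have hsq : (k₁ * g₁ + k₂ * g₂) ^ 2 ≤ 2 * (k₁ * g₁ ^ 2 + k₂ * g₂ ^ 2) := by
    have h3 : (k₁ * g₁) ^ 2 ≤ k₁ * g₁ ^ 2 := by
      rw [mul_pow]
      gcongr
      nlinarith
    have h4 : (k₂ * g₂) ^ 2 ≤ k₂ * g₂ ^ 2 := by
      rw [mul_pow]
      gcongr
      nlinarith
    nlinarith [sq_nonneg (k₁ * g₁ - k₂ * g₂)]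
  calc ‖meanFlux α₁ α₂ D w₁ w₂ T‖ ^ 2 * volume.real (tri T)
      ≤ (α * (k₁ * g₁ + k₂ * g₂)) ^ 2 * volume.real (tri T) := by gcongr
    _ = α ^ 2 * volume.real (tri T) * (k₁ * g₁ + k₂ * g₂) ^ 2 := by ring
    _ ≤ α ^ 2 * volume.real (tri T) * (2 * (k₁ * g₁ ^ 2 + k₂ * g₂ ^ 2)) := by gcongr
    _ = _ := by rw [elemEnergy, e₁, e₂]; ring

/-- The inverse inequality for the mean flux. -/
theorem exists_inverse_inequality (D : InterfaceDomain) (σ : ℝ) : ∃ C : ℝ, 0 ≤ C ∧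
    ∀ (𝒯 : Triangulation D.Ω), 𝒯.Nondegenerate σ → ∀ T ∈ 𝒯.elements, ∀ α₁ α₂ α : ℝ,
    |α₁| ≤ α → |α₂| ≤ α → ∀ w₁ w₂ : Plane → ℝ,
    size T * (μH[1].real (interfacePart D T) * ‖meanFlux α₁ α₂ D w₁ w₂ T‖ ^ 2)
      ≤ C * α ^ 2 * elemEnergy D w₁ w₂ T := by
  obtain ⟨L, hL⟩ := D.exists_hausdorffMeasure_le
  -- `L` comes from the length of Γ_T, at most L h_T; 16σ² from h_T² ≤ 16σ² |T|; and 2 from the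
  -- bound for the mean flux.
  refine ⟨L * (16 * σ ^ 2) * 2, by positivity, fun 𝒯 hσ T hT α₁ α₂ α h₁ h₂ w₁ w₂ => ?_⟩
  have hlen : μH[1].real (interfacePart D T) ≤ L * size T := by
    have h := hL (tri T) (isCompact_tri T).isBounded
    rw [measureReal_def]
    refine ENNReal.toReal_le_of_le_ofReal (mul_nonneg L.coe_nonneg (size_nonneg T))
      (h.trans_eq ?_)
    rw [ENNReal.ofReal_mul L.coe_nonneg, ENNReal.ofReal_coe_nnreal, size]
  have hsz := hσ.size_sq_le hT
  have hv := hσ.volume_tri_pos hT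
  have hs := size_nonneg T
  have hm := norm_meanFlux_sq_mul_volume_le (D := D) (w₁ := w₁) (w₂ := w₂) h₁ h₂ hv
  calc size T * (μH[1].real (interfacePart D T) * ‖meanFlux α₁ α₂ D w₁ w₂ T‖ ^ 2)
      ≤ size T * (L * size T * ‖meanFlux α₁ α₂ D w₁ w₂ T‖ ^ 2) := by gcongr
    _ = L * size T ^ 2 * ‖meanFlux α₁ α₂ D w₁ w₂ T‖ ^ 2 := by ring
    _ ≤ L * (16 * σ ^ 2 * volume.real (tri T)) * ‖meanFlux α₁ α₂ D w₁ w₂ T‖ ^ 2 := by gcongr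
    _ = L * (16 * σ ^ 2) * (‖meanFlux α₁ α₂ D w₁ w₂ T‖ ^ 2 * volume.real (tri T)) := by ring
    _ ≤ L * (16 * σ ^ 2) * (2 * α ^ 2 * elemEnergy D w₁ w₂ T) := by gcongr
    _ = _ := by ring

/-- Young's inequality for the consistency term on one interface element. -/
theorem IsBroken.two_mul_abs_setIntegral_le (h : IsBroken D 𝒯 v w₁ w₂) {s : ℝ}
    (hs : s = 1 ∨ s = -1) (m : Plane) (T : Finset Plane) {η : ℝ} (hη : 0 < η) :
    2 * |∫ x in interfacePart D T, inner ℝ (D.normal s x) m * (w₁ x - w₂ x) ∂μH[1]|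
      ≤ η * (μH[1].real (interfacePart D T) * ‖m‖ ^ 2)
        + η⁻¹ * ∫ x in interfacePart D T, (w₁ x - w₂ x) * (w₁ x - w₂ x) ∂μH[1] := by
  have hint1 : IntegrableOn (fun _ : Plane => η * ‖m‖ ^ 2) (interfacePart D T) μH[1] :=
    integrableOn_const (hausdorffMeasure_interfacePart_lt_top D T).ne
  have hint2 := (h.integrable_jump_mul_jump h T).const_mul η⁻¹
  have hint3 := (h.integrable_inner_mul_jump s m T).norm.const_mul 2
  calc 2 * |∫ x in interfacePart D T, inner ℝ (D.normal s x) m * (w₁ x - w₂ x) ∂μH[1]|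
      ≤ 2 * ∫ x in interfacePart D T, ‖inner ℝ (D.normal s x) m * (w₁ x - w₂ x)‖ ∂μH[1] := by
        gcongr
        rw [← Real.norm_eq_abs]
        exact norm_integral_le_integral_norm _
    _ = ∫ x in interfacePart D T, 2 * ‖inner ℝ (D.normal s x) m * (w₁ x - w₂ x)‖ ∂μH[1] :=
        (integral_const_mul _ _).symm
    _ ≤ ∫ x in interfacePart D T,
          (η * ‖m‖ ^ 2 + η⁻¹ * ((w₁ x - w₂ x) * (w₁ x - w₂ x))) ∂μH[1] := by
        refine integral_mono hint3 (hint1.add hint2) fun x => ?_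
        have h1 : |inner ℝ (D.normal s x) m| ≤ ‖m‖ :=
          (abs_real_inner_le_norm _ _).trans
            (mul_le_of_le_one_left (norm_nonneg _) (D.norm_normal_le hs x))
        simp only [norm_mul, Real.norm_eq_abs]
        set j := |w₁ x - w₂ x| with hj
        have hjj : (w₁ x - w₂ x) * (w₁ x - w₂ x) = j ^ 2 := by rw [hj, sq_abs, sq]
        rw [hjj]
        have hj0 : 0 ≤ j := abs_nonneg _
        have h2 : 2 * (|inner ℝ (D.normal s x) m| * j) ≤ 2 * (‖m‖ * j) := by gcongr
        refine h2.trans ?_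
        have h3 : 0 ≤ η⁻¹ * (η * ‖m‖ - j) ^ 2 := by positivity
        have h4 : η⁻¹ * (η * ‖m‖ - j) ^ 2 = η * ‖m‖ ^ 2 + η⁻¹ * j ^ 2 - 2 * (‖m‖ * j) := by
          field_simp; ring
        linarith
    _ = _ := by
        rw [integral_add hint1 hint2, integral_const_mul η⁻¹, setIntegral_const, smul_eq_mul]
        ring

theorem IsBroken.min_mul_gradEnergy_le (h : IsBroken D 𝒯 v w₁ w₂) (α₁ α₂ : ℝ) :
    min α₁ α₂ * gradEnergy D v
      ≤ ∫ x in D.Ω₁ ∪ D.Ω₂, inner ℝ (flux D α₁ α₂ v x) (gradient v x) := by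
  rw [gradEnergy, ← integral_const_mul]
  refine integral_mono (h.integrable_norm_gradient_sq.const_mul _)
    (h.integrable_inner_flux h α₁ α₂) fun x => ?_
  simp only [flux, real_inner_smul_left, real_inner_self_eq_norm_sq]
  gcongr
  unfold InterfaceDomain.coeff
  split_ifs
  · exact min_le_left _ _
  · exact min_le_right _ _

/-- Coercivity of the Nitsche form for sufficiently large stabilisation. -/
theorem exists_coercive (D : InterfaceDomain) {α₁ α₂ : ℝ} (hα₁ : 0 < α₁) (hα₂ : 0 < α₂)
    (σ κ : ℝ) : ∃ C₀ : ℝ, 0 < C₀ ∧ ∃ c : ℝ, 0 < c ∧ ∀ Ct : ℝ, C₀ ≤ Ct →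
      ∀ s : ℝ, (s = 1 ∨ s = -1) → ∀ 𝒯 : Triangulation D.Ω, 𝒯.Nondegenerate σ →
      (∀ T ∈ interfaceElements D 𝒯, 𝒯.meshSize ≤ κ * size T) → Resolves D 𝒯 →
      ∀ v w₁ w₂ : Plane → ℝ, IsBroken D 𝒯 v w₁ w₂ →
      c * (gradEnergy D v + jumpEnergy D 𝒯 w₁ w₂) ≤ ah D 𝒯 s α₁ α₂ Ct v v := by
  obtain ⟨CI, hCI0, hCI⟩ := exists_inverse_inequality D σ
  set α := max α₁ α₂ with hα
  set β := min α₁ α₂ with hβ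
  have hαpos : 0 < α := lt_max_of_lt_left hα₁
  have hβpos : 0 < β := lt_min hα₁ hα₂
  -- Young parameter for which the consistency terms consume at most half of the ellipticity
  -- constant β; the 1 keeps the denominator positive when `CI` is 0.
  set θ := β / (2 * (CI * α ^ 2 + 1)) with hθ
  have hθpos : 0 < θ := by positivity
  have hθle : θ * (CI * α ^ 2) ≤ β / 2 := by
    rw [hθ, div_mul_eq_mul_div, div_le_iff₀ (by positivity)]
    nlinarith
  -- The penalty has to cover θ⁻¹ times the jump energy, spent in Young's inequality, and leave one
  -- more. The factor |κ| arises from h_T⁻¹ ≤ |κ| h⁻¹, and the last 1 makes C₀ positive.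
  set C₀ := ((θ⁻¹ + 1) * |κ| + 1) / α with hC₀
  refine ⟨C₀, by positivity, min (β / 2) 1, by positivity,
    fun Ct hCt s hs 𝒯 hσ hκ hres v w₁ w₂ h => ?_⟩
  set J : Finset Plane → ℝ := fun T =>
    ∫ x in interfacePart D T, (w₁ x - w₂ x) * (w₁ x - w₂ x) ∂μH[1] with hJ
  set X : Finset Plane → ℝ := fun T => ∫ x in interfacePart D T,
    inner ℝ (D.normal s x) (meanFlux α₁ α₂ D w₁ w₂ T) * (w₁ x - w₂ x) ∂μH[1] with hX
  have hJ0 : ∀ T, 0 ≤ J T := fun T => integral_nonneg fun x => mul_self_nonneg _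
  have hel : ∀ T ∈ interfaceElements D 𝒯, T ∈ 𝒯.elements := fun T hT =>
    (mem_interfaceElements.1 hT).1
  have hah : ah D 𝒯 s α₁ α₂ Ct v v
      = (∫ x in D.Ω₁ ∪ D.Ω₂, inner ℝ (flux D α₁ α₂ v x) (gradient v x))
        - 2 * (∑ T ∈ interfaceElements D 𝒯, X T)
        + Ct * 𝒯.meshSize⁻¹ * α * ∑ T ∈ interfaceElements D 𝒯, J T := by
    unfold ah
    rw [Finset.sum_congr rfl fun T hT =>
        h.setIntegral_nitscheMean_mul_jump h hres s α₁ α₂ hT,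
      Finset.sum_congr rfl fun T _ => h.setIntegral_jump_mul_jump h T]
    ring
  -- Young's inequality with parameter θ h_T, which matches the weight h_T of the inverse inequality
  -- and h_T⁻¹ of the jump energy.
  have hXle : ∀ T ∈ interfaceElements D 𝒯, 2 * X T ≤
      θ * (CI * α ^ 2 * elemEnergy D w₁ w₂ T) + θ⁻¹ * ((size T)⁻¹ * J T) := by
    intro T hT
    have hsz := 𝒯.size_pos (hel T hT)
    have h1 := h.two_mul_abs_setIntegral_le hs (meanFlux α₁ α₂ D w₁ w₂ T) T
      (mul_pos hθpos hsz)
    have h2 := hCI 𝒯 hσ T (hel T hT) α₁ α₂ α (by rw [abs_of_pos hα₁]; exact le_max_left _ _)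
      (by rw [abs_of_pos hα₂]; exact le_max_right _ _) w₁ w₂
    have h3 : X T ≤ |X T| := le_abs_self _
    have h4 := mul_le_mul_of_nonneg_left h2 hθpos.le
    rw [mul_inv, mul_assoc, mul_assoc] at h1
    linarith
  have hsumX : 2 * (∑ T ∈ interfaceElements D 𝒯, X T)
      ≤ β / 2 * gradEnergy D v + θ⁻¹ * jumpEnergy D 𝒯 w₁ w₂ := by
    rw [Finset.mul_sum]
    refine (Finset.sum_le_sum hXle).trans ?_
    rw [Finset.sum_add_distrib, ← Finset.mul_sum, ← Finset.mul_sum, ← Finset.mul_sum]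
    have h1 := h.sum_elemEnergy_le
    have h2 : θ * (CI * α ^ 2 * ∑ T ∈ interfaceElements D 𝒯, elemEnergy D w₁ w₂ T)
        ≤ θ * (CI * α ^ 2) * gradEnergy D v := by
      rw [← mul_assoc]; gcongr
    have h3 : θ * (CI * α ^ 2) * gradEnergy D v ≤ β / 2 * gradEnergy D v := by
      have := gradEnergy_nonneg D v
      gcongr
    have h4 : jumpEnergy D 𝒯 w₁ w₂ = ∑ T ∈ interfaceElements D 𝒯, (size T)⁻¹ * J T := rfl
    rw [h4]
    linarith
  have hlam : (θ⁻¹ + 1) * jumpEnergy D 𝒯 w₁ w₂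
      ≤ Ct * 𝒯.meshSize⁻¹ * α * ∑ T ∈ interfaceElements D 𝒯, J T := by
    rw [jumpEnergy, Finset.mul_sum, Finset.mul_sum]
    refine Finset.sum_le_sum fun T hT => ?_
    have hsz := 𝒯.size_pos (hel T hT)
    have hmesh : 0 < 𝒯.meshSize := hsz.trans_le (𝒯.size_le_meshSize (hel T hT))
    have h1 : (size T)⁻¹ ≤ |κ| * 𝒯.meshSize⁻¹ := by
      rw [← div_eq_mul_inv, le_div_iff₀ hmesh, inv_mul_le_iff₀ hsz, mul_comm]
      refine (hκ T hT).trans ?_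
      gcongr
      exact le_abs_self κ
    have h2 : (θ⁻¹ + 1) * |κ| ≤ Ct * α := by
      have : C₀ * α ≤ Ct * α := by gcongr
      rw [hC₀, div_mul_cancel₀ _ hαpos.ne'] at this
      linarith
    calc (θ⁻¹ + 1) * ((size T)⁻¹ * J T)
        ≤ (θ⁻¹ + 1) * (|κ| * 𝒯.meshSize⁻¹ * J T) := by
          have := hJ0 T
          gcongr
      _ = (θ⁻¹ + 1) * |κ| * (𝒯.meshSize⁻¹ * J T) := by ring
      _ ≤ Ct * α * (𝒯.meshSize⁻¹ * J T) := by
          have := hJ0 T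
          gcongr
      _ = _ := by ring
  have hgrad := h.min_mul_gradEnergy_le α₁ α₂
  have hg0 := gradEnergy_nonneg D v
  have hj0 := jumpEnergy_nonneg D 𝒯 w₁ w₂
  rw [hah, mul_add]
  have h1 : min (β / 2) 1 * gradEnergy D v ≤ β / 2 * gradEnergy D v := by
    gcongr; exact min_le_left _ _
  have h2 : min (β / 2) 1 * jumpEnergy D 𝒯 w₁ w₂ ≤ 1 * jumpEnergy D 𝒯 w₁ w₂ := by
    gcongr; exact min_le_right _ _
  linarith

end Broken


/-! ### The mesh dependent norm -/

theorem enorm_sq_eq_ofReal {E : Type*} [SeminormedAddCommGroup E] (x : E) :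
    ‖x‖ₑ ^ 2 = ENNReal.ofReal (‖x‖ ^ 2) := by
  rw [← ofReal_norm, ENNReal.ofReal_pow (norm_nonneg _)]

/-- Perturbing a family by a convergent one changes its limit, or the default value standing for it
if there is none, by at most the norm of the limit of the perturbation. -/
theorem enorm_limUnder_le_add {l : Filter ℝ} [l.NeBot] {f g h : ℝ → ℝ} {L : ℝ}
    (hh : h =ᶠ[l] fun r => f r + g r) (hg : Tendsto g l (𝓝 L)) :
    ‖limUnder l h‖ₑ ≤ ‖limUnder l f‖ₑ + ‖L‖ₑ := by
  by_cases hf : ∃ a, Tendsto f l (𝓝 a)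
  · obtain ⟨a, ha⟩ := hf
    rw [ha.limUnder_eq, ((ha.add hg).congr' hh.symm).limUnder_eq]
    exact enorm_add_le _ _
  -- If f has no limit, neither has h; `limUnder` then makes its default choice from the same empty
  -- predicate, so the two values agree.
  · have hh' : ∀ a, ¬ Tendsto h l (𝓝 a) := by
      intro a ha
      refine hf ⟨a - L, (ha.sub hg).congr' ?_⟩
      filter_upwards [hh] with r hr
      rw [hr]; ring
    have e1 : (fun a => map f l ≤ 𝓝 a) = fun _ => False := by
      ext a; exact iff_false_intro fun h => hf ⟨a, h⟩
    have e2 : (fun a => map h l ≤ 𝓝 a) = fun _ => False := by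
      ext a; exact iff_false_intro fun h => hh' a h
    have : limUnder l h = limUnder l f := by
      unfold limUnder lim
      rw [e1, e2]
    rw [this]
    exact le_self_add

theorem ENNReal.add_sq_le_two_mul (a b : ℝ≥0∞) : (a + b) ^ 2 ≤ 2 * a ^ 2 + 2 * b ^ 2 := by
  have := ENNReal.rpow_add_le_mul_rpow_add_rpow a b (p := 2) (by norm_num)
  rwa [show (2 : ℝ) - 1 = 1 by norm_num, ENNReal.rpow_one, ENNReal.rpow_two, ENNReal.rpow_two,
    ENNReal.rpow_two, mul_add] at this

theorem setAverage_add {E : Type*} [NormedAddCommGroup E] [NormedSpace ℝ E] {μ : Measure Plane}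
    {S : Set Plane} {f g : Plane → E} (hf : IntegrableOn f S μ) (hg : IntegrableOn g S μ) :
    ⨍ x in S, (f x + g x) ∂μ = (⨍ x in S, f x ∂μ) + ⨍ x in S, g x ∂μ := by
  rw [setAverage_eq, setAverage_eq, setAverage_eq, integral_add hf hg, smul_add]

theorem setLIntegral_biUnion_finset_le {ι : Type*} (s : Finset ι) (t : ι → Set Plane)
    (μ : Measure Plane) (f : Plane → ℝ≥0∞) :
    ∫⁻ x in ⋃ i ∈ s, t i, f x ∂μ ≤ ∑ i ∈ s, ∫⁻ x in t i, f x ∂μ := by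
  classical
  induction s using Finset.induction_on with
  | empty => simp
  | insert a s ha ih =>
    rw [Finset.set_biUnion_insert, Finset.sum_insert ha]
    exact (lintegral_union_le _ _ _).trans (add_le_add le_rfl ih)

section Broken

variable {D : InterfaceDomain} {𝒯 : Triangulation D.Ω} {v w₁ w₂ : Plane → ℝ}

theorem IsBroken.lintegral_gradient (h : IsBroken D 𝒯 v w₁ w₂) :
    ∫⁻ x in D.Ω₁ ∪ D.Ω₂, ‖gradient v x‖ₑ ^ 2 = ENNReal.ofReal (gradEnergy D v) := by
  rw [gradEnergy, ofReal_integral_eq_lintegral_ofReal h.integrable_norm_gradient_sq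
    (Eventually.of_forall fun _ => by positivity)]
  simp only [enorm_sq_eq_ofReal]

theorem IsBroken.lintegral_jump (h : IsBroken D 𝒯 v w₁ w₂) (T : Finset Plane) :
    ∫⁻ x in interfacePart D T, ‖w₁ x - w₂ x‖ₑ ^ 2 ∂μH[1] = ENNReal.ofReal
      (∫ x in interfacePart D T, (w₁ x - w₂ x) * (w₁ x - w₂ x) ∂μH[1]) := by
  rw [ofReal_integral_eq_lintegral_ofReal (h.integrable_jump_mul_jump h T)
    (Eventually.of_forall fun _ => mul_self_nonneg _)]
  simp only [enorm_sq_eq_ofReal, Real.norm_eq_abs, sq_abs]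
  simp only [sq]

theorem IsBroken.sum_lintegral_jump (h : IsBroken D 𝒯 v w₁ w₂) :
    ∑ T ∈ interfaceElements D 𝒯, ENNReal.ofReal (size T)⁻¹ *
      ∫⁻ x in interfacePart D T, ‖w₁ x - w₂ x‖ₑ ^ 2 ∂μH[1]
      = ENNReal.ofReal (jumpEnergy D 𝒯 w₁ w₂) := by
  rw [jumpEnergy, ENNReal.ofReal_sum_of_nonneg]
  · refine Finset.sum_congr rfl fun T _ => ?_
    rw [h.lintegral_jump, ENNReal.ofReal_mul (inv_nonneg.2 (size_nonneg T))]
  · exact fun T _ => mul_nonneg (inv_nonneg.2 (size_nonneg T))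
      (integral_nonneg fun _ => mul_self_nonneg _)

/-- The interface is covered by its parts in the interface elements, up to finitely many points. -/
theorem Resolves.exists_cover (hres : Resolves D 𝒯) :
    ∃ V : Finset Plane, D.Γ ⊆ (⋃ T ∈ interfaceElements D 𝒯, interfacePart D T) ∪ V := by
  classical
  refine ⟨𝒯.elements.biUnion id, fun x hx => ?_⟩
  obtain ⟨T, hT, hxT⟩ := 𝒯.exists_mem_tri (subset_closure hx.1)
  by_cases hI : T ∈ interfaceElements D 𝒯
  · exact Or.inl (mem_biUnion (x := T) hI ⟨hx, hxT⟩)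
  · refine Or.inr ?_
    have := hres.2 T hT hI ⟨hx, hxT⟩
    simp only [Finset.coe_biUnion, id]
    exact mem_biUnion (x := T) (Finset.mem_coe.2 hT) this

/-- The Poincaré inequality has the unweighted jump; since h_T is at most the diameter d of the
domain, the weight h_T⁻¹ of the jump energy costs only a factor d. -/
theorem exists_lintegral_sq_le_energy (D : InterfaceDomain) : ∃ C : ℝ≥0, ∀ (𝒯 : Triangulation D.Ω),
    Resolves D 𝒯 → ∀ (v w₁ w₂ : Plane → ℝ), IsBroken D 𝒯 v w₁ w₂ →
    (∀ x ∈ frontier D.Ω, v x = 0) →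
    ∫⁻ x in D.Ω, ‖v x‖ₑ ^ 2
      ≤ C * ENNReal.ofReal (gradEnergy D v + jumpEnergy D 𝒯 w₁ w₂) := by
  obtain ⟨C, hC⟩ := exists_poincare D
  set d : ℝ := Metric.diam (closure D.Ω) with hd
  have hd0 : 0 ≤ d := Metric.diam_nonneg
  refine ⟨C * (1 + Real.toNNReal d), fun 𝒯 hres v w₁ w₂ h hbd => (hC 𝒯 v w₁ w₂ h hbd).trans ?_⟩
  obtain ⟨V, hV⟩ := hres.exists_cover
  have hΓ : ∫⁻ x in D.Γ, ‖w₁ x - w₂ x‖ₑ ^ 2 ∂μH[1]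
      ≤ ENNReal.ofReal d * ENNReal.ofReal (jumpEnergy D 𝒯 w₁ w₂) := by
    have hV0 : μH[1] (V : Set Plane) = 0 := by
      have := Measure.nullSingletonClass_hausdorff Plane (d := 1) one_pos
      exact V.finite_toSet.measure_zero _
    calc ∫⁻ x in D.Γ, ‖w₁ x - w₂ x‖ₑ ^ 2 ∂μH[1]
        ≤ ∫⁻ x in (⋃ T ∈ interfaceElements D 𝒯, interfacePart D T) ∪ V,
            ‖w₁ x - w₂ x‖ₑ ^ 2 ∂μH[1] := lintegral_mono_set hV
      _ ≤ (∫⁻ x in ⋃ T ∈ interfaceElements D 𝒯, interfacePart D T, ‖w₁ x - w₂ x‖ₑ ^ 2 ∂μH[1])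
            + ∫⁻ x in V, ‖w₁ x - w₂ x‖ₑ ^ 2 ∂μH[1] := lintegral_union_le _ _ _
      _ = ∫⁻ x in ⋃ T ∈ interfaceElements D 𝒯, interfacePart D T, ‖w₁ x - w₂ x‖ₑ ^ 2 ∂μH[1] := by
          rw [setLIntegral_measure_zero _ _ hV0, add_zero]
      _ ≤ ∑ T ∈ interfaceElements D 𝒯, ∫⁻ x in interfacePart D T, ‖w₁ x - w₂ x‖ₑ ^ 2 ∂μH[1] :=
          setLIntegral_biUnion_finset_le _ _ _ _
      _ ≤ ∑ T ∈ interfaceElements D 𝒯, ENNReal.ofReal d * (ENNReal.ofReal (size T)⁻¹ *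
            ∫⁻ x in interfacePart D T, ‖w₁ x - w₂ x‖ₑ ^ 2 ∂μH[1]) := by
          refine Finset.sum_le_sum fun T hT => ?_
          have hel := (mem_interfaceElements.1 hT).1
          have hsz := 𝒯.size_pos hel
          have hle : size T ≤ d :=
            Metric.diam_mono (𝒯.tri_subset hel) D.isCompact_closure_Ω.isBounded
          rw [← mul_assoc, ← ENNReal.ofReal_mul hd0]
          refine le_mul_of_one_le_left zero_le ?_
          rw [ENNReal.one_le_ofReal, ← div_eq_mul_inv]
          exact (one_le_div hsz).2 hle
      _ = ENNReal.ofReal d * ENNReal.ofReal (jumpEnergy D 𝒯 w₁ w₂) := by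
          rw [← Finset.mul_sum, h.sum_lintegral_jump]
  rw [h.lintegral_gradient, ENNReal.ofReal_add (gradEnergy_nonneg D v)
    (jumpEnergy_nonneg D 𝒯 w₁ w₂), ENNReal.coe_mul, mul_assoc]
  gcongr
  refine (add_le_add le_rfl hΓ).trans ?_
  rw [ENNReal.coe_add, ENNReal.coe_one, ENNReal.ofNNReal_toNNReal, add_mul, one_mul, mul_add]
  rw [add_assoc]
  gcongr
  rw [← add_assoc]
  exact le_add_self

/-- The inverse inequality with unit coefficients, summed over T: for broken functions the gradient
controls the middle term of the mesh dependent norm. -/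
theorem IsBroken.exists_sum_lintegral_mean_le (D : InterfaceDomain) (σ : ℝ) : ∃ C : ℝ≥0,
    ∀ (𝒯 : Triangulation D.Ω), 𝒯.Nondegenerate σ → ∀ s : ℝ, (s = 1 ∨ s = -1) →
    ∀ v w₁ w₂ : Plane → ℝ, IsBroken D 𝒯 v w₁ w₂ →
    ∑ T ∈ interfaceElements D 𝒯, ENNReal.ofReal (size T) * ∫⁻ x in interfacePart D T,
      ‖inner ℝ (D.normal s x) (meanFlux 1 1 D w₁ w₂ T)‖ₑ ^ 2 ∂μH[1]
      ≤ C * ENNReal.ofReal (gradEnergy D v) := by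
  obtain ⟨C, hC0, hC⟩ := exists_inverse_inequality D σ
  refine ⟨Real.toNNReal C, fun 𝒯 hσ s hs v w₁ w₂ h => ?_⟩
  have hT : ∀ T ∈ interfaceElements D 𝒯, ENNReal.ofReal (size T) * ∫⁻ x in interfacePart D T,
      ‖inner ℝ (D.normal s x) (meanFlux 1 1 D w₁ w₂ T)‖ₑ ^ 2 ∂μH[1]
      ≤ ENNReal.ofReal (C * elemEnergy D w₁ w₂ T) := by
    intro T hT
    have h1 : ∫⁻ x in interfacePart D T,
        ‖inner ℝ (D.normal s x) (meanFlux 1 1 D w₁ w₂ T)‖ₑ ^ 2 ∂μH[1]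
        ≤ ENNReal.ofReal (μH[1].real (interfacePart D T) * ‖meanFlux 1 1 D w₁ w₂ T‖ ^ 2) := by
      calc _ ≤ ∫⁻ x in interfacePart D T, ENNReal.ofReal (‖meanFlux 1 1 D w₁ w₂ T‖ ^ 2) ∂μH[1] := by
            refine lintegral_mono fun x => ?_
            rw [enorm_sq_eq_ofReal]
            refine ENNReal.ofReal_le_ofReal ?_
            gcongr
            exact (norm_inner_le_norm _ _).trans
              (mul_le_of_le_one_left (norm_nonneg _) (D.norm_normal_le hs x))
        _ = _ := by
            rw [setLIntegral_const, ENNReal.ofReal_mul measureReal_nonneg, measureReal_def,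
              ENNReal.ofReal_toReal (hausdorffMeasure_interfacePart_lt_top D T).ne, mul_comm]
    calc _ ≤ ENNReal.ofReal (size T) * ENNReal.ofReal
            (μH[1].real (interfacePart D T) * ‖meanFlux 1 1 D w₁ w₂ T‖ ^ 2) := by gcongr
      _ = ENNReal.ofReal (size T *
            (μH[1].real (interfacePart D T) * ‖meanFlux 1 1 D w₁ w₂ T‖ ^ 2)) :=
          (ENNReal.ofReal_mul (size_nonneg T)).symm
      _ ≤ _ := by
          refine ENNReal.ofReal_le_ofReal ?_
          have := hC 𝒯 hσ T (mem_interfaceElements.1 hT).1 1 1 1 (by simp) (by simp) w₁ w₂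
          simpa using this
  have hE0 : ∀ T, 0 ≤ elemEnergy D w₁ w₂ T := fun T => by unfold elemEnergy; positivity
  refine (Finset.sum_le_sum hT).trans ?_
  rw [← ENNReal.ofReal_sum_of_nonneg fun T _ => mul_nonneg hC0 (hE0 T), ← Finset.mul_sum,
    ENNReal.ofNNReal_toNNReal, ← ENNReal.ofReal_mul hC0]
  exact ENNReal.ofReal_le_ofReal (by have := h.sum_elemEnergy_le; gcongr)

theorem meshNorm_sq (D : InterfaceDomain) (𝒯 : Triangulation D.Ω) (s : ℝ) (v : Plane → ℝ)
    (G : Plane → Plane) : meshNorm D 𝒯 s v G ^ 2 =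
    (∫⁻ x in D.Ω₁ ∪ D.Ω₂, ‖G x‖ₑ ^ 2)
    + (∑ T ∈ interfaceElements D 𝒯, ENNReal.ofReal (size T) *
        ∫⁻ x in interfacePart D T, ‖nitscheMean D s T G x‖ₑ ^ 2 ∂μH[1])
    + ∑ T ∈ interfaceElements D 𝒯, ENNReal.ofReal (size T)⁻¹ *
        ∫⁻ x in interfacePart D T, ‖D.jump v x‖ₑ ^ 2 ∂μH[1] := by
  rw [meshNorm, ← ENNReal.rpow_two, ← ENNReal.rpow_mul]
  norm_num

theorem IsBroken.integrable_gradient (h : IsBroken D 𝒯 v w₁ w₂) :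
    IntegrableOn (gradient v) (D.Ω₁ ∪ D.Ω₂) := by
  obtain ⟨B, hB⟩ := h.exists_gradient_bound
  exact Integrable.of_bound (measurable_gradient v).aestronglyMeasurable B hB

/-- Measurability is asked of g alone: f will be a jump or mean of an error, defined by pointwise
limits. -/
theorem lintegral_sq_le_of_le_add {μ : Measure Plane} {f g h : Plane → ℝ≥0∞} (hg : Measurable g)
    (hle : ∀ᵐ x ∂μ, h x ≤ f x + g x) :
    ∫⁻ x, h x ^ 2 ∂μ ≤ 2 * ∫⁻ x, f x ^ 2 ∂μ + 2 * ∫⁻ x, g x ^ 2 ∂μ := by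
  calc ∫⁻ x, h x ^ 2 ∂μ ≤ ∫⁻ x, (2 * f x ^ 2 + 2 * g x ^ 2) ∂μ := by
        refine lintegral_mono_ae ?_
        filter_upwards [hle] with x hx
        exact (pow_le_pow_left' hx 2).trans (ENNReal.add_sq_le_two_mul _ _)
    _ = _ := by
        rw [lintegral_add_right _ ((hg.pow_const 2).const_mul 2),
          lintegral_const_mul' _ _ (by simp),
          lintegral_const_mul' _ _ (by simp)]

/-- Changing a function by a broken piecewise linear function changes its mesh dependent norm by at
most a multiple of the energy of the latter. -/
theorem exists_meshNorm_sq_le (D : InterfaceDomain) (σ : ℝ) : ∃ C : ℝ≥0,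
    ∀ 𝒯 : Triangulation D.Ω, 𝒯.Nondegenerate σ → Resolves D 𝒯 → ∀ s : ℝ, (s = 1 ∨ s = -1) →
    ∀ e w₁ w₂ : Plane → ℝ, IsBroken D 𝒯 e w₁ w₂ → ∀ (f f' : Plane → ℝ) (G G' : Plane → Plane),
    IntegrableOn f D.Ω → IntegrableOn G (D.Ω₁ ∪ D.Ω₂) → (∀ x, f' x = f x + e x) →
    (∀ᵐ x ∂(volume.restrict (D.Ω₁ ∪ D.Ω₂)), G' x = G x + gradient e x) →
    meshNorm D 𝒯 s f' G' ^ 2 ≤ 2 * meshNorm D 𝒯 s f G ^ 2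
      + C * ENNReal.ofReal (gradEnergy D e + jumpEnergy D 𝒯 w₁ w₂) := by
  obtain ⟨C, hC⟩ := IsBroken.exists_sum_lintegral_mean_le D σ
  refine ⟨2 * (1 + C), fun 𝒯 hσ hres s hs e w₁ w₂ he f f' G G' hf hG hf' hG' => ?_⟩
  have hvol : ∫⁻ x in D.Ω₁ ∪ D.Ω₂, ‖G' x‖ₑ ^ 2 ≤ 2 * (∫⁻ x in D.Ω₁ ∪ D.Ω₂, ‖G x‖ₑ ^ 2)
      + 2 * ∫⁻ x in D.Ω₁ ∪ D.Ω₂, ‖gradient e x‖ₑ ^ 2 := by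
    refine lintegral_sq_le_of_le_add (measurable_gradient e).enorm ?_
    filter_upwards [hG'] with x hx
    rw [hx]; exact enorm_add_le _ _
  have hjump : ∀ T ∈ interfaceElements D 𝒯,
      ∫⁻ x in interfacePart D T, ‖D.jump f' x‖ₑ ^ 2 ∂μH[1]
        ≤ 2 * (∫⁻ x in interfacePart D T, ‖D.jump f x‖ₑ ^ 2 ∂μH[1])
          + 2 * ∫⁻ x in interfacePart D T, ‖w₁ x - w₂ x‖ₑ ^ 2 ∂μH[1] := by
    intro T hT
    refine lintegral_sq_le_of_le_add he.measurable_jump.enorm ?_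
    filter_upwards [ae_restrict_mem (measurableSet_interfacePart D T)] with x hx
    -- f need not have traces at x; the jump of e exists, and this suffices.
    refine enorm_limUnder_le_add (Eventually.of_forall fun r => ?_) (he.tendsto_jump hx.1)
    have hei : IntegrableOn e D.Ω := he.memLp.integrable (by norm_num)
    have hs₁ : Metric.ball x r ∩ D.Ω₁ ⊆ D.Ω := fun z hz => hz.2.1
    have hs₂ : Metric.ball x r ∩ D.Ω₂ ⊆ D.Ω := fun z hz => hz.2.1
    simp only [hf']
    rw [setAverage_add (hf.mono_set hs₁) (hei.mono_set hs₁),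
      setAverage_add (hf.mono_set hs₂) (hei.mono_set hs₂)]
    ring
  have hmean : ∀ T ∈ interfaceElements D 𝒯,
      ∫⁻ x in interfacePart D T, ‖nitscheMean D s T G' x‖ₑ ^ 2 ∂μH[1]
        ≤ 2 * (∫⁻ x in interfacePart D T, ‖nitscheMean D s T G x‖ₑ ^ 2 ∂μH[1])
          + 2 * ∫⁻ x in interfacePart D T,
            ‖inner ℝ (D.normal s x) (meanFlux 1 1 D w₁ w₂ T)‖ₑ ^ 2 ∂μH[1] := by
    intro T hT
    refine lintegral_sq_le_of_le_add
      ((D.measurable_normal s).inner measurable_const).enorm ?_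
    filter_upwards [(hres.1 T hT).ae_mem_interior] with x hx
    refine enorm_limUnder_le_add (Eventually.of_forall fun r => ?_)
      (he.tendsto_normalMean s 1 1 (mem_interfaceElements.1 hT).1 hx.1 hx.2)
    have hei := he.integrable_gradient
    have hs₁ : Metric.ball x r ∩ D.Ω₁ ⊆ D.Ω₁ ∪ D.Ω₂ := fun z hz => Or.inl hz.2
    have hs₂ : Metric.ball x r ∩ D.Ω₂ ⊆ D.Ω₁ ∪ D.Ω₂ := fun z hz => Or.inr hz.2
    have e₁ : ⨍ z in Metric.ball x r ∩ D.Ω₁, G' z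
        = (⨍ z in Metric.ball x r ∩ D.Ω₁, G z) + ⨍ z in Metric.ball x r ∩ D.Ω₁, gradient e z := by
      rw [← setAverage_add (hG.mono_set hs₁) (hei.mono_set hs₁)]
      exact average_congr (ae_restrict_of_ae_restrict_of_subset hs₁ hG')
    have e₂ : ⨍ z in Metric.ball x r ∩ D.Ω₂, G' z
        = (⨍ z in Metric.ball x r ∩ D.Ω₂, G z) + ⨍ z in Metric.ball x r ∩ D.Ω₂, gradient e z := by
      rw [← setAverage_add (hG.mono_set hs₂) (hei.mono_set hs₂)]
      exact average_congr (ae_restrict_of_ae_restrict_of_subset hs₂ hG')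
    dsimp only
    rw [e₁, e₂, flux_one_one, ← inner_add_right]
    congr 1
    module
  have hsum_mean : ∑ T ∈ interfaceElements D 𝒯, ENNReal.ofReal (size T) *
        ∫⁻ x in interfacePart D T, ‖nitscheMean D s T G' x‖ₑ ^ 2 ∂μH[1]
      ≤ 2 * (∑ T ∈ interfaceElements D 𝒯, ENNReal.ofReal (size T) *
        ∫⁻ x in interfacePart D T, ‖nitscheMean D s T G x‖ₑ ^ 2 ∂μH[1])
        + 2 * (C * ENNReal.ofReal (gradEnergy D e)) := by
    refine (Finset.sum_le_sum fun T hT => mul_le_mul_right (hmean T hT) _).trans ?_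
    refine le_trans (le_of_eq ?_) (add_le_add_right
      (mul_le_mul_right (hC 𝒯 hσ s hs e w₁ w₂ he) 2) _)
    rw [Finset.mul_sum, Finset.mul_sum, ← Finset.sum_add_distrib]
    exact Finset.sum_congr rfl fun T _ => by ring
  have hsum_jump : ∑ T ∈ interfaceElements D 𝒯, ENNReal.ofReal (size T)⁻¹ *
        ∫⁻ x in interfacePart D T, ‖D.jump f' x‖ₑ ^ 2 ∂μH[1]
      ≤ 2 * (∑ T ∈ interfaceElements D 𝒯, ENNReal.ofReal (size T)⁻¹ *
        ∫⁻ x in interfacePart D T, ‖D.jump f x‖ₑ ^ 2 ∂μH[1])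
        + 2 * ENNReal.ofReal (jumpEnergy D 𝒯 w₁ w₂) := by
    refine (Finset.sum_le_sum fun T hT => mul_le_mul_right (hjump T hT) _).trans ?_
    rw [← he.sum_lintegral_jump]
    refine le_of_eq ?_
    rw [Finset.mul_sum, Finset.mul_sum, ← Finset.sum_add_distrib]
    exact Finset.sum_congr rfl fun T _ => by ring
  rw [he.lintegral_gradient] at hvol
  rw [meshNorm_sq, meshNorm_sq]
  refine (add_le_add (add_le_add hvol hsum_mean) hsum_jump).trans ?_
  rw [ENNReal.ofReal_add (gradEnergy_nonneg D e) (jumpEnergy_nonneg D 𝒯 w₁ w₂)]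
  set A := ENNReal.ofReal (gradEnergy D e)
  set B := ENNReal.ofReal (jumpEnergy D 𝒯 w₁ w₂)
  push_cast
  -- The slack 2CB completes the common factor 2(1 + C) of A + B.
  refine le_trans (le_self_add (b := 2 * C * B)) (le_of_eq ?_)
  ring

end Broken


/-! ### Stability of the discrete problems and the error estimates -/

section Hilbert

variable {H : Type*} [NormedAddCommGroup H] [InnerProductSpace ℝ H]

/-- The combination of the two variational inequalities with the discrete state and co-state
equations. -/
theorem control_error_le {a : ℝ} {y p u yh ph uh yH pH yd : H}
    (h₁ : 0 ≤ inner ℝ (p + a • u) (uh - u)) (h₂ : 0 ≤ inner ℝ (ph + a • uh) (u - uh))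
    (h₃ : inner ℝ uh (ph - pH) - inner ℝ u (ph - pH)
      = inner ℝ (yh - yd) (yh - yH) - inner ℝ (y - yd) (yh - yH)) :
    a * ‖u - uh‖ ^ 2 + ‖y - yh‖ ^ 2 ≤ ‖p - pH‖ * ‖u - uh‖ + ‖y - yh‖ * ‖y - yH‖ := by
  have h₄ : inner ℝ (p - pH) (uh - u) ≤ ‖p - pH‖ * ‖u - uh‖ := by
    rw [norm_sub_rev u uh]; exact real_inner_le_norm _ _
  have h₅ : inner ℝ (y - yh) (y - yH) ≤ ‖y - yh‖ * ‖y - yH‖ := real_inner_le_norm _ _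
  -- The sum of h₁ and h₂ reads a‖u − u_h‖² ≤ (p − p_h, u_h − u). Split p − p_h at p^h: by h₃ the
  -- part with p^h − p_h equals −‖y − y_h‖² + (y − y_h, y − y^h).
  refine le_trans ?_ (add_le_add h₄ h₅)
  rw [← real_inner_self_eq_norm_sq, ← real_inner_self_eq_norm_sq]
  have c : ∀ x z : H, inner ℝ x z = inner ℝ z x := fun x z => real_inner_comm z x
  simp only [inner_add_left, inner_sub_left, inner_sub_right, real_inner_smul_left] at h₁ h₂ h₃ ⊢
  linarith [c ph uh, c ph u, c pH uh, c pH u, c p u, c p uh, c u uh, c y yh, c y yH, c y yd,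
    c yh yH, c yh yd, c yH yd]

end Hilbert

/-- In the unknowns a^{1/2} U and a^{-1/2} P the weight disappears, and Young's inequality bounds
the sum of squares. Hence a constant free of a. -/
theorem add_le_of_weighted_sq_le {a U Y P Z : ℝ} (ha : 0 < a) (hU : 0 ≤ U)
    (hP : 0 ≤ P) (hZ : 0 ≤ Z) (h : a * U ^ 2 + Y ^ 2 ≤ P * U + Y * Z) :
    a ^ (1 / 2 : ℝ) * U + Y ≤ 2 * (Z + a ^ (-(1 / 2) : ℝ) * P) := by
  set b := a ^ (1 / 2 : ℝ) with hb
  have hbpos : 0 < b := Real.rpow_pos_of_pos ha _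
  have hbb : b ^ 2 = a := by
    rw [hb, ← Real.rpow_natCast, ← Real.rpow_mul ha.le]; norm_num
  have hbi : a ^ (-(1 / 2) : ℝ) = b⁻¹ := Real.rpow_neg ha.le _
  rw [hbi]
  set A := b * U with hA
  set Q := b⁻¹ * P with hQ
  have hAQ : P * U = Q * A := by rw [hA, hQ]; field_simp
  have hAA : a * U ^ 2 = A ^ 2 := by rw [hA, mul_pow, hbb]
  rw [hAQ, hAA] at h
  have hA0 : 0 ≤ A := by positivity
  have hQ0 : 0 ≤ Q := by positivity
  have h1 : A ^ 2 + Y ^ 2 ≤ Q ^ 2 + Z ^ 2 := by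
    nlinarith [sq_nonneg (A - Q), sq_nonneg (Y - Z)]
  refine abs_le_of_sq_le_sq' ?_ (by positivity) |>.2
  nlinarith [sq_nonneg (A - Y), mul_nonneg hQ0 hZ]

/-! ### Stability of the scheme and its consequences in L²(Ω) and in the mesh dependent norm -/

section L2

variable {D : InterfaceDomain} {𝒯 : Triangulation D.Ω}

theorem l2inner_eq_inner {f g : Plane → ℝ} (hf : MemLp f 2 D.vol) (hg : MemLp g 2 D.vol) :
    D.l2inner f g = inner ℝ (hf.toLp f) (hg.toLp g) := by
  rw [L2.inner_def, InterfaceDomain.l2inner]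
  refine integral_congr_ae ?_
  filter_upwards [hf.coeFn_toLp, hg.coeFn_toLp] with x hx hx'
  rw [hx, hx']
  simp [mul_comm]

theorem l2norm_eq {f : Plane → ℝ} (hf : MemLp f 2 D.vol) :
    D.l2norm f = ENNReal.ofReal ‖hf.toLp f‖ := by
  rw [Lp.norm_toLp, ENNReal.ofReal_toReal hf.eLpNorm_ne_top, InterfaceDomain.l2norm]

theorem lintegral_eq_norm_toLp_sq {f : Plane → ℝ} (hf : MemLp f 2 D.vol) :
    ∫⁻ x in D.Ω, ‖f x‖ₑ ^ 2 = ENNReal.ofReal (‖hf.toLp f‖ ^ 2) := by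
  rw [ENNReal.ofReal_pow (norm_nonneg _), ← l2norm_eq hf, InterfaceDomain.l2norm]
  have h := eLpNorm_nnreal_pow_eq_lintegral (μ := D.vol) (f := f) (p := 2) two_ne_zero
  simp only [NNReal.coe_ofNat, ENNReal.rpow_two, ENNReal.coe_ofNat] at h
  rw [h]; rfl

theorem memLp_of_mem_Vh {v : Plane → ℝ} (hv : v ∈ Vh D 𝒯) : MemLp v 2 D.vol := by
  obtain ⟨_, _, h⟩ := exists_isBroken hv
  exact h.memLp

/-- Both loads contain the same terms with g, which cancel without any integrability. -/
theorem IsNitscheState.ah_sub (hres : Resolves D 𝒯) {s α₁ α₂ Ct : ℝ} {g u u' v v' w : Plane → ℝ}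
    (h : IsNitscheState D 𝒯 s α₁ α₂ Ct g u v) (h' : IsNitscheState D 𝒯 s α₁ α₂ Ct g u' v')
    (hw : w ∈ Vh D 𝒯) :
    ah D 𝒯 s α₁ α₂ Ct (v - v') w = D.l2inner u w - D.l2inner u' w := by
  rw [ah_sub_left hres s α₁ α₂ Ct h.1 h'.1 hw, h.2 w hw, h'.2 w hw, load, load]
  ring

theorem IsNitscheCostate.ah_sub (hres : Resolves D 𝒯) {s α₁ α₂ Ct : ℝ} {f f' q q' w : Plane → ℝ}
    (h : IsNitscheCostate D 𝒯 s α₁ α₂ Ct f q) (h' : IsNitscheCostate D 𝒯 s α₁ α₂ Ct f' q')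
    (hw : w ∈ Vh D 𝒯) :
    ah D 𝒯 s α₁ α₂ Ct w (q - q') = D.l2inner f w - D.l2inner f' w := by
  rw [ah_sub_right hres s α₁ α₂ Ct h.1 h'.1 hw, h.2 w hw, h'.2 w hw]

/-- Stability of the Nitsche scheme in the energy and `L²` norms. -/
theorem exists_stability (D : InterfaceDomain) {α₁ α₂ : ℝ} (hα₁ : 0 < α₁) (hα₂ : 0 < α₂)
    (σ κ : ℝ) : ∃ C₀ : ℝ, 0 < C₀ ∧ ∃ C : ℝ, 0 ≤ C ∧ ∀ Ct : ℝ, C₀ ≤ Ct →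
      ∀ s : ℝ, (s = 1 ∨ s = -1) → ∀ 𝒯 : Triangulation D.Ω, 𝒯.Nondegenerate σ →
      (∀ T ∈ interfaceElements D 𝒯, 𝒯.meshSize ≤ κ * size T) → Resolves D 𝒯 →
      ∀ (e : Plane → ℝ) (he : MemLp e 2 D.vol), e ∈ Vh D 𝒯 → ∀ f : Lp ℝ 2 D.vol,
      ah D 𝒯 s α₁ α₂ Ct e e = inner ℝ f (he.toLp e) →
      ‖he.toLp e‖ ≤ C * ‖f‖ ∧ ∃ w₁ w₂, IsBroken D 𝒯 e w₁ w₂ ∧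
        gradEnergy D e + jumpEnergy D 𝒯 w₁ w₂ ≤ C * ‖f‖ ^ 2 := by
  obtain ⟨C₀, hC₀, c, hc, hcoer⟩ := exists_coercive D hα₁ hα₂ σ κ
  obtain ⟨CP, hCP⟩ := exists_lintegral_sq_le_energy D
  -- Coercivity gives cQ ≤ FN and Poincaré gives N² ≤ CP · Q, hence N ≤ (CP/c) F and then Q ≤
  -- (CP/c²) F²; the sum serves both bounds.
  refine ⟨C₀, hC₀, CP / c + CP / c ^ 2, by positivity,
    fun Ct hCt s hs 𝒯 hσ hκ hres e he heV f hah => ?_⟩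
  obtain ⟨w₁, w₂, hb⟩ := exists_isBroken heV
  set Q := gradEnergy D e + jumpEnergy D 𝒯 w₁ w₂ with hQ
  have hQ0 : 0 ≤ Q := add_nonneg (gradEnergy_nonneg D e) (jumpEnergy_nonneg D 𝒯 w₁ w₂)
  set N := ‖he.toLp e‖ with hN
  have hN0 : 0 ≤ N := norm_nonneg _
  set F := ‖f‖ with hF
  have hF0 : 0 ≤ F := norm_nonneg _
  have h1 : c * Q ≤ F * N := by
    have := hcoer Ct hCt s hs 𝒯 hσ hκ hres e w₁ w₂ hb
    rw [hah] at this
    exact this.trans (real_inner_le_norm _ _)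
  have h2 : N ^ 2 ≤ CP * Q := by
    have := hCP 𝒯 hres e w₁ w₂ hb heV.2
    rw [lintegral_eq_norm_toLp_sq he, ← ENNReal.ofReal_coe_nnreal,
      ← ENNReal.ofReal_mul CP.coe_nonneg] at this
    exact (ENNReal.ofReal_le_ofReal_iff (by positivity)).1 this
  have hQle : Q ≤ F * N / c := by rw [le_div_iff₀ hc]; linarith
  have hNle : N ≤ CP / c * F := by
    rcases hN0.eq_or_lt with h0 | h0
    · rw [← h0]; positivity
    · have h3 : N * N ≤ CP / c * F * N := by
        calc N * N = N ^ 2 := by ring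
          _ ≤ CP * Q := h2
          _ ≤ CP * (F * N / c) := by gcongr
          _ = _ := by ring
      exact le_of_mul_le_mul_right h3 h0
  refine ⟨hNle.trans ?_, w₁, w₂, hb, ?_⟩
  · gcongr
    have : (0 : ℝ) ≤ CP / c ^ 2 := by positivity
    linarith
  · calc Q ≤ F * N / c := hQle
      _ ≤ F * (CP / c * F) / c := by gcongr
      _ = CP / c ^ 2 * F ^ 2 := by field_simp
      _ ≤ _ := by
        gcongr
        have : (0 : ℝ) ≤ CP / c := by positivity
        linarith

/-- As C ≥ 2 + K ≥ 1, also C² ≥ 2 + K, so no square root enters the constant. -/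
theorem le_mul_add_of_sq_le {X M N : ℝ≥0∞} {K C : ℝ≥0} (h : X ^ 2 ≤ 2 * M ^ 2 + K * N ^ 2)
    (hC : 2 + K ≤ C) : X ≤ C * (M + N) := by
  have h1 : X ^ 2 ≤ (C * (M + N)) ^ 2 := by
    refine h.trans ?_
    have hC' : (2 : ℝ≥0∞) + K ≤ C := by exact_mod_cast hC
    have h1C : (1 : ℝ≥0∞) ≤ C := le_trans (by norm_num) (le_self_add.trans hC')
    calc 2 * M ^ 2 + K * N ^ 2 ≤ (2 + K) * (M + N) ^ 2 := by
          have : (2 + (K : ℝ≥0∞)) * (M + N) ^ 2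
              = 2 * M ^ 2 + K * N ^ 2
                + (4 * M * N + 2 * N ^ 2 + K * M ^ 2 + 2 * K * M * N) := by ring
          rw [this]; exact le_self_add
      _ ≤ (C * C) * (M + N) ^ 2 := by
          gcongr
          exact hC'.trans (le_mul_of_one_le_left zero_le h1C)
      _ = _ := by ring
  exact (ENNReal.pow_le_pow_left_iff two_ne_zero).1 h1

theorem integrable_sub_gradient {G : Plane → Plane} (hG : MemLp G 2 D.vol) {v w₁ w₂ : Plane → ℝ}
    (h : IsBroken D 𝒯 v w₁ w₂) : IntegrableOn (fun x => G x - gradient v x) (D.Ω₁ ∪ D.Ω₂) := by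
  have h1 : IntegrableOn G D.Ω := hG.integrable (by norm_num)
  exact (h1.mono_set (union_subset (fun x hx => hx.1) fun x hx => hx.1)).sub h.integrable_gradient

/-- Comparison of the mesh dependent norms of the errors of two discrete functions. -/
theorem meshNorm_sub_le {C₁ : ℝ≥0} {C₂ : ℝ} (hC₂ : 0 ≤ C₂) {s : ℝ} {y v v' w₁ w₂ : Plane → ℝ}
    {G : Plane → Plane} {N : ℝ} (hN : 0 ≤ N)
    (hy : MemLp y 2 D.vol) (hG : MemLp G 2 D.vol) (hv : v ∈ Vh D 𝒯) (hv' : v' ∈ Vh D 𝒯)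
    (he : IsBroken D 𝒯 (v - v') w₁ w₂)
    (hE : gradEnergy D (v - v') + jumpEnergy D 𝒯 w₁ w₂ ≤ C₂ * N ^ 2)
    (hmesh : ∀ (f f' : Plane → ℝ) (G G' : Plane → Plane),
      IntegrableOn f D.Ω → IntegrableOn G (D.Ω₁ ∪ D.Ω₂) → (∀ x, f' x = f x + (v - v') x) →
      (∀ᵐ x ∂(volume.restrict (D.Ω₁ ∪ D.Ω₂)), G' x = G x + gradient (v - v') x) →
      meshNorm D 𝒯 s f' G' ^ 2 ≤ 2 * meshNorm D 𝒯 s f G ^ 2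
        + C₁ * ENNReal.ofReal (gradEnergy D (v - v') + jumpEnergy D 𝒯 w₁ w₂))
    {C : ℝ≥0} (hC : 2 + C₁ * Real.toNNReal C₂ ≤ C) :
    meshNorm D 𝒯 s (fun x => y x - v' x) (fun x => G x - gradient v' x)
      ≤ C * (meshNorm D 𝒯 s (fun x => y x - v x) (fun x => G x - gradient v x)
        + ENNReal.ofReal N) := by
  obtain ⟨a₁, a₂, ha⟩ := exists_isBroken hv
  obtain ⟨b₁, b₂, hb⟩ := exists_isBroken hv'
  have h1 := hmesh (fun x => y x - v x) (fun x => y x - v' x) (fun x => G x - gradient v x)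
    (fun x => G x - gradient v' x) ((hy.sub ha.memLp).integrable (by norm_num))
    (integrable_sub_gradient hG ha) (fun x => by simp) (by
      have h2 := he.gradient_add hb
      rw [sub_add_cancel] at h2
      filter_upwards [h2] with x hx
      rw [hx]; abel)
  refine le_mul_add_of_sq_le (K := C₁ * Real.toNNReal C₂) (h1.trans ?_) hC
  refine add_le_add le_rfl ?_
  rw [ENNReal.coe_mul, mul_assoc]
  refine mul_le_mul' le_rfl ?_
  rw [← ENNReal.ofReal_pow hN, ENNReal.ofNNReal_toNNReal, ← ENNReal.ofReal_mul hC₂]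
  exact ENNReal.ofReal_le_ofReal hE

end L2

end NitscheXFEM

/-! ### The four error estimates -/

open NitscheXFEM

theorem theorem4p1 (D : NitscheXFEM.InterfaceDomain) (α₁ α₂ : ℝ) (hα₁ : 0 < α₁) (hα₂ : 0 < α₂)
    (σ κ : ℝ) :
    ∃ C₀ : ℝ, 0 < C₀ ∧ ∃ C : ℝ≥0,
      ∀ Ct : ℝ, C₀ ≤ Ct → ∀ s : ℝ, (s = 1 ∨ s = -1) →
      ∀ 𝒯 : NitscheXFEM.Triangulation D.Ω, 𝒯.Nondegenerate σ →
        (∀ T ∈ NitscheXFEM.interfaceElements D 𝒯, 𝒯.meshSize ≤ κ * NitscheXFEM.size T) →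
        NitscheXFEM.Resolves D 𝒯 →
      ∀ a : ℝ, 0 < a → ∀ yd ua ub g : NitscheXFEM.Plane → ℝ,
        MemLp yd 2 D.vol → MemLp ua 2 D.vol → MemLp ub 2 D.vol → D.MemHHalf g →
      ∀ (y : NitscheXFEM.Plane → ℝ) (Gy : NitscheXFEM.Plane → NitscheXFEM.Plane)
        (p : NitscheXFEM.Plane → ℝ) (Gp : NitscheXFEM.Plane → NitscheXFEM.Plane)
        (u : NitscheXFEM.Plane → ℝ),
        D.IsOptimal α₁ α₂ a yd ua ub g y Gy p Gp u →
      ∀ yh ph uh : NitscheXFEM.Plane → ℝ,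
        NitscheXFEM.IsDiscreteOptimal D 𝒯 s α₁ α₂ Ct a yd ua ub g yh ph uh →
      ∀ yH pH : NitscheXFEM.Plane → ℝ,
        NitscheXFEM.IsNitscheState D 𝒯 s α₁ α₂ Ct g u yH →
        NitscheXFEM.IsNitscheCostate D 𝒯 s α₁ α₂ Ct (fun x => y x - yd x) pH →
        (ENNReal.ofReal (a ^ (1 / 2 : ℝ)) * D.l2norm (fun x => u x - uh x)
              + D.l2norm (fun x => y x - yh x)
            ≤ C * (D.l2norm (fun x => y x - yH x)
              + ENNReal.ofReal (a ^ (-(1 / 2) : ℝ)) * D.l2norm (fun x => p x - pH x)))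
        ∧ (D.l2norm (fun x => p x - ph x)
            ≤ C * (D.l2norm (fun x => p x - pH x) + D.l2norm (fun x => y x - yh x)))
        ∧ (NitscheXFEM.meshNorm D 𝒯 s (fun x => y x - yh x) (fun x => Gy x - gradient yh x)
            ≤ C * (NitscheXFEM.meshNorm D 𝒯 s
                (fun x => y x - yH x) (fun x => Gy x - gradient yH x)
              + D.l2norm (fun x => u x - uh x)))
        ∧ (NitscheXFEM.meshNorm D 𝒯 s (fun x => p x - ph x) (fun x => Gp x - gradient ph x)
            ≤ C * (NitscheXFEM.meshNorm D 𝒯 s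
                (fun x => p x - pH x) (fun x => Gp x - gradient pH x)
              + D.l2norm (fun x => y x - yh x))) := by
  obtain ⟨C₀, hC₀, C₂, hC₂, hstab⟩ := exists_stability D hα₁ hα₂ σ κ
  obtain ⟨C₁, hmesh⟩ := exists_meshNorm_sq_le D σ
  -- The first estimate needs C ≥ 2, the second C ≥ 1 and C ≥ C₂, and the mesh dependent ones C ≥ 2
  -- + C₁C₂.
  refine ⟨C₀, hC₀, (2 + C₁ * Real.toNNReal C₂) + Real.toNNReal C₂, ?_⟩
  intro Ct hCt s hs 𝒯 hσ hκ hres a ha yd ua ub g hyd _ _ _ y Gy p Gp u hopt yh ph uh hdis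
    yH pH hyH hpH
  set C : ℝ≥0 := (2 + C₁ * Real.toNNReal C₂) + Real.toNNReal C₂ with hC
  have hCge : 2 + C₁ * Real.toNNReal C₂ ≤ C := le_self_add
  have hC2 : (2 : ℝ) ≤ C := by
    have : (2 : ℝ≥0) ≤ C := le_self_add.trans hCge
    exact_mod_cast this
  have hCC₂ : C₂ ≤ C := by
    have : Real.toNNReal C₂ ≤ C := le_add_self
    exact (Real.le_coe_toNNReal C₂).trans (by exact_mod_cast this)
  have hy := hopt.mem_y.1
  have hp := hopt.mem_p.1
  have hu := hopt.mem_u.1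
  have huh := hdis.mem_u.1
  have hyhV := hdis.state.1
  have hphV := hdis.costate.1
  have hyh := memLp_of_mem_Vh hyhV
  have hph := memLp_of_mem_Vh hphV
  have hyHm := memLp_of_mem_Vh hyH.1
  have hpHm := memLp_of_mem_Vh hpH.1
  have hdy := (Vh D 𝒯).sub_mem hyH.1 hyhV
  have hdp := (Vh D 𝒯).sub_mem hpH.1 hphV
  -- the differences of the discrete solutions
  have hey : ah D 𝒯 s α₁ α₂ Ct (yH - yh) (yH - yh)
      = inner ℝ (hu.toLp u - huh.toLp uh) ((hyHm.sub hyh).toLp (yH - yh)) := by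
    rw [hyH.ah_sub hres hdis.state hdy, inner_sub_left, l2inner_eq_inner hu (hyHm.sub hyh),
      l2inner_eq_inner huh (hyHm.sub hyh)]
  have lyd (w : Plane → ℝ) (hw : MemLp w 2 D.vol) : D.l2inner (fun x => y x - yd x) w
      = inner ℝ (hy.toLp y - hyd.toLp yd) (hw.toLp w) := l2inner_eq_inner (hy.sub hyd) hw
  have lyhd (w : Plane → ℝ) (hw : MemLp w 2 D.vol) : D.l2inner (fun x => yh x - yd x) w
      = inner ℝ (hyh.toLp yh - hyd.toLp yd) (hw.toLp w) := l2inner_eq_inner (hyh.sub hyd) hw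
  have hep : ah D 𝒯 s α₁ α₂ Ct (pH - ph) (pH - ph)
      = inner ℝ (hy.toLp y - hyh.toLp yh) ((hpHm.sub hph).toLp (pH - ph)) := by
    rw [hpH.ah_sub hres hdis.costate hdp, lyd _ (hpHm.sub hph), lyhd _ (hpHm.sub hph),
      ← inner_sub_left, sub_sub_sub_cancel_right]
  obtain ⟨-, y₁, y₂, hyb, hyE⟩ := hstab Ct hCt s hs 𝒯 hσ hκ hres _ (hyHm.sub hyh) hdy _ hey
  obtain ⟨hpN, p₁, p₂, hpb, hpE⟩ := hstab Ct hCt s hs 𝒯 hσ hκ hres _ (hpHm.sub hph) hdp _ hep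
  have nu : D.l2norm (fun x => u x - uh x) = ENNReal.ofReal ‖hu.toLp u - huh.toLp uh‖ :=
    l2norm_eq (hu.sub huh)
  have ny : D.l2norm (fun x => y x - yh x) = ENNReal.ofReal ‖hy.toLp y - hyh.toLp yh‖ :=
    l2norm_eq (hy.sub hyh)
  have nyH : D.l2norm (fun x => y x - yH x) = ENNReal.ofReal ‖hy.toLp y - hyHm.toLp yH‖ :=
    l2norm_eq (hy.sub hyHm)
  have np : D.l2norm (fun x => p x - ph x) = ENNReal.ofReal ‖hp.toLp p - hph.toLp ph‖ :=
    l2norm_eq (hp.sub hph)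
  have npH : D.l2norm (fun x => p x - pH x) = ENNReal.ofReal ‖hp.toLp p - hpHm.toLp pH‖ :=
    l2norm_eq (hp.sub hpHm)
  refine ⟨?_, ?_, ?_, ?_⟩
  · have h₁ : 0 ≤ inner ℝ (hp.toLp p + a • hu.toLp u) (huh.toLp uh - hu.toLp u) :=
      (hopt.variational uh hdis.mem_u).trans_eq
        (l2inner_eq_inner (hp.add (hu.const_mul a)) (huh.sub hu))
    have h₂ : 0 ≤ inner ℝ (hph.toLp ph + a • huh.toLp uh) (hu.toLp u - huh.toLp uh) :=
      (hdis.variational u hopt.mem_u).trans_eq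
        (l2inner_eq_inner (hph.add (huh.const_mul a)) (hu.sub huh))
    have h₃ : inner ℝ (huh.toLp uh) (hph.toLp ph - hpHm.toLp pH)
        - inner ℝ (hu.toLp u) (hph.toLp ph - hpHm.toLp pH)
        = inner ℝ (hyh.toLp yh - hyd.toLp yd) (hyh.toLp yh - hyHm.toLp yH)
          - inner ℝ (hy.toLp y - hyd.toLp yd) (hyh.toLp yh - hyHm.toLp yH) := by
      -- The number a_h(y_h − y^h, p_h − p^h) is computed twice, from the state and from the
      -- co-state equations.
      have e₁ := hdis.state.ah_sub hres hyH ((Vh D 𝒯).sub_mem hphV hpH.1)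
      have e₂ := hdis.costate.ah_sub hres hpH ((Vh D 𝒯).sub_mem hyhV hyH.1)
      rw [e₁, l2inner_eq_inner huh (hph.sub hpHm), l2inner_eq_inner hu (hph.sub hpHm),
        lyhd _ (hyh.sub hyHm), lyd _ (hyh.sub hyHm)] at e₂
      exact e₂
    have h := add_le_of_weighted_sq_le ha (norm_nonneg _) (norm_nonneg _) (norm_nonneg _)
      (control_error_le h₁ h₂ h₃)
    have ha1 : 0 ≤ a ^ (1 / 2 : ℝ) := (Real.rpow_pos_of_pos ha _).le
    have ha2 : 0 ≤ a ^ (-(1 / 2) : ℝ) := (Real.rpow_pos_of_pos ha _).le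
    rw [nu, ny, nyH, npH, ← ENNReal.ofReal_mul ha1, ← ENNReal.ofReal_mul ha2,
      ← ENNReal.ofReal_add (by positivity) (by positivity),
      ← ENNReal.ofReal_add (by positivity) (by positivity), ← ENNReal.ofReal_coe_nnreal,
      ← ENNReal.ofReal_mul C.coe_nonneg]
    refine ENNReal.ofReal_le_ofReal (h.trans ?_)
    gcongr
  · rw [np, npH, ny, ← ENNReal.ofReal_add (norm_nonneg _) (norm_nonneg _),
      ← ENNReal.ofReal_coe_nnreal, ← ENNReal.ofReal_mul C.coe_nonneg]
    refine ENNReal.ofReal_le_ofReal ?_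
    have hpN' : ‖hpHm.toLp pH - hph.toLp ph‖ ≤ C₂ * ‖hy.toLp y - hyh.toLp yh‖ := hpN
    have htri := norm_sub_le_norm_sub_add_norm_sub (hp.toLp p) (hpHm.toLp pH) (hph.toLp ph)
    calc ‖hp.toLp p - hph.toLp ph‖
        ≤ 1 * ‖hp.toLp p - hpHm.toLp pH‖ + C₂ * ‖hy.toLp y - hyh.toLp yh‖ := by linarith
      _ ≤ C * ‖hp.toLp p - hpHm.toLp pH‖ + C * ‖hy.toLp y - hyh.toLp yh‖ := by
          gcongr
          linarith
      _ = _ := by ring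
  · rw [nu]
    exact meshNorm_sub_le hC₂ (norm_nonneg _) hy hopt.mem_y.2.1 hyH.1 hyhV hyb hyE
      (hmesh 𝒯 hσ hres s hs _ _ _ hyb) hCge
  · rw [ny]
    exact meshNorm_sub_le hC₂ (norm_nonneg _) hp hopt.mem_p.2.1 hpH.1 hphV hpb hpE
      (hmesh 𝒯 hσ hres s hs _ _ _ hpb) hCge
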